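/- **Setting.** Let $n\ge 3$ and let $(M^n,g)$ be a smooth, compact, connected Riemannian manifold without boundary, with Riemannian distance $d_g$. Let $H^1(M)$ be the completion of $C^\infty(M)$ for $\|u\|_2+\|\nabla u\|_2$. Let $r>0$ (for example, smaller than the injectivity radius) and let $\chi\in C^\infty(\mathbb R)$ satisfy $\chi(t)=1$ for $|t|\le r/2$ and $\chi(t)=0$ for $|t|\ge r$. Let $(x_\varepsilon)_{\varepsilon>0}$ be points of $M$ with $x_\varepsilon\to x_0$ and let $\mu_\varepsilon>0$ with $\mu_\varepsilon\to 0$ as $\varepsilon\to 0$. Let $2^\star=\frac{2n}{n-2}$, let $D^{1,2}(\mathbb R^n)$ be the completion of $C^\infty_c(\mathbb R^n)$ for $\|\nabla u\|_2$, and let $\Sigma$ be the set of $V\in D^{1,2}(\mathbb R^n)\setminus\{0\}$ which solve $-\sum_i\partial_i^2V=|V|^{2^\star-2}V$ weakly. Elements of $\Sigma$ are functions modulo equality almost everywhere. A chart $\varphi$ is *normal* at $p$ if, in this chart, $g_{ij}(p)=\delta_{ij}$ and $\partial_kg_{ij}(p)=0$. A *family of normal charts* is a family $(\varphi_\varepsilon)_{\varepsilon\ge0}$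 of smooth charts defined on a common open neighbourhood $U$ of $\{d_g(\cdot,x_0)\le r\}$, with $\varphi_\varepsilon$ normal at $x_\varepsilon$ for all small $\varepsilon>0$ and $\varphi_\varepsilon\to\varphi_0$ in $C^k_{loc}(U)$ for all $k$. A family $(B_\varepsilon)_{\varepsilon>0}$ in $H^1(M)$ is a *family of bubbles centered at $x_\varepsilon$ with radius $\mu_\varepsilon$ and modeled on $V\in\Sigma$ through $(\varphi_\varepsilon)$* if $(\varphi_\varepsilon)$ is a family of normal charts and $$B_\varepsilon-\chi(d_g(\cdot,x_\varepsilon))\,\mu_\varepsilon^{-\frac{n-2}2}\,V\Big(\frac{\varphi_\varepsilon(\cdot)-\varphi_\varepsilon(x_\varepsilon)}{\mu_\varepsilon}\Big)\to0\quad\text{in }H^1(M)\text{ as }\varepsilon\to0;$$ it is *modeled on $V$* if this holds for some $(\varphi_\varepsilon)$. For $n\ge5$, if $B$ is modeled on $V$ through $(\varphi_\varepsilon)$, put $$\mathrm{Weyl}_g\otimes B=\mathrm{W}(\varphi_0,V):=\frac{4n}{3(n-2)^2}\Big(\int_{\mathbb R^n}|V|^{2^\star}\Big)^{-1}\int_{\mathbb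 R^n}\mathrm{Weyl}_g(x_0)_{i\alpha j\beta}\,y^\alpha y^\beta\,\partial^2_{ij}V\Big(\tfrac{n-2}2V+y^l\partial_lV\Big)dy,$$ where repeated indices are summed, $V$ stands for its $C^2$ representative, and the coordinates of the Weyl tensor are those in the chart $\varphi_0$. **Proposition.** 1. Let $(\varphi_\varepsilon)$ and $(\bar\varphi_\varepsilon)$ be families of normal charts. Then $D(\varphi_\varepsilon\circ\bar\varphi_\varepsilon^{-1})(\bar\varphi_\varepsilon(x_\varepsilon))$ converges, as $\varepsilon\to0$, to some $O\in O(n)$, and the following hold for this $O$. * If $B$ and $\bar B$ are families of bubbles centered at $x_\varepsilon$ with radius $\mu_\varepsilon$, modeled on $V$ through $(\varphi_\varepsilon)$ and on $\bar V$ through $(\bar\varphi_\varepsilon)$ respectively, then $$B_\varepsilon-\bar B_\varepsilon\to0\ \text{ in }H^1(M)\iff\bar V=V\circ O,$$ and if $n\ge5$ and $B_\varepsilon-\bar B_\varepsilon\to0$ in $H^1(M)$, then $\mathrm W(\bar\varphi_0,\bar V)=\mathrm W(\varphi_0,V)$. * A family $B$ is a family of bubbles modeled on $V$ through $(\varphi_\varepsilon)$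 if and only if it is one modeled on $V\circ O$ through $(\bar\varphi_\varepsilon)$. * If $n\ge5$ and $V\in\Sigma$, then $\mathrm W(\bar\varphi_0,V\circ O)=\mathrm W(\varphi_0,V)$. 2. If $B$ and $\bar B$ are families of bubbles centered at $x_\varepsilon$ with radius $\mu_\varepsilon$, modeled on $V$ and $\bar V$, and $B_\varepsilon-\bar B_\varepsilon\to0$ in $H^1(M)$, then $\bar V=V\circ O$ for some $O\in O(n)$. 3. If $B$ is a family of bubbles centered at $x_\varepsilon$ with radius $\mu_\varepsilon$ modeled on $V$, then $B$ is also modeled on $\bar V$ if and only if $\bar V=V\circ O$ for some $O\in O(n)$. -/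

import Mathlib

open Set Filter Topology MeasureTheory Bundle Manifold
open scoped ENNReal NNReal ContDiff

noncomputable section

namespace BubbleFamilies

/-- The Euclidean space `ℝⁿ`. -/
abbrev Euc (n : ℕ) : Type := EuclideanSpace ℝ (Fin n)

/-! ### Finite-energy solutions of the Yamabe equation on `ℝⁿ` -/

/-- The critical Sobolev exponent `2⋆ = 2n / (n - 2)`. -/
def twoStar (n : ℕ) : ℝ := 2 * (n : ℝ) / ((n : ℝ) - 2)

/-- `V ∈ D^{1,2}(ℝⁿ)` with gradient `G`: the completion of `C_c^∞(ℝⁿ)` for `u ↦ ‖∇u‖₂`, realised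
(by the Sobolev embedding `D^{1,2} ⊂ L^{2⋆}`) as a space of functions in `L^{2⋆}`. -/
structure HasD12Gradient {n : ℕ} (V : Euc n → ℝ) (G : Euc n → Euc n) : Prop where
  memLp : MemLp V (ENNReal.ofReal (twoStar n)) volume
  memLp_grad : MemLp G 2 volume
  approx : ∃ u : ℕ → Euc n → ℝ,
    (∀ k, ContDiff ℝ ∞ (u k) ∧ HasCompactSupport (u k)) ∧
    Tendsto (fun k => eLpNorm (fun y => u k y - V y) (ENNReal.ofReal (twoStar n)) volume)
      atTop (𝓝 0) ∧
    Tendsto (fun k => eLpNorm (fun y => gradient (u k) y - G y) 2 volume) atTop (𝓝 0)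

/-- The set `Σ` of non-zero `V ∈ D^{1,2}(ℝⁿ)` solving `Δ_ξ V = |V|^{2⋆ - 2} V` weakly, where
`Δ_ξ = - ∑ ∂ᵢ²`. Its elements are functions considered up to equality almost everywhere. -/
def SigmaSol (n : ℕ) : Set (Euc n → ℝ) :=
  {V | ∃ G : Euc n → Euc n, HasD12Gradient V G ∧ ¬ (V =ᵐ[volume] fun _ => 0) ∧
    ∀ ψ : Euc n → ℝ, ContDiff ℝ ∞ ψ → HasCompactSupport ψ →
      ∫ y, inner ℝ (G y) (gradient ψ y) = ∫ y, |V y| ^ (twoStar n - 2) * V y * ψ y}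

open Classical in
/-- The `C²` representative of a class of functions modulo equality almost everywhere (unique, by
continuity, when it exists), and `0` if there is none. -/
def c2Rep {n : ℕ} (V : Euc n → ℝ) : Euc n → ℝ :=
  if h : ∃ W : Euc n → ℝ, ContDiff ℝ 2 W ∧ W =ᵐ[volume] V then h.choose else fun _ => 0

/-- The partial derivative `∂ᵢ f` on `ℝⁿ`. -/
def pd {n : ℕ} (i : Fin n) (f : Euc n → ℝ) (y : Euc n) : ℝ :=
  fderiv ℝ f y (EuclideanSpace.single i 1)

/-! ### Curvature in coordinates

`g` is a matrix-valued function on (an open subset of) `ℝⁿ`, the metric in a chart. -/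

section Coordinates

variable {n : ℕ}

/-- Christoffel symbols `Γ^k_{ij}`. -/
def christoffel (g : Euc n → Matrix (Fin n) (Fin n) ℝ) (k i j : Fin n) (y : Euc n) : ℝ :=
  (1 / 2) * ∑ l, (g y)⁻¹ k l *
    (pd i (fun z => g z j l) y + pd j (fun z => g z i l) y - pd l (fun z => g z i j) y)

/-- The coefficients `R^m_{jkl}` of `R(∂ₖ,∂ₗ)∂ⱼ = ∇ₖ∇ₗ∂ⱼ - ∇ₗ∇ₖ∂ⱼ`. -/
def riemannUp (g : Euc n → Matrix (Fin n) (Fin n) ℝ) (m j k l : Fin n) (y : Euc n) : ℝ :=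
  pd k (christoffel g m l j) y - pd l (christoffel g m k j) y +
    ∑ s, (christoffel g m k s y * christoffel g s l j y -
      christoffel g m l s y * christoffel g s k j y)

/-- The Riemann tensor `R_{ijkl}`, with the sign for which a metric of constant curvature `1` has
`R_{ijkl} = g_{ik} g_{jl} - g_{il} g_{jk}`. -/
def riemann (g : Euc n → Matrix (Fin n) (Fin n) ℝ) (i j k l : Fin n) (y : Euc n) : ℝ :=
  ∑ m, g y i m * riemannUp g m j k l y

/-- The Ricci tensor `R_{jl} = g^{ik} R_{ijkl}`. -/
def ricci (g : Euc n → Matrix (Fin n) (Fin n) ℝ) (j l : Fin n) (y : Euc n) : ℝ :=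
  ∑ i, ∑ k, (g y)⁻¹ i k * riemann g i j k l y

/-- The scalar curvature `g^{jl} R_{jl}`. -/
def scalarCurv (g : Euc n → Matrix (Fin n) (Fin n) ℝ) (y : Euc n) : ℝ :=
  ∑ j, ∑ l, (g y)⁻¹ j l * ricci g j l y

/-- The Weyl tensor `Rm - Ric ⊙ g / (n - 2) + S g ⊙ g / (2 (n - 1) (n - 2))`, where `⊙` is the
Kulkarni-Nomizu product. -/
def weyl (g : Euc n → Matrix (Fin n) (Fin n) ℝ) (i j k l : Fin n) (y : Euc n) : ℝ :=
  riemann g i j k l y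
    - (1 / ((n : ℝ) - 2)) *
        (ricci g i k y * g y j l - ricci g i l y * g y j k
          + ricci g j l y * g y i k - ricci g j k y * g y i l)
    + scalarCurv g y / (((n : ℝ) - 1) * ((n : ℝ) - 2)) *
        (g y i k * g y j l - g y i l * g y j k)

end Coordinates

/-! ### Riemannian manifolds -/

section Manifold

attribute [local instance 2000] chartedSpaceSelf

variable {n : ℕ} {M : Type*} [MetricSpace M] [ChartedSpace (Euc n) M]
  [RiemannianBundle (fun p : M => TangentSpace 𝓘(ℝ, Euc n) p)]

/-- The matrix `g_{ij}` of the metric in the chart `φ`, as a function on the image of `φ`. -/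
def chartMetric (φ : OpenPartialHomeomorph M (Euc n)) (y : Euc n) : Matrix (Fin n) (Fin n) ℝ :=
  Matrix.of fun i j =>
    inner ℝ
      (mfderiv 𝓘(ℝ, Euc n) 𝓘(ℝ, Euc n) φ.symm y (EuclideanSpace.single i (1 : ℝ) : Euc n))
      (mfderiv 𝓘(ℝ, Euc n) 𝓘(ℝ, Euc n) φ.symm y (EuclideanSpace.single j (1 : ℝ) : Euc n))

/-- The chart `φ` is normal at `p`: `g_{ij}(p) = δ_{ij}` and `∂ₖ g_{ij}(p) = 0`. It is not assumed
that `φ p = 0`, nor that `φ` is an exponential chart. -/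
def IsNormalAt (φ : OpenPartialHomeomorph M (Euc n)) (p : M) : Prop :=
  p ∈ φ.source ∧ chartMetric φ (φ p) = 1 ∧
    ∀ i j k : Fin n, pd k (fun y => chartMetric φ y i j) (φ p) = 0

/-- A family `(φ_ε)_{ε ≥ 0}` of smooth charts defined on a common neighbourhood `U` of the closed
ball of centre `x₀` and radius `r`, with `φ_ε` normal at `x_ε` for small `ε > 0`, and with
`φ_ε → φ_0` as `ε → 0` in `C^k` on the compact subsets of `U`, for all `k` (the derivatives are
taken in the chart `φ_0`). -/
def IsNormalChartFamily (r : ℝ) (x₀ : M) (x : ℝ → M)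
    (φ : ℝ → OpenPartialHomeomorph M (Euc n)) : Prop :=
  ∃ U : Set M, IsOpen U ∧ Metric.closedBall x₀ r ⊆ U ∧
    (∀ ε, 0 ≤ ε → φ ε ∈ IsManifold.maximalAtlas 𝓘(ℝ, Euc n) ∞ M ∧ U ⊆ (φ ε).source) ∧
    (∀ᶠ ε in 𝓝[>] (0 : ℝ), IsNormalAt (φ ε) (x ε)) ∧
    ∀ K : Set M, IsCompact K → K ⊆ U → ∀ k : ℕ,
      TendstoUniformlyOn (fun ε => iteratedFDeriv ℝ k (φ ε ∘ (φ 0).symm))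
        (iteratedFDeriv ℝ k (φ 0 ∘ (φ 0).symm)) (𝓝[>] (0 : ℝ)) (φ 0 '' K)

/-- The product `Weyl_g ⊗ B` for bubbles centred at points converging to `x₀`, modeled on `V` in
charts converging to `φ`: the coordinates of the Weyl tensor at `x₀` are those in the chart `φ`. -/
def weylTensorBubble (φ : OpenPartialHomeomorph M (Euc n)) (x₀ : M) (V : Euc n → ℝ) : ℝ :=
  4 * (n : ℝ) / (3 * ((n : ℝ) - 2) ^ 2) * (∫ y, |V y| ^ twoStar n)⁻¹ *
    ∫ y : Euc n, ∑ i, ∑ a, ∑ j, ∑ b,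
      weyl (chartMetric φ) i a j b (φ x₀) * (y a * y b * pd i (pd j (c2Rep V)) y *
        (((n : ℝ) - 2) / 2 * c2Rep V y + ∑ l, y l * pd l (c2Rep V) y))

variable [MeasurableSpace M] [BorelSpace M]

variable (n) in
/-- The Riemannian volume measure: the `n`-dimensional Hausdorff measure of the Riemannian
distance, normalised so as to be Lebesgue measure on `ℝⁿ`. -/
def vol : Measure M := Measure.euclideanHausdorffMeasure n

/-- The differential `du_p`, a continuous linear form on `T_p M`. -/
def differential (u : M → ℝ) (p : M) : TangentSpace 𝓘(ℝ, Euc n) p →L[ℝ] ℝ :=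
  mfderiv 𝓘(ℝ, Euc n) 𝓘(ℝ, ℝ) u p

/-- `|∇u|_g`, that is, the norm of the differential of `u` for the metric `g`. -/
def gradNorm (u : M → ℝ) (p : M) : ℝ := ‖differential (n := n) u p‖

variable (n) in
/-- `‖u‖₂ + ‖∇u‖₂` for a smooth function `u` on `M`. -/
def smoothH1Norm (u : M → ℝ) : ℝ≥0∞ :=
  eLpNorm u 2 (vol n) + eLpNorm (gradNorm (n := n) u) 2 (vol n)

variable (n) in
/-- `(u_k)` is a sequence in `C^∞(M)` which is Cauchy for `‖u‖₂ + ‖∇u‖₂` and converges to `w` in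
`L²(M)`; it represents `w` as an element of the completion `H¹(M)`. -/
structure IsH1Approx (w : M → ℝ) (u : ℕ → M → ℝ) : Prop where
  aesm : AEStronglyMeasurable w (vol n)
  smooth : ∀ k, ContMDiff 𝓘(ℝ, Euc n) 𝓘(ℝ, ℝ) ∞ (u k)
  cauchy : Tendsto (fun q : ℕ × ℕ => smoothH1Norm n (u q.1 - u q.2)) atTop (𝓝 0)
  tendsto : Tendsto (fun k => eLpNorm (u k - w) 2 (vol n)) atTop (𝓝 0)

variable (n) in
/-- `w ∈ H¹(M)`, the completion of `C^∞(M)` for `‖u‖₂ + ‖∇u‖₂`, realised inside `L²(M)`. -/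
def MemH1 (w : M → ℝ) : Prop := ∃ u : ℕ → M → ℝ, IsH1Approx n w u

variable (n) in
/-- The norm of `w` in the completion `H¹(M)`: the limit of `‖u_k‖₂ + ‖∇u_k‖₂` along a sequence
representing `w` (the limit does not depend on the sequence); `∞` if `w ∉ H¹(M)`. -/
def h1Norm (w : M → ℝ) : ℝ≥0∞ :=
  ⨅ (u : ℕ → M → ℝ) (_ : IsH1Approx n w u), limsup (fun k => smoothH1Norm n (u k)) atTop

variable (n) in
/-- `w_ε → 0` in `H¹(M)` as `ε → 0⁺`. -/
def TendstoZeroH1 (w : ℝ → M → ℝ) : Prop :=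
  Tendsto (fun ε => h1Norm n (w ε)) (𝓝[>] (0 : ℝ)) (𝓝 0)

/-- The function `χ(d_g(·, p)) m^{-(n-2)/2} V((φ(·) - φ(p)) / m)` on `M`. -/
def bubbleProfile (χ : ℝ → ℝ) (V : Euc n → ℝ) (φ : OpenPartialHomeomorph M (Euc n)) (p : M)
    (m : ℝ) (q : M) : ℝ :=
  χ (dist q p) * m ^ (-(((n : ℝ) - 2) / 2)) * V (m⁻¹ • (φ q - φ p))

/-- `B` is a family of bubbles centred at `x_ε → x₀`, of radius `μ_ε`, and modeled on `V` through
the charts `φ_ε`. -/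
structure IsBubbleFamilyIn (χ : ℝ → ℝ) (r : ℝ) (x₀ : M) (x : ℝ → M) (μ : ℝ → ℝ)
    (φ : ℝ → OpenPartialHomeomorph M (Euc n)) (V : Euc n → ℝ) (B : ℝ → M → ℝ) : Prop where
  charts : IsNormalChartFamily r x₀ x φ
  mem_sigma : V ∈ SigmaSol n
  memH1 : ∀ ε, 0 < ε → MemH1 n (B ε)
  tendsto : TendstoZeroH1 n (fun ε => B ε - bubbleProfile χ V (φ ε) (x ε) (μ ε))

/-- `B` is a family of bubbles centred at `x_ε → x₀`, of radius `μ_ε`, and modeled on `V`. -/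
def IsBubbleFamily (χ : ℝ → ℝ) (r : ℝ) (x₀ : M) (x : ℝ → M) (μ : ℝ → ℝ)
    (V : Euc n → ℝ) (B : ℝ → M → ℝ) : Prop :=
  ∃ φ : ℝ → OpenPartialHomeomorph M (Euc n), IsBubbleFamilyIn χ r x₀ x μ φ V B

end Manifold

end BubbleFamilies

end

open BubbleFamilies

open Set Filter Topology MeasureTheory Bundle Manifold
open scoped ENNReal NNReal ContDiff

noncomputable section

set_option linter.unusedSectionVars false

namespace BubbleFamilies

/-! ### Differentials and the metric read in a chart -/

section ChartCalculus

attribute [local instance 2000] chartedSpaceSelf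

variable {n : ℕ} {M : Type*} [MetricSpace M] [ChartedSpace (Euc n) M]
  [IsManifold 𝓘(ℝ, Euc n) ∞ M]

/-! Two charts normal at the same point both read the metric there as the identity, so the
differential of their transition map at that point is an isometry. Since `φ ε` tends to `φ 0` in
every `C^k`, normality at `x ε` passes to the limit (`IsNormalChartFamily.isNormalAt_zero`), and the
differentials of the transition maps at the centers converge to an isometry `O`.

A bubble lives at scale `μ ε`. At that scale the transition map is affine with linear part `O`, up
to an error `o(μ ε)`, so reading `V` in `φ` amounts to reading `V ∘ O` in `φ'`, up to `o(1)` in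
`H¹`. For smooth compactly supported `V` this is a pointwise estimate (`rescaled_sub_bounds`). The
general case follows by density, because bubbles are bounded in `H¹` by the `D^{1,2}` norm of the
model, uniformly in the scale (`exists_h1Norm_bubbleProfile_le`): the `L²` norm of the gradient and
the `L^{2⋆}` norm are scale invariant, and the latter controls `L²` on compact sets. The result is
`tendstoZeroH1_bubbleProfile_sub`, valid for every function of finite energy; the equation enters
only through its invariance under isometries.

Conversely, two equivalent families can be read in the same charts, so the bubbles of `W = V' - V ∘
O` tend to zero in `H¹`. Testing them against a rescaled test function `ψ` bounds `∫ W ∂ψ` by the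
`H¹` norm of the bubble times `‖ψ‖₂`, with a constant independent of the scale. Hence the weak
gradient of `W` vanishes, and `W = 0` by the Sobolev inequality
(`ae_eq_zero_of_tendstoZeroH1_bubbleProfile`).

For the Weyl term, the second derivatives of the transition map between two normal charts vanish at
the center, so the Hessian of the metric changes by composition with `O` plus terms in the third
derivatives of the transition map. Those cancel in the Riemann tensor by symmetry
(`normalRm_transition`). The Weyl tensor therefore changes by `O`, and the integral is invariant
under the change of variables `z ↦ O z`.

Finally, every isometry occurs: replacing `φ ε` by `O⁻¹ ∘ φ ε` turns the model `V` into `V ∘ O`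
without changing the bubble.

A technical point runs through the analysis: `H¹` is a completion of smooth functions, while the
cutoff `χ(d(·, p))` is only known to be Lipschitz. It is replaced by mollifications made in a chart
(`CutoffApprox`). -/

theorem chart_mdifferentiable {φ : OpenPartialHomeomorph M (Euc n)}
    (hφ : φ ∈ IsManifold.maximalAtlas 𝓘(ℝ, Euc n) ∞ M) :
    φ.MDifferentiable 𝓘(ℝ, Euc n) 𝓘(ℝ, Euc n) :=
  ⟨(contMDiffOn_of_mem_maximalAtlas hφ).mdifferentiableOn (by simp),
    (contMDiffOn_symm_of_mem_maximalAtlas hφ).mdifferentiableOn (by simp)⟩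

theorem contDiffOn_comp_chart_symm {F : Type*} [NormedAddCommGroup F] [NormedSpace ℝ F]
    {φ : OpenPartialHomeomorph M (Euc n)}
    (hφ : φ ∈ IsManifold.maximalAtlas 𝓘(ℝ, Euc n) ∞ M) {u : M → F} {U : Set M}
    (hu : ContMDiffOn 𝓘(ℝ, Euc n) 𝓘(ℝ, F) ∞ u U) :
    ContDiffOn ℝ ∞ (u ∘ φ.symm) (φ.target ∩ φ.symm ⁻¹' U) := by
  rw [← contMDiffOn_iff_contDiffOn]
  exact hu.comp ((contMDiffOn_symm_of_mem_maximalAtlas hφ).mono inter_subset_left)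
    fun y hy => hy.2

theorem contDiffOn_transition {φ φ' : OpenPartialHomeomorph M (Euc n)}
    (hφ : φ ∈ IsManifold.maximalAtlas 𝓘(ℝ, Euc n) ∞ M)
    (hφ' : φ' ∈ IsManifold.maximalAtlas 𝓘(ℝ, Euc n) ∞ M) :
    ContDiffOn ℝ ∞ (φ ∘ φ'.symm) (φ'.target ∩ φ'.symm ⁻¹' φ.source) :=
  contDiffOn_comp_chart_symm hφ' (contMDiffOn_of_mem_maximalAtlas hφ)

theorem isOpen_transition (φ φ' : OpenPartialHomeomorph M (Euc n)) :
    IsOpen (φ'.target ∩ φ'.symm ⁻¹' φ.source) :=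
  φ'.symm.isOpen_inter_preimage φ.open_source

/-- The transition map is differentiable at the image of a common point of the domains. -/
theorem differentiableAt_transition {φ φ' : OpenPartialHomeomorph M (Euc n)}
    (hφ : φ ∈ IsManifold.maximalAtlas 𝓘(ℝ, Euc n) ∞ M)
    (hφ' : φ' ∈ IsManifold.maximalAtlas 𝓘(ℝ, Euc n) ∞ M) {y : Euc n}
    (hy : y ∈ φ'.target) (hy' : φ'.symm y ∈ φ.source) :
    DifferentiableAt ℝ (φ ∘ φ'.symm) y :=
  (((contDiffOn_transition hφ hφ').contDiffAt
    ((isOpen_transition φ φ').mem_nhds ⟨hy, hy'⟩)).differentiableAt (by simp))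

theorem fderiv_comp_chart_symm {φ : OpenPartialHomeomorph M (Euc n)}
    (hφ : φ ∈ IsManifold.maximalAtlas 𝓘(ℝ, Euc n) ∞ M) {u : M → ℝ} {y : Euc n}
    (hy : y ∈ φ.target) (hu : MDifferentiableAt 𝓘(ℝ, Euc n) 𝓘(ℝ, ℝ) u (φ.symm y)) (e : Euc n) :
    fderiv ℝ (u ∘ φ.symm) y e = differential (n := n) u (φ.symm y)
      (mfderiv 𝓘(ℝ, Euc n) 𝓘(ℝ, Euc n) φ.symm y e) := by
  have h := mfderiv_comp y hu ((chart_mdifferentiable hφ).mdifferentiableAt_symm hy)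
  have h2 : mfderiv 𝓘(ℝ, Euc n) 𝓘(ℝ, ℝ) (u ∘ φ.symm) y = fderiv ℝ (u ∘ φ.symm) y :=
    mfderiv_eq_fderiv
  rw [← h2, h]
  rfl

theorem mfderiv_chart_symm_surjective {φ : OpenPartialHomeomorph M (Euc n)}
    (hφ : φ ∈ IsManifold.maximalAtlas 𝓘(ℝ, Euc n) ∞ M) {y : Euc n} (hy : y ∈ φ.target) :
    Function.Bijective (mfderiv 𝓘(ℝ, Euc n) 𝓘(ℝ, Euc n) φ.symm y) :=
  (chart_mdifferentiable hφ).symm.mfderiv_bijective hy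

/-- Chain rule for `φ'.symm = φ.symm ∘ (φ ∘ φ'.symm)`, valid near `y`. The two sides lie in tangent
spaces attached to two expressions of the same point, hence the ascription to the model space. -/
theorem mfderiv_symm_transition {φ φ' : OpenPartialHomeomorph M (Euc n)}
    (hφ : φ ∈ IsManifold.maximalAtlas 𝓘(ℝ, Euc n) ∞ M)
    (hφ' : φ' ∈ IsManifold.maximalAtlas 𝓘(ℝ, Euc n) ∞ M) {y : Euc n}
    (hy : y ∈ φ'.target) (hy' : φ'.symm y ∈ φ.source) (e : Euc n) :
    (mfderiv 𝓘(ℝ, Euc n) 𝓘(ℝ, Euc n) φ'.symm y e : Euc n) =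
      (mfderiv 𝓘(ℝ, Euc n) 𝓘(ℝ, Euc n) φ.symm ((φ ∘ φ'.symm) y)
        (fderiv ℝ (φ ∘ φ'.symm) y e) : Euc n) := by
  have hd := differentiableAt_transition hφ hφ' hy hy'
  have hT : (φ ∘ φ'.symm) y ∈ φ.target := φ.map_source hy'
  have h := mfderiv_comp y ((chart_mdifferentiable hφ).mdifferentiableAt_symm hT)
    hd.mdifferentiableAt
  have h1 : (φ.symm ∘ (φ ∘ φ'.symm)) =ᶠ[𝓝 y] φ'.symm := by
    filter_upwards [(isOpen_transition φ φ').mem_nhds ⟨hy, hy'⟩] with z hz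
    exact φ.left_inv hz.2
  have h2 : (mfderiv 𝓘(ℝ, Euc n) 𝓘(ℝ, Euc n) (φ.symm ∘ (φ ∘ φ'.symm)) y e : Euc n) =
      (mfderiv 𝓘(ℝ, Euc n) 𝓘(ℝ, Euc n) φ'.symm y e : Euc n) := by
    rw [h1.mfderiv_eq]
    rfl
  rw [← h2, h, ← mfderiv_eq_fderiv]
  rfl

variable [RiemannianBundle (fun p : M => TangentSpace 𝓘(ℝ, Euc n) p)]

/-- The scalar product of two tangent vectors at `p`, seen as elements of the model space. -/
def tangentInner (p : M) (v w : Euc n) : ℝ :=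
  @inner ℝ (TangentSpace 𝓘(ℝ, Euc n) p) _ v w

/-- The scalar product for the metric `g` of the vectors with coordinates `e`, `e'` at the point
with coordinates `y` in the chart `φ`. -/
def coordInner (φ : OpenPartialHomeomorph M (Euc n)) (y e e' : Euc n) : ℝ :=
  tangentInner (φ.symm y) (mfderiv 𝓘(ℝ, Euc n) 𝓘(ℝ, Euc n) φ.symm y e)
    (mfderiv 𝓘(ℝ, Euc n) 𝓘(ℝ, Euc n) φ.symm y e')

/-- The length for the metric `g` of the vector with coordinates `e` at the point with coordinates
`y` in the chart `φ`. -/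
def coordNorm (φ : OpenPartialHomeomorph M (Euc n)) (y e : Euc n) : ℝ :=
  ‖(mfderiv 𝓘(ℝ, Euc n) 𝓘(ℝ, Euc n) φ.symm y e : TangentSpace 𝓘(ℝ, Euc n) (φ.symm y))‖

theorem coordInner_self (φ : OpenPartialHomeomorph M (Euc n)) (y e : Euc n) :
    coordInner φ y e e = coordNorm φ y e ^ 2 :=
  real_inner_self_eq_norm_sq (F := TangentSpace 𝓘(ℝ, Euc n) (φ.symm y)) _

theorem coordNorm_nonneg (φ : OpenPartialHomeomorph M (Euc n)) (y e : Euc n) :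
    0 ≤ coordNorm φ y e :=
  norm_nonneg (E := TangentSpace 𝓘(ℝ, Euc n) (φ.symm y)) _

theorem coordNorm_eq_sqrt (φ : OpenPartialHomeomorph M (Euc n)) (y e : Euc n) :
    coordNorm φ y e = √(coordInner φ y e e) := by
  rw [coordInner_self, Real.sqrt_sq (coordNorm_nonneg φ y e)]

theorem chartMetric_apply (φ : OpenPartialHomeomorph M (Euc n)) (y : Euc n) (i j : Fin n) :
    chartMetric φ y i j =
      coordInner φ y (EuclideanSpace.single i 1) (EuclideanSpace.single j 1) := rfl

theorem coordInner_comm (φ : OpenPartialHomeomorph M (Euc n)) (y e f : Euc n) :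
    coordInner φ y e f = coordInner φ y f e :=
  real_inner_comm (F := TangentSpace 𝓘(ℝ, Euc n) (φ.symm y)) _ _

theorem coordInner_add_left (φ : OpenPartialHomeomorph M (Euc n)) (y e e' f : Euc n) :
    coordInner φ y (e + e') f = coordInner φ y e f + coordInner φ y e' f := by
  have h := inner_add_left (𝕜 := ℝ) (E := TangentSpace 𝓘(ℝ, Euc n) (φ.symm y))
    (mfderiv 𝓘(ℝ, Euc n) 𝓘(ℝ, Euc n) φ.symm y e) (mfderiv 𝓘(ℝ, Euc n) 𝓘(ℝ, Euc n) φ.symm y e')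
    (mfderiv 𝓘(ℝ, Euc n) 𝓘(ℝ, Euc n) φ.symm y f)
  have h2 : mfderiv 𝓘(ℝ, Euc n) 𝓘(ℝ, Euc n) φ.symm y (e + e') =
    mfderiv 𝓘(ℝ, Euc n) 𝓘(ℝ, Euc n) φ.symm y e + mfderiv 𝓘(ℝ, Euc n) 𝓘(ℝ, Euc n) φ.symm y e' :=
    map_add (mfderiv 𝓘(ℝ, Euc n) 𝓘(ℝ, Euc n) φ.symm y) e e'
  rw [← h2] at h
  exact h

theorem coordInner_smul_left (φ : OpenPartialHomeomorph M (Euc n)) (y e f : Euc n) (c : ℝ) :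
    coordInner φ y (c • e) f = c * coordInner φ y e f := by
  have h := real_inner_smul_left (F := TangentSpace 𝓘(ℝ, Euc n) (φ.symm y))
    (mfderiv 𝓘(ℝ, Euc n) 𝓘(ℝ, Euc n) φ.symm y e)
    (mfderiv 𝓘(ℝ, Euc n) 𝓘(ℝ, Euc n) φ.symm y f) c
  have h2 : mfderiv 𝓘(ℝ, Euc n) 𝓘(ℝ, Euc n) φ.symm y (c • e) =
    c • mfderiv 𝓘(ℝ, Euc n) 𝓘(ℝ, Euc n) φ.symm y e :=
    map_smul (mfderiv 𝓘(ℝ, Euc n) 𝓘(ℝ, Euc n) φ.symm y) c e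
  rw [← h2] at h
  exact h

/-- The metric in a chart as a bilinear form on the model space. -/
def coordForm (φ : OpenPartialHomeomorph M (Euc n)) (y : Euc n) : LinearMap.BilinForm ℝ (Euc n) :=
  LinearMap.mk₂ ℝ (coordInner φ y) (coordInner_add_left φ y)
    (fun c e f => by simp [coordInner_smul_left])
    (fun e f f' => by
      rw [coordInner_comm, coordInner_add_left, coordInner_comm φ y f, coordInner_comm φ y f'])
    (fun c e f => by
      rw [coordInner_comm, coordInner_smul_left, coordInner_comm φ y f, smul_eq_mul])

theorem coordInner_eq_sum (φ : OpenPartialHomeomorph M (Euc n)) (y e f : Euc n) :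
    coordInner φ y e f = ∑ i, ∑ j, e i * f j * chartMetric φ y i j := by
  have he : ∀ e : Euc n, e = ∑ i, e i • EuclideanSpace.single i (1 : ℝ) := fun e => by
    simpa using ((EuclideanSpace.basisFun (Fin n) ℝ).sum_repr e).symm
  have : coordInner φ y e f = coordForm φ y (∑ i, e i • EuclideanSpace.single i (1 : ℝ))
      (∑ j, f j • EuclideanSpace.single j (1 : ℝ)) := by
    rw [← he e, ← he f]; rfl
  rw [this]
  rw [map_sum, Finset.sum_comm]
  refine Finset.sum_congr rfl fun j _ => ?_
  rw [map_sum, LinearMap.sum_apply]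
  refine Finset.sum_congr rfl fun i _ => ?_
  rw [chartMetric_apply, map_smul, map_smul, LinearMap.smul_apply, smul_eq_mul, smul_eq_mul,
    mul_left_comm, mul_assoc]
  rfl

theorem coordInner_transition {φ φ' : OpenPartialHomeomorph M (Euc n)}
    (hφ : φ ∈ IsManifold.maximalAtlas 𝓘(ℝ, Euc n) ∞ M)
    (hφ' : φ' ∈ IsManifold.maximalAtlas 𝓘(ℝ, Euc n) ∞ M) {y : Euc n}
    (hy : y ∈ φ'.target) (hy' : φ'.symm y ∈ φ.source) (e e' : Euc n) :
    coordInner φ' y e e' = coordInner φ ((φ ∘ φ'.symm) y) (fderiv ℝ (φ ∘ φ'.symm) y e)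
      (fderiv ℝ (φ ∘ φ'.symm) y e') := by
  unfold coordInner
  rw [show φ.symm ((φ ∘ φ'.symm) y) = φ'.symm y from φ.left_inv hy']
  exact congrArg₂ (tangentInner (φ'.symm y)) (mfderiv_symm_transition hφ hφ' hy hy' e)
    (mfderiv_symm_transition hφ hφ' hy hy' e')

theorem coordNorm_transition {φ φ' : OpenPartialHomeomorph M (Euc n)}
    (hφ : φ ∈ IsManifold.maximalAtlas 𝓘(ℝ, Euc n) ∞ M)
    (hφ' : φ' ∈ IsManifold.maximalAtlas 𝓘(ℝ, Euc n) ∞ M) {y : Euc n}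
    (hy : y ∈ φ'.target) (hy' : φ'.symm y ∈ φ.source) (e : Euc n) :
    coordNorm φ' y e = coordNorm φ ((φ ∘ φ'.symm) y) (fderiv ℝ (φ ∘ φ'.symm) y e) := by
  rw [coordNorm_eq_sqrt, coordNorm_eq_sqrt, coordInner_transition hφ hφ' hy hy']

theorem gradNorm_nonneg (u : M → ℝ) (p : M) : 0 ≤ gradNorm (n := n) u p :=
  norm_nonneg (differential (n := n) u p)

theorem abs_fderiv_le_gradNorm_mul {φ : OpenPartialHomeomorph M (Euc n)}
    (hφ : φ ∈ IsManifold.maximalAtlas 𝓘(ℝ, Euc n) ∞ M) {u : M → ℝ} {y : Euc n}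
    (hy : y ∈ φ.target) (hu : MDifferentiableAt 𝓘(ℝ, Euc n) 𝓘(ℝ, ℝ) u (φ.symm y)) (e : Euc n) :
    |fderiv ℝ (u ∘ φ.symm) y e| ≤ gradNorm (n := n) u (φ.symm y) * coordNorm φ y e := by
  rw [fderiv_comp_chart_symm hφ hy hu]
  exact (differential (n := n) u (φ.symm y)).le_opNorm _

/-- The differential of `φ.symm` is onto, so the operator norm for `g` can be tested on coordinate
vectors measured by `coordNorm`. With `abs_fderiv_le_gradNorm_mul`, this reduces every statement on
`gradNorm` to Euclidean derivatives. -/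
theorem gradNorm_le_of_forall {φ : OpenPartialHomeomorph M (Euc n)}
    (hφ : φ ∈ IsManifold.maximalAtlas 𝓘(ℝ, Euc n) ∞ M) {u : M → ℝ} {y : Euc n}
    (hy : y ∈ φ.target) (hu : MDifferentiableAt 𝓘(ℝ, Euc n) 𝓘(ℝ, ℝ) u (φ.symm y)) {c : ℝ}
    (hc : 0 ≤ c) (h : ∀ e, |fderiv ℝ (u ∘ φ.symm) y e| ≤ c * coordNorm φ y e) :
    gradNorm (n := n) u (φ.symm y) ≤ c := by
  refine ContinuousLinearMap.opNorm_le_bound _ hc fun v => ?_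
  obtain ⟨e, he⟩ := (mfderiv_chart_symm_surjective hφ hy).2 v
  have h1 := h e
  have h2 : coordNorm φ y e = ‖v‖ := by rw [← he]; rfl
  have h3 : fderiv ℝ (u ∘ φ.symm) y e = differential (n := n) u (φ.symm y) v := by
    rw [← he]; exact fderiv_comp_chart_symm hφ hy hu e
  rw [h2, h3] at h1
  exact h1

theorem coordNorm_pos {φ : OpenPartialHomeomorph M (Euc n)}
    (hφ : φ ∈ IsManifold.maximalAtlas 𝓘(ℝ, Euc n) ∞ M) {y e : Euc n}
    (hy : y ∈ φ.target) (he : e ≠ 0) : 0 < coordNorm φ y e := by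
  refine norm_pos_iff.2 fun h => he ?_
  exact (mfderiv_chart_symm_surjective hφ hy).1 (h.trans (map_zero _).symm)

variable [IsContMDiffRiemannianBundle 𝓘(ℝ, Euc n) ∞ (Euc n)
      (fun p : M => TangentSpace 𝓘(ℝ, Euc n) p)]

/-- The coordinate field `y ↦ dφ⁻¹(y) e` is the tangent map of `φ.symm` applied to the constant
section `(y, e)`, hence smooth; the bundle metric is smooth as well. -/
theorem contDiffOn_coordInner {φ : OpenPartialHomeomorph M (Euc n)}
    (hφ : φ ∈ IsManifold.maximalAtlas 𝓘(ℝ, Euc n) ∞ M) (e e' : Euc n) :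
    ContDiffOn ℝ ∞ (fun y => coordInner φ y e e') φ.target := by
  have key : ∀ e : Euc n, ContMDiffOn 𝓘(ℝ, Euc n) (𝓘(ℝ, Euc n).prod 𝓘(ℝ, Euc n)) ∞
      (fun y => (TotalSpace.mk' (Euc n) (φ.symm y) (mfderiv 𝓘(ℝ, Euc n) 𝓘(ℝ, Euc n) φ.symm y e) :
        TotalSpace (Euc n) (fun p : M => TangentSpace 𝓘(ℝ, Euc n) p))) φ.target := by
    intro e
    have h1 := (contMDiffOn_symm_of_mem_maximalAtlas hφ).contMDiffOn_tangentMapWithin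
      (m := ∞) (by simp) φ.open_target.uniqueMDiffOn
    have h2 : ContMDiffOn 𝓘(ℝ, Euc n) 𝓘(ℝ, Euc n).tangent ∞
        (fun y => (⟨y, e⟩ : TangentBundle 𝓘(ℝ, Euc n) (Euc n))) φ.target := by
      exact contMDiffOn_vectorSpace_iff_contDiffOn.2 (contDiffOn_const (c := e))
    have h3 := h1.comp h2 fun y hy => hy
    refine h3.congr fun y hy => ?_
    simp only [Function.comp, tangentMapWithin]
    rw [mfderivWithin_of_isOpen φ.open_target hy]
  rw [← contMDiffOn_iff_contDiffOn]
  exact (key e).inner_bundle (key e')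

end ChartCalculus
end BubbleFamilies
end

open Set Filter Topology MeasureTheory Bundle Manifold
open scoped ENNReal NNReal ContDiff

noncomputable section

set_option linter.unusedSectionVars false

namespace BubbleFamilies

/-! ### Comparison of Riemannian and Euclidean distances in a chart -/

section ChartLipschitz

attribute [local instance 2000] chartedSpaceSelf

variable {n : ℕ} {M : Type*} [MetricSpace M] [ChartedSpace (Euc n) M]
  [IsManifold 𝓘(ℝ, Euc n) ∞ M]
  [RiemannianBundle (fun p : M => TangentSpace 𝓘(ℝ, Euc n) p)]
  [IsContMDiffRiemannianBundle 𝓘(ℝ, Euc n) ∞ (Euc n)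
      (fun p : M => TangentSpace 𝓘(ℝ, Euc n) p)]

theorem contDiffOn_chartMetric {φ : OpenPartialHomeomorph M (Euc n)}
    (hφ : φ ∈ IsManifold.maximalAtlas 𝓘(ℝ, Euc n) ∞ M) (i j : Fin n) :
    ContDiffOn ℝ ∞ (fun y => chartMetric φ y i j) φ.target :=
  contDiffOn_coordInner hφ _ _

theorem continuousOn_coordInner {φ : OpenPartialHomeomorph M (Euc n)}
    (hφ : φ ∈ IsManifold.maximalAtlas 𝓘(ℝ, Euc n) ∞ M) :
    ContinuousOn (fun z : Euc n × Euc n => coordInner φ z.1 z.2 z.2) (φ.target ×ˢ univ) := by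
  simp only [coordInner_eq_sum]
  refine continuousOn_finsetSum _ fun i _ => continuousOn_finsetSum _ fun j _ => ?_
  refine ContinuousOn.mul (by fun_prop) ?_
  exact (contDiffOn_chartMetric hφ i j).continuousOn.comp continuousOn_fst fun z hz => hz.1

theorem coordNorm_smul {φ : OpenPartialHomeomorph M (Euc n)} {y e : Euc n} {c : ℝ} (hc : 0 ≤ c) :
    coordNorm φ y (c • e) = c * coordNorm φ y e := by
  rw [coordNorm_eq_sqrt, coordNorm_eq_sqrt, coordInner_smul_left, coordInner_comm,
    coordInner_smul_left, ← mul_assoc, Real.sqrt_mul (mul_nonneg hc hc), Real.sqrt_mul_self hc]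

/-- On compact sets, the metric read in a chart is comparable to the Euclidean metric. -/
theorem exists_coordNorm_bounds {φ : OpenPartialHomeomorph M (Euc n)}
    (hφ : φ ∈ IsManifold.maximalAtlas 𝓘(ℝ, Euc n) ∞ M) {K : Set (Euc n)} (hK : IsCompact K)
    (hKt : K ⊆ φ.target) :
    ∃ C : ℝ≥0, 0 < C ∧ ∀ y ∈ K, ∀ e : Euc n,
      ‖e‖ ≤ C * coordNorm φ y e ∧ coordNorm φ y e ≤ C * ‖e‖ := by
  set S : Set (Euc n × Euc n) := K ×ˢ Metric.sphere (0 : Euc n) 1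
  have hS : IsCompact S := hK.prod (isCompact_sphere _ _)
  have hc : ContinuousOn (fun z : Euc n × Euc n => coordNorm φ z.1 z.2) S := by
    simp only [coordNorm_eq_sqrt]
    exact ((continuousOn_coordInner hφ).mono
      (prod_mono hKt (subset_univ _))).sqrt
  have hpos : ∀ z ∈ S, 0 < coordNorm φ z.1 z.2 := fun z hz =>
    coordNorm_pos hφ (hKt hz.1) (by
      intro h0
      have := hz.2
      simp [h0] at this)
  -- `A` bounds the norm and `A'` its inverse on `K × sphere`; homogeneity extends both bounds to
  -- all vectors. The `1` in the constant only ensures positivity.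
  obtain ⟨A, hA⟩ := hS.exists_bound_of_continuousOn hc
  obtain ⟨A', hA'⟩ := hS.exists_bound_of_continuousOn (f := fun z => (coordNorm φ z.1 z.2)⁻¹)
    (hc.inv₀ fun z hz => (hpos z hz).ne')
  refine ⟨⟨max 1 (max A A'), by positivity⟩, lt_of_lt_of_le zero_lt_one
    (show (1 : ℝ) ≤ _ from le_max_left _ _), fun y hy e => ?_⟩
  change ‖e‖ ≤ max 1 (max A A') * coordNorm φ y e ∧ coordNorm φ y e ≤ max 1 (max A A') * ‖e‖
  rcases eq_or_ne e 0 with rfl | he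
  · have : coordNorm φ y (0 : Euc n) = 0 := by
      have := coordNorm_smul (φ := φ) (y := y) (e := 0) le_rfl
      simpa using this
    simp [this]
  have hne : 0 < ‖e‖ := norm_pos_iff.2 he
  set f := ‖e‖⁻¹ • e
  have hf : (y, f) ∈ S := ⟨hy, by simp [f, norm_smul, hne.ne']⟩
  have hef : coordNorm φ y e = ‖e‖ * coordNorm φ y f := by
    rw [← coordNorm_smul hne.le, smul_inv_smul₀ hne.ne']
  have h1 := hA _ hf
  have h2 := hA' _ hf
  have h3 := hpos _ hf
  simp only [norm_inv, Real.norm_eq_abs, abs_of_pos h3] at h1 h2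
  rw [hef]
  constructor
  · have h4 : 1 ≤ A' * coordNorm φ y f := by
      rwa [inv_le_iff_one_le_mul₀ h3] at h2
    have h5 : A' * coordNorm φ y f ≤ max 1 (max A A') * coordNorm φ y f := by
      gcongr
      exact (le_max_right _ _).trans (le_max_right _ _)
    nlinarith
  · rw [mul_comm]
    gcongr
    exact h1.trans ((le_max_left _ _).trans (le_max_right _ _))

theorem enorm_le_mul_enorm {E F : Type*} [SeminormedAddCommGroup E] [SeminormedAddCommGroup F]
    {a : E} {b : F} {C : ℝ≥0} (h : ‖a‖ ≤ C * ‖b‖) : ‖a‖ₑ ≤ C * ‖b‖ₑ := by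
  have h' : ‖a‖₊ ≤ C * ‖b‖₊ := h
  simp only [enorm]
  exact_mod_cast h'

theorem enorm_mfderiv_chart_le {φ : OpenPartialHomeomorph M (Euc n)}
    (hφ : φ ∈ IsManifold.maximalAtlas 𝓘(ℝ, Euc n) ∞ M) {p : M} (hp : p ∈ φ.source) {C : ℝ≥0}
    (h : ∀ e, ‖e‖ ≤ C * coordNorm φ (φ p) e) (v : TangentSpace 𝓘(ℝ, Euc n) p) :
    @enorm (Euc n) _ (mfderiv 𝓘(ℝ, Euc n) 𝓘(ℝ, Euc n) φ p v) ≤ C * ‖v‖ₑ := by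
  obtain ⟨y, hy, rfl⟩ : ∃ y ∈ φ.target, φ.symm y = p := ⟨φ p, φ.map_source hp, φ.left_inv hp⟩
  rw [φ.right_inv hy] at h
  obtain ⟨e, rfl⟩ := (mfderiv_chart_symm_surjective hφ hy).2 v
  have h1 := (chart_mdifferentiable hφ).comp_symm_deriv hy
  have h2 : @Eq (Euc n) (mfderiv 𝓘(ℝ, Euc n) 𝓘(ℝ, Euc n) φ (φ.symm y)
      (mfderiv 𝓘(ℝ, Euc n) 𝓘(ℝ, Euc n) φ.symm y e)) e :=
    congrArg (fun L : TangentSpace 𝓘(ℝ, Euc n) y →L[ℝ] TangentSpace 𝓘(ℝ, Euc n) y => L e) h1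
  refine (congrArg (fun z : Euc n => ‖z‖ₑ) h2).trans_le ?_
  exact enorm_le_mul_enorm (E := Euc n) (F := TangentSpace 𝓘(ℝ, Euc n) (φ.symm y)) (h e)

variable [IsRiemannianManifold 𝓘(ℝ, Euc n) M]

/-- If the metric is bounded along a segment in a chart, so is the distance of the ends. -/
theorem edist_chart_symm_le {φ : OpenPartialHomeomorph M (Euc n)}
    (hφ : φ ∈ IsManifold.maximalAtlas 𝓘(ℝ, Euc n) ∞ M) {y y' : Euc n} {C : ℝ≥0}
    (hs : segment ℝ y y' ⊆ φ.target)
    (h : ∀ z ∈ segment ℝ y y', ∀ e, coordNorm φ z e ≤ C * ‖e‖) :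
    edist (φ.symm y) (φ.symm y') ≤ C * edist y y' := by
  let η := ContinuousAffineMap.lineMap (R := ℝ) y y'
  have hη : ∀ t ∈ Icc (0 : ℝ) 1, η t ∈ segment ℝ y y' := by
    intro t ht
    rw [segment_eq_image_lineMap]
    exact ⟨t, ht, rfl⟩
  set γ := φ.symm ∘ η
  have η_smooth : ContMDiffOn 𝓘(ℝ, ℝ) 𝓘(ℝ, Euc n) 1 η (Icc 0 1) :=
    (contMDiff_iff_contDiff.2 (ContinuousAffineMap.contDiff _)).contMDiffOn
  -- The image of the Euclidean segment is a competitor in the definition of the Riemannian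
  -- distance.
  have h1 : edist (φ.symm y) (φ.symm y') ≤ pathELength 𝓘(ℝ, Euc n) γ 0 1 := by
    rw [IsRiemannianManifold.out (I := 𝓘(ℝ, Euc n)) (φ.symm y) (φ.symm y')]
    apply riemannianEDist_le_pathELength _ _ _ zero_le_one
    · exact ((contMDiffOn_symm_of_mem_maximalAtlas hφ).of_le (by simp)).comp η_smooth
        fun t ht => hs (hη t ht)
    · simp [γ, η, ContinuousAffineMap.coe_lineMap_eq]
    · simp [γ, η, ContinuousAffineMap.coe_lineMap_eq]
  refine h1.trans ?_
  rw [← lintegral_fderiv_lineMap_eq_edist, pathELength_eq_lintegral_mfderivWithin_Icc,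
    ← lintegral_const_mul' _ _ ENNReal.coe_ne_top]
  apply setLIntegral_mono' measurableSet_Icc (fun t ht ↦ ?_)
  have h2 : mfderivWithin 𝓘(ℝ, ℝ) 𝓘(ℝ, Euc n) γ (Icc 0 1) t =
      (mfderiv 𝓘(ℝ, Euc n) 𝓘(ℝ, Euc n) φ.symm (η t)) ∘L
        (mfderivWithin 𝓘(ℝ, ℝ) 𝓘(ℝ, Euc n) η (Icc 0 1) t) := by
    apply mfderiv_comp_mfderivWithin
    · exact (chart_mdifferentiable hφ).mdifferentiableAt_symm (hs (hη t ht))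
    · exact η_smooth.mdifferentiableOn one_ne_zero t ht
    · rw [uniqueMDiffWithinAt_iff_uniqueDiffWithinAt]
      exact uniqueDiffOn_Icc zero_lt_one t ht
  have h3 : mfderivWithin 𝓘(ℝ, ℝ) 𝓘(ℝ, Euc n) γ (Icc 0 1) t 1 =
      (mfderiv 𝓘(ℝ, Euc n) 𝓘(ℝ, Euc n) φ.symm (η t))
        (mfderivWithin 𝓘(ℝ, ℝ) 𝓘(ℝ, Euc n) η (Icc 0 1) t 1) := congr($h2 1)
  rw [h3]
  have h4 := h (η t) (hη t ht) (fderivWithin ℝ η (Icc 0 1) t 1)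
  rw [mfderivWithin_eq_fderivWithin]
  exact enorm_le_mul_enorm (F := Euc n) (E := TangentSpace 𝓘(ℝ, Euc n) (φ.symm (η t))) h4

/-- If the metric is bounded below on a ball contained in the domain of a chart, then the chart is
Lipschitz there. -/
theorem edist_chart_le {φ : OpenPartialHomeomorph M (Euc n)}
    (hφ : φ ∈ IsManifold.maximalAtlas 𝓘(ℝ, Euc n) ∞ M) {p q : M} {C : ℝ≥0} {R : ℝ≥0∞}
    (hR : ∀ z, edist p z < R → z ∈ φ.source ∧ ∀ e, ‖e‖ ≤ C * coordNorm φ (φ z) e)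
    (hpq : edist p q < R) :
    edist (φ p) (φ q) ≤ C * edist p q := by
  have key : ∀ s, edist p q < s → s < R → edist (φ p) (φ q) ≤ C * s := by
    intro s hs hsR
    rw [IsRiemannianManifold.out (I := 𝓘(ℝ, Euc n)) p q] at hs
    obtain ⟨γ, hγ0, hγ1, hγs, hγ⟩ := exists_lt_of_riemannianEDist_lt hs
    -- An almost minimising path cannot leave the ball of radius `R`: the length of each initial
    -- piece bounds the distance to `p`. The chart can thus be applied along the whole path.
    have hin : ∀ t ∈ Icc (0 : ℝ) 1, edist p (γ t) < R := by
      intro t ht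
      rw [IsRiemannianManifold.out (I := 𝓘(ℝ, Euc n)) p (γ t)]
      refine lt_of_le_of_lt ?_ (hγ.trans hsR)
      refine (riemannianEDist_le_pathELength (hγs.mono (Icc_subset_Icc le_rfl ht.2)) hγ0 rfl
        ht.1).trans (pathELength_mono le_rfl ht.2)
    let γ' := φ ∘ γ
    have hC : ContMDiffOn 𝓘(ℝ, ℝ) 𝓘(ℝ, Euc n) 1 γ' (Icc 0 1) :=
      ((contMDiffOn_of_mem_maximalAtlas hφ).of_le (by simp)).comp hγs
        fun t ht => (hR _ (hin t ht)).1
    rw [← hγ0, ← hγ1, edist_comm, edist_eq_enorm_sub]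
    calc
      ‖γ' 1 - γ' 0‖ₑ
      _ ≤ ∫⁻ t' in Icc 0 1, ‖derivWithin γ' (Icc 0 1) t'‖ₑ := by
        apply enorm_sub_le_lintegral_derivWithin_Icc_of_contDiffOn_Icc _ zero_le_one
        rwa [← contMDiffOn_iff_contDiffOn]
      _ ≤ ∫⁻ t' in Icc 0 1, C * ‖mfderivWithin 𝓘(ℝ, ℝ) 𝓘(ℝ, Euc n) γ (Icc 0 1) t' 1‖ₑ := by
        apply setLIntegral_mono' measurableSet_Icc (fun t' ht' ↦ ?_)
        have h1 : mfderivWithin 𝓘(ℝ, ℝ) 𝓘(ℝ, Euc n) γ' (Icc 0 1) t' =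
            (mfderiv 𝓘(ℝ, Euc n) 𝓘(ℝ, Euc n) φ (γ t')) ∘L
              (mfderivWithin 𝓘(ℝ, ℝ) 𝓘(ℝ, Euc n) γ (Icc 0 1) t') := by
          apply mfderiv_comp_mfderivWithin
          · exact (chart_mdifferentiable hφ).mdifferentiableAt (hR _ (hin t' ht')).1
          · exact hγs.mdifferentiableOn one_ne_zero _ ht'
          · rw [uniqueMDiffWithinAt_iff_uniqueDiffWithinAt]
            exact uniqueDiffOn_Icc zero_lt_one _ ht'
        have h2 : @Eq (Euc n) (derivWithin γ' (Icc 0 1) t') (mfderiv 𝓘(ℝ, Euc n) 𝓘(ℝ, Euc n) φ (γ t')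
            (mfderivWithin 𝓘(ℝ, ℝ) 𝓘(ℝ, Euc n) γ (Icc 0 1) t' 1)) := by
          rw [← fderivWithin_derivWithin, ← mfderivWithin_eq_fderivWithin]
          exact congr($h1 1)
        rw [h2]
        exact enorm_mfderiv_chart_le hφ (hR _ (hin t' ht')).1 (hR _ (hin t' ht')).2 _
      _ = C * pathELength 𝓘(ℝ, Euc n) γ 0 1 := by
        rw [lintegral_const_mul' _ _ ENNReal.coe_ne_top,
          pathELength_eq_lintegral_mfderivWithin_Icc]
      _ ≤ C * s := by gcongr
  have hlim : Tendsto (fun s : ℝ≥0∞ => C * s) (𝓝[>] (edist p q)) (𝓝 ((C : ℝ≥0∞) * edist p q)) :=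
    (ENNReal.Tendsto.const_mul tendsto_id (Or.inr ENNReal.coe_ne_top)).mono_left
      nhdsWithin_le_nhds
  have hne : (𝓝[>] (edist p q)).NeBot := nhdsGT_neBot_of_exists_gt ⟨R, hpq⟩
  refine ge_of_tendsto hlim ?_
  filter_upwards [Ioo_mem_nhdsGT hpq] with s hs using key s hs.1 hs.2

/-- A chart is Lipschitz on the compact subsets of its domain. -/
theorem exists_lipschitzOnWith_chart {φ : OpenPartialHomeomorph M (Euc n)}
    (hφ : φ ∈ IsManifold.maximalAtlas 𝓘(ℝ, Euc n) ∞ M) {K : Set M} (hK : IsCompact K)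
    (hKs : K ⊆ φ.source) : ∃ C : ℝ≥0, LipschitzOnWith C φ K := by
  refine LocallyLipschitzOn.exists_lipschitzOnWith_of_compact hK ?_
  suffices h : ∀ p ∈ K, ∃ C : ℝ≥0, ∃ t ∈ 𝓝 p, LipschitzOnWith C φ t by
    intro p hp
    obtain ⟨C, t, ht, h⟩ := h p hp
    exact ⟨C, t, mem_nhdsWithin_of_mem_nhds ht, h⟩
  intro p hp
  have hφp : φ p ∈ φ.target := φ.map_source (hKs hp)
  obtain ⟨L, hL, hLn, hLt⟩ : ∃ L, IsCompact L ∧ L ∈ 𝓝 (φ p) ∧ L ⊆ φ.target := by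
    obtain ⟨L, hL, h1, h2⟩ := exists_compact_subset φ.open_target hφp
    exact ⟨L, hL, mem_interior_iff_mem_nhds.1 h1, h2⟩
  obtain ⟨C, -, hC⟩ := exists_coordNorm_bounds hφ hL hLt
  have hn : φ.source ∩ φ ⁻¹' L ∈ 𝓝 p :=
    inter_mem (φ.open_source.mem_nhds (hKs hp)) ((φ.continuousAt (hKs hp)).preimage_mem_nhds hLn)
  obtain ⟨ρ, hρ, hball⟩ := Metric.mem_nhds_iff.1 hn
  refine ⟨C, Metric.ball p (ρ / 3), Metric.ball_mem_nhds _ (by positivity), fun a ha b hb => ?_⟩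
  -- Two points of the ball of radius `ρ / 3` are at distance less than `2ρ / 3`, and the ball of
  -- that radius around either one stays in the ball of radius `ρ`, where the bounds hold.
  have hab : dist a b < 2 * (ρ / 3) := by
    have := dist_triangle_right a b p
    rw [Metric.mem_ball] at ha hb
    linarith
  refine edist_chart_le hφ (R := ENNReal.ofReal (2 * (ρ / 3))) (fun z hz => ?_) ?_
  · rw [edist_dist, ENNReal.ofReal_lt_ofReal_iff (by positivity)] at hz
    have hz' : z ∈ Metric.ball p ρ := by
      rw [Metric.mem_ball] at ha ⊢
      have := dist_triangle_left z p a
      linarith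
    exact ⟨(hball hz').1, fun e => (hC _ (hball hz').2 e).1⟩
  · rwa [edist_dist, ENNReal.ofReal_lt_ofReal_iff (by positivity)]

/-- The inverse of a chart is Lipschitz on the compact subsets of its target. -/
theorem exists_lipschitzOnWith_chart_symm {φ : OpenPartialHomeomorph M (Euc n)}
    (hφ : φ ∈ IsManifold.maximalAtlas 𝓘(ℝ, Euc n) ∞ M) {K : Set (Euc n)} (hK : IsCompact K)
    (hKt : K ⊆ φ.target) : ∃ C : ℝ≥0, LipschitzOnWith C φ.symm K := by
  refine LocallyLipschitzOn.exists_lipschitzOnWith_of_compact hK ?_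
  intro y hy
  obtain ⟨ρ, hρ, hball⟩ := Metric.mem_nhds_iff.1 (φ.open_target.mem_nhds (hKt hy))
  have hb : Metric.closedBall y (ρ / 2) ⊆ φ.target :=
    (Metric.closedBall_subset_ball (by linarith)).trans hball
  obtain ⟨C, -, hC⟩ := exists_coordNorm_bounds hφ (isCompact_closedBall y (ρ / 2)) hb
  refine ⟨C, Metric.closedBall y (ρ / 2),
    mem_nhdsWithin_of_mem_nhds (Metric.closedBall_mem_nhds _ (by positivity)), fun a ha b hb' => ?_⟩
  have hseg := (convex_closedBall y (ρ / 2)).segment_subset ha hb'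
  exact edist_chart_symm_le hφ (hseg.trans hb) fun z hz e => (hC z (hseg hz) e).2

end ChartLipschitz
end BubbleFamilies
end

open Set Filter Topology MeasureTheory Bundle Manifold
open scoped ENNReal NNReal ContDiff

noncomputable section

set_option linter.unusedSectionVars false

namespace BubbleFamilies

/-! ### Measurability of gradients and comparison of volumes -/

section ChartMeasure

attribute [local instance 2000] chartedSpaceSelf

variable {n : ℕ} {M : Type*} [MetricSpace M] [ChartedSpace (Euc n) M]
  [IsManifold 𝓘(ℝ, Euc n) ∞ M]
  [RiemannianBundle (fun p : M => TangentSpace 𝓘(ℝ, Euc n) p)]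
  [IsContMDiffRiemannianBundle 𝓘(ℝ, Euc n) ∞ (Euc n)
      (fun p : M => TangentSpace 𝓘(ℝ, Euc n) p)]
  [MeasurableSpace M] [BorelSpace M]

/-- `gradNorm` exceeds `c` at a point exactly when some fixed coordinate vector witnesses it, and
such a strict inequality between continuous functions persists nearby. This lower semicontinuity is
enough for measurability. -/
theorem isOpen_inter_lt_gradNorm {u : M → ℝ} {U : Set M} (hU : IsOpen U)
    (hu : ContMDiffOn 𝓘(ℝ, Euc n) 𝓘(ℝ, ℝ) ∞ u U) {c : ℝ} (hc : 0 ≤ c) :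
    IsOpen (U ∩ {p | c < gradNorm (n := n) u p}) := by
  rw [isOpen_iff_mem_nhds]
  rintro p ⟨hpU, hp⟩
  set φ := chartAt (Euc n) p
  have hφ : φ ∈ IsManifold.maximalAtlas 𝓘(ℝ, Euc n) ∞ M := IsManifold.chart_mem_maximalAtlas p
  have hps : p ∈ φ.source := mem_chart_source _ p
  have hmd : ∀ q ∈ U, MDifferentiableAt 𝓘(ℝ, Euc n) 𝓘(ℝ, ℝ) u q := fun q hq =>
    (hu.contMDiffAt (hU.mem_nhds hq)).mdifferentiableAt (by simp)
  set W := φ.target ∩ φ.symm ⁻¹' U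
  have hW : IsOpen W := φ.symm.isOpen_inter_preimage hU
  have hsm : ContDiffOn ℝ ∞ (u ∘ φ.symm) W := contDiffOn_comp_chart_symm hφ hu
  obtain ⟨e, he⟩ : ∃ e, c * coordNorm φ (φ p) e < |fderiv ℝ (u ∘ φ.symm) (φ p) e| := by
    by_contra! h
    have h1 := gradNorm_le_of_forall hφ (φ.map_source hps)
      (by rw [φ.left_inv hps]; exact hmd p hpU) hc h
    rw [φ.left_inv hps] at h1
    exact absurd hp (not_lt.2 h1)
  have hc1 : ContinuousOn (fun y => c * coordNorm φ y e) W := by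
    simp only [coordNorm_eq_sqrt]
    exact continuousOn_const.mul
      ((contDiffOn_coordInner hφ e e).continuousOn.mono inter_subset_left).sqrt
  have hc2 : ContinuousOn (fun y => |fderiv ℝ (u ∘ φ.symm) y e|) W :=
    ((hsm.continuousOn_fderiv_of_isOpen hW (by simp)).clm_apply continuousOn_const).abs
  have hpW : φ p ∈ W := ⟨φ.map_source hps, by simpa [φ.left_inv hps] using hpU⟩
  have hev : ∀ᶠ y in 𝓝 (φ p), c * coordNorm φ y e < |fderiv ℝ (u ∘ φ.symm) y e| :=
    (hc1.continuousAt (hW.mem_nhds hpW)).eventually_lt (hc2.continuousAt (hW.mem_nhds hpW)) he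
  filter_upwards [hU.mem_nhds hpU, φ.open_source.mem_nhds hps,
    (φ.continuousAt hps).eventually hev] with q hqU hqs hq
  refine ⟨hqU, ?_⟩
  have h2 := abs_fderiv_le_gradNorm_mul hφ (u := u) (φ.map_source hqs)
    (by rw [φ.left_inv hqs]; exact hmd q hqU) e
  rw [φ.left_inv hqs] at h2
  have h3 := hq.trans_le h2
  exact lt_of_mul_lt_mul_right h3 (coordNorm_nonneg _ _ _)

theorem measurable_indicator_gradNorm {u : M → ℝ} {U : Set M} (hU : IsOpen U)
    (hu : ContMDiffOn 𝓘(ℝ, Euc n) 𝓘(ℝ, ℝ) ∞ u U) :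
    Measurable (U.indicator (gradNorm (n := n) u)) := by
  refine measurable_of_Ioi fun c => ?_
  rcases lt_or_ge c 0 with hc | hc
  · convert MeasurableSet.univ
    refine eq_univ_of_forall fun p => ?_
    exact hc.trans_le (indicator_nonneg (fun p _ => gradNorm_nonneg u p) p)
  · convert (isOpen_inter_lt_gradNorm hU hu hc).measurableSet using 1
    ext p
    by_cases hp : p ∈ U <;> simp [hp, hc]

theorem aestronglyMeasurable_gradNorm {u : M → ℝ} {U K : Set M} (hU : IsOpen U)
    (hu : ContMDiffOn 𝓘(ℝ, Euc n) 𝓘(ℝ, ℝ) ∞ u U) (hK : MeasurableSet K) (hKU : K ⊆ U)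
    (ν : Measure M) :
    AEStronglyMeasurable (gradNorm (n := n) u) (ν.restrict K) := by
  refine (measurable_indicator_gradNorm hU hu).aestronglyMeasurable.congr ?_
  filter_upwards [ae_restrict_mem hK] with p hp
  simp [hKU hp]

theorem measurable_gradNorm {u : M → ℝ} (hu : ContMDiff 𝓘(ℝ, Euc n) 𝓘(ℝ, ℝ) ∞ u) :
    Measurable (gradNorm (n := n) u) := by
  simpa using measurable_indicator_gradNorm isOpen_univ hu.contMDiffOn

/-- Uniform comparison of the Riemannian metric and measure on `K` with the Euclidean ones. -/
structure ChartBounds (K : Set M) (C : ℝ≥0) (ψ : OpenPartialHomeomorph M (Euc n)) : Prop where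
  mem : ψ ∈ IsManifold.maximalAtlas 𝓘(ℝ, Euc n) ∞ M
  sub : K ⊆ ψ.source
  lintegral_le : ∀ f : Euc n → ℝ≥0∞, ∫⁻ q in K, f (ψ q) ∂(vol n) ≤ C * ∫⁻ y in ψ '' K, f y
  le_lintegral : ∀ f : Euc n → ℝ≥0∞, ∫⁻ y in ψ '' K, f y ≤ C * ∫⁻ q in K, f (ψ q) ∂(vol n)
  norm_le : ∀ q ∈ K, ∀ e, ‖e‖ ≤ C * coordNorm ψ (ψ q) e
  le_norm : ∀ q ∈ K, ∀ e, coordNorm ψ (ψ q) e ≤ C * ‖e‖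

theorem euclideanHausdorffMeasure_image_le {X Y : Type*} [EMetricSpace X] [MeasurableSpace X]
    [BorelSpace X] [EMetricSpace Y] [MeasurableSpace Y] [BorelSpace Y] {f : X → Y} {s : Set X}
    {C : ℝ≥0} (hf : LipschitzOnWith C f s) (d : ℕ) :
    (Measure.euclideanHausdorffMeasure d : Measure Y) (f '' s) ≤
      (C : ℝ≥0∞) ^ d * (Measure.euclideanHausdorffMeasure d : Measure X) s := by
  simp only [Measure.euclideanHausdorffMeasure_def, Measure.smul_apply]
  have h := hf.hausdorffMeasure_image_le (d := d) (Nat.cast_nonneg d)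
  rw [ENNReal.rpow_natCast] at h
  rw [ENNReal.smul_def, ENNReal.smul_def, smul_eq_mul, smul_eq_mul, mul_left_comm]
  gcongr

variable [IsRiemannianManifold 𝓘(ℝ, Euc n) M]

/-- Both volumes are `n`-dimensional Hausdorff measures, and a `C`-Lipschitz map multiplies such a
measure by at most `C ^ n`. Since `φ` and `φ.symm` are Lipschitz on compact sets, the volumes are
comparable without computing a density. -/
theorem exists_chartBounds {φ : OpenPartialHomeomorph M (Euc n)}
    (hφ : φ ∈ IsManifold.maximalAtlas 𝓘(ℝ, Euc n) ∞ M) {K : Set M} (hK : IsCompact K)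
    (hKs : K ⊆ φ.source) : ∃ C : ℝ≥0, ChartBounds K C φ := by
  have hK' : IsCompact (φ '' K) := hK.image_of_continuousOn (φ.continuousOn.mono hKs)
  have hKt : φ '' K ⊆ φ.target := by
    rintro _ ⟨q, hq, rfl⟩
    exact φ.map_source (hKs hq)
  obtain ⟨A, hA⟩ := exists_lipschitzOnWith_chart hφ hK hKs
  obtain ⟨B, hB⟩ := exists_lipschitzOnWith_chart_symm hφ hK' hKt
  obtain ⟨D, -, hD⟩ := exists_coordNorm_bounds hφ hK' hKt
  set C : ℝ≥0 := max D (max (A ^ n) (B ^ n))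
  have hmK : AEMeasurable φ ((vol n).restrict K) :=
    (φ.continuousOn.mono hKs).aemeasurable hK.isClosed.measurableSet
  have hmK' : AEMeasurable φ.symm ((volume : Measure (Euc n)).restrict (φ '' K)) :=
    (φ.continuousOn_symm.mono hKt).aemeasurable hK'.isClosed.measurableSet
  have hvol : (volume : Measure (Euc n)) = Measure.euclideanHausdorffMeasure n :=
    (EuclideanSpace.euclideanHausdorffMeasure_eq_volume n).symm
  have h1 : (vol n).restrict K ≤ C • ((volume : Measure (Euc n)).restrict (φ '' K)).map φ.symm := by
    refine Measure.le_iff.2 fun s hs => ?_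
    rw [Measure.smul_apply, Measure.map_apply_of_aemeasurable hmK' hs, Measure.restrict_apply hs,
      Measure.restrict_apply' hK'.isClosed.measurableSet]
    have hsub : s ∩ K = φ.symm '' (φ.symm ⁻¹' s ∩ φ '' K) := by
      ext q
      constructor
      · rintro ⟨hq, hqK⟩
        exact ⟨φ q, ⟨by simpa [φ.left_inv (hKs hqK)] using hq, q, hqK, rfl⟩,
          φ.left_inv (hKs hqK)⟩
      · rintro ⟨_, ⟨hy, q', hq', rfl⟩, rfl⟩
        exact ⟨hy, by rwa [φ.left_inv (hKs hq')]⟩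
    rw [hsub, hvol]
    refine (euclideanHausdorffMeasure_image_le (hB.mono inter_subset_right) n).trans ?_
    rw [ENNReal.smul_def, smul_eq_mul]
    gcongr
    exact_mod_cast (le_max_right _ _).trans (le_max_right _ _)
  have h2 : (volume : Measure (Euc n)).restrict (φ '' K) ≤ C • ((vol n).restrict K).map φ := by
    refine Measure.le_iff.2 fun s hs => ?_
    rw [Measure.smul_apply, Measure.map_apply_of_aemeasurable hmK hs, Measure.restrict_apply hs,
      Measure.restrict_apply' hK.isClosed.measurableSet]
    have hsub : s ∩ φ '' K = φ '' (φ ⁻¹' s ∩ K) := by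
      rw [inter_comm, inter_comm (φ ⁻¹' s), image_inter_preimage]
    rw [hsub, hvol]
    refine (euclideanHausdorffMeasure_image_le (hA.mono inter_subset_right) n).trans ?_
    rw [ENNReal.smul_def, smul_eq_mul]
    change _ ≤ _ * (Measure.euclideanHausdorffMeasure n : Measure M) _
    gcongr
    exact_mod_cast (le_max_left _ _).trans (le_max_right _ _)
  refine ⟨C, hφ, hKs, fun f => ?_, fun f => ?_, fun q hq e => ?_, fun q hq e => ?_⟩
  · refine (lintegral_mono' h1 le_rfl).trans ?_
    rw [lintegral_smul_measure, ENNReal.smul_def, smul_eq_mul]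
    gcongr
    refine (lintegral_map_le _ _).trans (setLIntegral_congr_fun hK'.isClosed.measurableSet ?_).le
    intro y hy
    simp only [φ.right_inv (hKt hy)]
  · refine (lintegral_mono' h2 le_rfl).trans ?_
    rw [lintegral_smul_measure, ENNReal.smul_def, smul_eq_mul]
    gcongr
    exact lintegral_map_le _ _
  · refine (hD _ (mem_image_of_mem _ hq) e).1.trans ?_
    have := coordNorm_nonneg φ (φ q) e
    gcongr
    exact le_max_left _ _
  · refine (hD _ (mem_image_of_mem _ hq) e).2.trans ?_
    gcongr
    exact le_max_left _ _

/-- The bounds in a chart pass to charts with controlled transition map. -/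
theorem ChartBounds.of_transition {K : Set M} (hK : IsCompact K) {C : ℝ≥0}
    {φ ψ : OpenPartialHomeomorph M (Euc n)} (h : ChartBounds K C φ)
    (hψ : ψ ∈ IsManifold.maximalAtlas 𝓘(ℝ, Euc n) ∞ M) (hKψ : K ⊆ ψ.source)
    (hdet : ∀ z ∈ φ '' K, |(fderiv ℝ (ψ ∘ φ.symm) z).det| ∈ Icc (1 / 2 : ℝ) 2)
    (hnorm : ∀ z ∈ φ '' K, ∀ e, ‖e‖ ≤ 2 * ‖fderiv ℝ (ψ ∘ φ.symm) z e‖ ∧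
      ‖fderiv ℝ (ψ ∘ φ.symm) z e‖ ≤ 2 * ‖e‖) :
    ChartBounds K (2 * C) ψ := by
  have hK' : IsCompact (φ '' K) := hK.image_of_continuousOn (φ.continuousOn.mono h.sub)
  have hKt : φ '' K ⊆ φ.target := by
    rintro _ ⟨q, hq, rfl⟩
    exact φ.map_source (h.sub hq)
  set F := ψ ∘ φ.symm
  have hF : ∀ q ∈ K, F (φ q) = ψ q := fun q hq => by simp [F, φ.left_inv (h.sub hq)]
  have himg : ψ '' K = F '' (φ '' K) := by
    rw [image_image]
    exact image_congr fun q hq => (hF q hq).symm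
  have hinj : InjOn F (φ '' K) := by
    rintro _ ⟨q, hq, rfl⟩ _ ⟨q', hq', rfl⟩ he
    rw [hF q hq, hF q' hq'] at he
    rw [ψ.injOn (hKψ hq) (hKψ hq') he]
  have hch : ∀ f : Euc n → ℝ≥0∞, ∫⁻ y in ψ '' K, f y =
      ∫⁻ z in φ '' K, ENNReal.ofReal |(fderiv ℝ F z).det| * f (F z) := fun f => by
    rw [himg]
    refine lintegral_image_eq_lintegral_abs_det_fderiv_mul _ hK'.isClosed.measurableSet ?_ hinj f
    rintro _ ⟨q, hq, rfl⟩
    refine (differentiableAt_transition hψ h.mem (hKt (mem_image_of_mem _ hq)) ?_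
      ).hasFDerivAt.hasFDerivWithinAt
    rw [φ.left_inv (h.sub hq)]
    exact hKψ hq
  -- The lower bound makes the differential injective, hence onto, so the norm bounds for `ψ` can be
  -- tested on images of vectors of the chart `φ`, which have the same Riemannian length.
  have hsurj : ∀ q ∈ K, ∀ e', ∃ e, fderiv ℝ F (φ q) e = e' ∧ coordNorm φ (φ q) e =
      coordNorm ψ (ψ q) e' := by
    intro q hq e'
    have hi : Function.Injective (fderiv ℝ F (φ q)) := by
      refine (injective_iff_map_eq_zero _).2 fun e he => ?_
      have := (hnorm _ (mem_image_of_mem _ hq) e).1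
      rw [he, norm_zero, mul_zero] at this
      exact norm_le_zero_iff.1 this
    obtain ⟨e, he⟩ := (LinearMap.injective_iff_surjective (f := (fderiv ℝ F (φ q) :
      Euc n →ₗ[ℝ] Euc n))).1 hi e'
    refine ⟨e, he, ?_⟩
    rw [coordNorm_transition hψ h.mem (hKt (mem_image_of_mem _ hq))
      (by rw [φ.left_inv (h.sub hq)]; exact hKψ hq)]
    change coordNorm ψ (F (φ q)) (fderiv ℝ F (φ q) e) = _
    rw [hF q hq]
    exact congrArg _ he
  refine ⟨hψ, hKψ, fun f => ?_, fun f => ?_, fun q hq e' => ?_, fun q hq e' => ?_⟩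
  · calc ∫⁻ q in K, f (ψ q) ∂(vol n) = ∫⁻ q in K, f (F (φ q)) ∂(vol n) :=
          setLIntegral_congr_fun hK.isClosed.measurableSet fun q hq => by rw [hF q hq]
      _ ≤ C * ∫⁻ z in φ '' K, f (F z) := h.lintegral_le _
      _ ≤ C * ∫⁻ z in φ '' K, 2 * (ENNReal.ofReal |(fderiv ℝ F z).det| * f (F z)) := by
          refine mul_le_mul_right (setLIntegral_mono' hK'.isClosed.measurableSet fun z hz => ?_) _
          rw [← mul_assoc]
          refine le_mul_of_one_le_left zero_le ?_
          have hd := (hdet z hz).1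
          generalize |(fderiv ℝ F z).det| = d at hd
          rw [show (2 : ℝ≥0∞) = ENNReal.ofReal 2 by simp, ← ENNReal.ofReal_mul (by norm_num),
            ENNReal.one_le_ofReal]
          linarith
      _ = _ := by
          rw [lintegral_const_mul' _ _ (by simp), ← hch, ← mul_assoc, mul_comm (C : ℝ≥0∞)]
          simp
  · rw [hch]
    calc ∫⁻ z in φ '' K, ENNReal.ofReal |(fderiv ℝ F z).det| * f (F z)
        ≤ ∫⁻ z in φ '' K, 2 * f (F z) := by
          refine setLIntegral_mono' hK'.isClosed.measurableSet fun z hz => ?_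
          gcongr
          have hd := (hdet z hz).2
          generalize |(fderiv ℝ F z).det| = d at hd
          rw [show (2 : ℝ≥0∞) = ENNReal.ofReal 2 by simp]
          exact ENNReal.ofReal_le_ofReal hd
      _ = 2 * ∫⁻ z in φ '' K, f (F z) := lintegral_const_mul' _ _ (by simp)
      _ ≤ 2 * (C * ∫⁻ q in K, f (F (φ q)) ∂(vol n)) := by
          gcongr
          exact h.le_lintegral fun z => f (F z)
      _ = _ := by
          rw [← mul_assoc]
          push_cast
          congr 1
          exact setLIntegral_congr_fun hK.isClosed.measurableSet fun q hq => by
            simp only [hF q hq]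
  · obtain ⟨e, he, hn⟩ := hsurj q hq e'
    rw [← hn, ← he]
    have h1 := (hnorm _ (mem_image_of_mem _ hq) e).2
    have h2 := h.norm_le q hq e
    push_cast
    linarith
  · obtain ⟨e, he, hn⟩ := hsurj q hq e'
    rw [← hn, ← he]
    have h1 := (hnorm _ (mem_image_of_mem _ hq) e).1
    have h2 := h.le_norm q hq e
    push_cast
    nlinarith [C.coe_nonneg]

end ChartMeasure
end BubbleFamilies
end

open Set Filter Topology MeasureTheory Bundle Manifold
open scoped ENNReal NNReal ContDiff

noncomputable section

set_option linter.unusedSectionVars false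

namespace BubbleFamilies

/-! ### Converging families of charts -/

section ChartFamilies

attribute [local instance 2000] chartedSpaceSelf

variable {n : ℕ} {M : Type*} [MetricSpace M] [ChartedSpace (Euc n) M]
  [IsManifold 𝓘(ℝ, Euc n) ∞ M]

/-- Smooth charts `φ_ε` defined on `U` and converging to `φ_0` in `C^k_loc(U)` for all `k`. -/
structure ConvergingCharts (U : Set M) (φ : ℝ → OpenPartialHomeomorph M (Euc n)) : Prop where
  isOpen : IsOpen U
  mem : ∀ ε, 0 ≤ ε → φ ε ∈ IsManifold.maximalAtlas 𝓘(ℝ, Euc n) ∞ M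
  sub : ∀ ε, 0 ≤ ε → U ⊆ (φ ε).source
  conv : ∀ K : Set M, IsCompact K → K ⊆ U → ∀ k : ℕ,
    TendstoUniformlyOn (fun ε => iteratedFDeriv ℝ k (φ ε ∘ (φ 0).symm))
      (iteratedFDeriv ℝ k (φ 0 ∘ (φ 0).symm)) (𝓝[>] (0 : ℝ)) (φ 0 '' K)

theorem ConvergingCharts.mono {U V : Set M} {φ : ℝ → OpenPartialHomeomorph M (Euc n)}
    (h : ConvergingCharts U φ) (hV : IsOpen V) (hVU : V ⊆ U) : ConvergingCharts V φ :=
  ⟨hV, h.mem, fun ε hε => hVU.trans (h.sub ε hε), fun K hK hKV => h.conv K hK (hKV.trans hVU)⟩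

theorem chart_comp_symm_eventuallyEq (φ : OpenPartialHomeomorph M (Euc n)) {y : Euc n}
    (hy : y ∈ φ.target) : φ ∘ φ.symm =ᶠ[𝓝 y] id := by
  filter_upwards [φ.open_target.mem_nhds hy] with z hz using φ.right_inv hz

namespace ConvergingCharts

variable {U K : Set M} {φ φ' : ℝ → OpenPartialHomeomorph M (Euc n)}

theorem mem_target (h : ConvergingCharts U φ) {ε : ℝ} (hε : 0 ≤ ε) {q : M} (hq : q ∈ U) :
    φ ε q ∈ (φ ε).target := (φ ε).map_source (h.sub ε hε hq)

theorem left_inv (h : ConvergingCharts U φ) {ε : ℝ} (hε : 0 ≤ ε) {q : M} (hq : q ∈ U) :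
    (φ ε).symm (φ ε q) = q := (φ ε).left_inv (h.sub ε hε hq)

theorem eventually_pos : ∀ᶠ ε in 𝓝[>] (0 : ℝ), 0 < ε := eventually_mem_nhdsWithin

/-- This and the next two lemmas extract orders 0, 1 and 2 of `conv` by evaluating differences of
multilinear maps. The limit `φ 0 ∘ (φ 0).symm` is the identity near each point, with differential
`id` and zero second derivative. -/
theorem tendstoUniformlyOn (h : ConvergingCharts U φ) (hK : IsCompact K) (hKU : K ⊆ U) :
    TendstoUniformlyOn (fun ε => φ ε) (φ 0) (𝓝[>] (0 : ℝ)) K := by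
  rw [Metric.tendstoUniformlyOn_iff]
  intro η hη
  filter_upwards [Metric.tendstoUniformlyOn_iff.1 (h.conv K hK hKU 0) η hη] with ε hε q hq
  have h1 := hε _ (mem_image_of_mem _ hq)
  rw [dist_eq_norm] at h1 ⊢
  have h2 := (ContinuousMultilinearMap.le_opNorm
    (iteratedFDeriv ℝ 0 (φ 0 ∘ (φ 0).symm) (φ 0 q) - iteratedFDeriv ℝ 0 (φ ε ∘ (φ 0).symm) (φ 0 q))
    (fun _ => 0))
  simp only [sub_apply, iteratedFDeriv_zero_apply, Function.comp, h.left_inv le_rfl (hKU hq),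
    Finset.univ_eq_empty, Finset.prod_empty, mul_one] at h2
  exact h2.trans_lt h1

theorem tendstoUniformlyOn_fderiv (h : ConvergingCharts U φ) (hK : IsCompact K) (hKU : K ⊆ U) :
    TendstoUniformlyOn (fun ε => fderiv ℝ (φ ε ∘ (φ 0).symm))
      (fun _ => ContinuousLinearMap.id ℝ (Euc n)) (𝓝[>] (0 : ℝ)) (φ 0 '' K) := by
  rw [Metric.tendstoUniformlyOn_iff]
  intro η hη
  filter_upwards [Metric.tendstoUniformlyOn_iff.1 (h.conv K hK hKU 1) η hη] with ε hε z hz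
  have h1 := hε z hz
  have hzt : z ∈ (φ 0).target := by
    obtain ⟨q, hq, rfl⟩ := hz
    exact h.mem_target le_rfl (hKU hq)
  rw [dist_eq_norm] at h1 ⊢
  refine lt_of_le_of_lt (ContinuousLinearMap.opNorm_le_bound _ (norm_nonneg _) fun e => ?_) h1
  have h2 := (ContinuousMultilinearMap.le_opNorm
    (iteratedFDeriv ℝ 1 (φ 0 ∘ (φ 0).symm) z - iteratedFDeriv ℝ 1 (φ ε ∘ (φ 0).symm) z)
    (fun _ => e))
  simp only [sub_apply, iteratedFDeriv_one_apply,
    (chart_comp_symm_eventuallyEq (φ 0) hzt).fderiv_eq, fderiv_id, Finset.univ_unique,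
    Finset.prod_const, Finset.card_singleton, pow_one] at h2
  exact h2

theorem eventually_fderiv_fderiv_le (h : ConvergingCharts U φ) (hK : IsCompact K)
    (hKU : K ⊆ U) {η : ℝ} (hη : 0 < η) :
    ∀ᶠ ε in 𝓝[>] (0 : ℝ), ∀ z ∈ φ 0 '' K, ∀ e e',
      ‖fderiv ℝ (fderiv ℝ (φ ε ∘ (φ 0).symm)) z e e'‖ ≤ η * ‖e‖ * ‖e'‖ := by
  filter_upwards [Metric.tendstoUniformlyOn_iff.1 (h.conv K hK hKU 2) η hη] with ε hε z hz e e'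
  have h1 := hε z hz
  have hzt : z ∈ (φ 0).target := by
    obtain ⟨q, hq, rfl⟩ := hz
    exact h.mem_target le_rfl (hKU hq)
  rw [dist_eq_norm] at h1
  have hid : fderiv ℝ (fderiv ℝ (φ 0 ∘ (φ 0).symm)) z = 0 := by
    have : fderiv ℝ (φ 0 ∘ (φ 0).symm) =ᶠ[𝓝 z] fun _ => ContinuousLinearMap.id ℝ (Euc n) := by
      filter_upwards [(φ 0).open_target.mem_nhds hzt] with w hw
      rw [(chart_comp_symm_eventuallyEq (φ 0) hw).fderiv_eq, fderiv_id]
    rw [this.fderiv_eq, fderiv_fun_const]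
    rfl
  have h2 := (ContinuousMultilinearMap.le_opNorm
    (iteratedFDeriv ℝ 2 (φ 0 ∘ (φ 0).symm) z - iteratedFDeriv ℝ 2 (φ ε ∘ (φ 0).symm) z)
    ![e, e'])
  simp only [sub_apply, iteratedFDeriv_two_apply, hid, Fin.prod_univ_two] at h2
  simp only [zero_apply, zero_sub, norm_neg, Matrix.cons_val_zero,
    Matrix.cons_val_one] at h2
  refine h2.trans ?_
  rw [mul_assoc]
  gcongr

theorem exists_compact_mem_nhds (h : ConvergingCharts U φ) {p : M} (hp : p ∈ U) :
    ∃ K, IsCompact K ∧ K ∈ 𝓝 p ∧ K ⊆ U := by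
  have := (φ 0).open_source
  have hloc : LocallyCompactSpace M := ChartedSpace.locallyCompactSpace (Euc n) M
  obtain ⟨K, hK, h1, h2⟩ := exists_compact_subset h.isOpen hp
  exact ⟨K, hK, mem_interior_iff_mem_nhds.1 h1, h2⟩

/-- The limit is taken jointly in the parameter and in the point because the centers `x ε` move with
`ε`. -/
theorem tendsto_apply (h : ConvergingCharts U φ) {p : M} (hp : p ∈ U) :
    Tendsto (fun z : ℝ × M => φ z.1 z.2) (𝓝[>] (0 : ℝ) ×ˢ 𝓝 p) (𝓝 (φ 0 p)) := by
  obtain ⟨K, hK, hKp, hKU⟩ := h.exists_compact_mem_nhds hp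
  rw [Metric.tendsto_nhds]
  intro η hη
  have h1 := Metric.tendstoUniformlyOn_iff.1 (h.tendstoUniformlyOn hK hKU) (η / 2) (half_pos hη)
  have h2 : ∀ᶠ q in 𝓝 p, dist (φ 0 q) (φ 0 p) < η / 2 :=
    Metric.tendsto_nhds.1 ((φ 0).continuousAt (h.sub 0 le_rfl hp)) _ (half_pos hη)
  filter_upwards [h1.prod_mk (h2.and hKp)] with z hz
  have h3 := hz.1 z.2 hz.2.2
  have h4 := hz.2.1
  rw [dist_comm] at h3
  linarith [dist_triangle (φ z.1 z.2) (φ 0 z.2) (φ 0 p)]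

theorem tendsto_fderiv (h : ConvergingCharts U φ) {p : M} (hp : p ∈ U) :
    Tendsto (fun z : ℝ × M => fderiv ℝ (φ z.1 ∘ (φ 0).symm) (φ 0 z.2)) (𝓝[>] (0 : ℝ) ×ˢ 𝓝 p)
      (𝓝 (ContinuousLinearMap.id ℝ (Euc n))) := by
  obtain ⟨K, hK, hKp, hKU⟩ := h.exists_compact_mem_nhds hp
  rw [Metric.tendsto_nhds]
  intro η hη
  have h1 := Metric.tendstoUniformlyOn_iff.1 (h.tendstoUniformlyOn_fderiv hK hKU) η hη
  filter_upwards [h1.prod_mk hKp] with z hz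
  rw [dist_comm]
  exact hz.1 _ (mem_image_of_mem _ hz.2)

/-- The derivatives of the transition maps between two converging families converge. -/
theorem tendsto_fderiv_transition (h : ConvergingCharts U φ) (h' : ConvergingCharts U φ')
    {p : M} (hp : p ∈ U) :
    Tendsto (fun z : ℝ × M => fderiv ℝ (φ z.1 ∘ (φ' z.1).symm) (φ' z.1 z.2))
      (𝓝[>] (0 : ℝ) ×ˢ 𝓝 p) (𝓝 (fderiv ℝ (φ 0 ∘ (φ' 0).symm) (φ' 0 p))) := by
  set D : ℝ × M → (Euc n →L[ℝ] Euc n) := fun z => fderiv ℝ (φ z.1 ∘ (φ 0).symm) (φ 0 z.2)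
  set D' : ℝ × M → (Euc n →L[ℝ] Euc n) := fun z => fderiv ℝ (φ' z.1 ∘ (φ' 0).symm) (φ' 0 z.2)
  set T : M → (Euc n →L[ℝ] Euc n) := fun q => fderiv ℝ (φ 0 ∘ (φ' 0).symm) (φ' 0 q)
  have hD : Tendsto D (𝓝[>] (0 : ℝ) ×ˢ 𝓝 p) (𝓝 1) := h.tendsto_fderiv hp
  have hD' : Tendsto D' (𝓝[>] (0 : ℝ) ×ˢ 𝓝 p) (𝓝 1) := h'.tendsto_fderiv hp
  have hT : Tendsto (fun z : ℝ × M => T z.2) (𝓝[>] (0 : ℝ) ×ˢ 𝓝 p) (𝓝 (T p)) := by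
    refine Tendsto.comp (g := T) (y := 𝓝 p) ?_ tendsto_snd
    have h1 : ContinuousAt (fderiv ℝ (φ 0 ∘ (φ' 0).symm)) (φ' 0 p) :=
      ((contDiffOn_transition (h.mem 0 le_rfl) (h'.mem 0 le_rfl)).continuousOn_fderiv_of_isOpen
        (isOpen_transition _ _) (by simp)).continuousAt ((isOpen_transition _ _).mem_nhds
        ⟨h'.mem_target le_rfl hp, by
          rw [mem_preimage, h'.left_inv le_rfl hp]; exact h.sub 0 le_rfl hp⟩)
    exact ContinuousAt.comp (f := φ' 0) h1 ((φ' 0).continuousAt (h'.sub 0 le_rfl hp))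
  -- `D'` is close to the identity, hence invertible. Factoring `φ ε ∘ (φ' 0).symm` through `φ' ε`
  -- and through `φ 0` gives `(unknown) * D' = D * T`, so the unknown differential is `D * T *
  -- D'⁻¹`.
  have hinv : Tendsto (fun z => Ring.inverse (D' z)) (𝓝[>] (0 : ℝ) ×ˢ 𝓝 p) (𝓝 1) := by
    have := (NormedRing.inverse_continuousAt (1 : (Euc n →L[ℝ] Euc n)ˣ)).tendsto.comp
      (hD' : Tendsto D' _ (𝓝 ((1 : (Euc n →L[ℝ] Euc n)ˣ) : Euc n →L[ℝ] Euc n)))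
    rw [Units.val_one, Ring.inverse_one] at this
    exact this
  have hunit : ∀ᶠ z in 𝓝[>] (0 : ℝ) ×ˢ 𝓝 p, IsUnit (D' z) :=
    hD'.eventually (Units.isOpen.mem_nhds isUnit_one)
  have hlim := (hD.mul hT).mul hinv
  rw [one_mul, mul_one] at hlim
  refine hlim.congr' ?_
  have hpos : ∀ᶠ z in 𝓝[>] (0 : ℝ) ×ˢ 𝓝 p, 0 < z.1 ∧ z.2 ∈ U :=
    eventually_pos.prod_mk (h.isOpen.mem_nhds hp)
  filter_upwards [hunit, hpos] with z hz hzz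
  obtain ⟨hε, hq⟩ := hzz
  obtain ⟨ε, q⟩ := z
  simp only at hε hq hz ⊢
  have hy : φ' 0 q ∈ (φ' 0).target := h'.mem_target le_rfl hq
  have hl : (φ' 0).symm (φ' 0 q) = q := h'.left_inv le_rfl hq
  have hd1 : DifferentiableAt ℝ (φ ε ∘ (φ 0).symm) ((φ 0 ∘ (φ' 0).symm) (φ' 0 q)) := by
    rw [Function.comp_apply, hl]
    exact differentiableAt_transition (h.mem ε hε.le) (h.mem 0 le_rfl) (h.mem_target le_rfl hq)
      (by rw [h.left_inv le_rfl hq]; exact h.sub ε hε.le hq)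
  have hd2 : DifferentiableAt ℝ (φ 0 ∘ (φ' 0).symm) (φ' 0 q) :=
    differentiableAt_transition (h.mem 0 le_rfl) (h'.mem 0 le_rfl) hy
      (by rw [hl]; exact h.sub 0 le_rfl hq)
  have hd3 : DifferentiableAt ℝ (φ' ε ∘ (φ' 0).symm) (φ' 0 q) :=
    differentiableAt_transition (h'.mem ε hε.le) (h'.mem 0 le_rfl) hy
      (by rw [hl]; exact h'.sub ε hε.le hq)
  have hd4 : DifferentiableAt ℝ (φ ε ∘ (φ' ε).symm) ((φ' ε ∘ (φ' 0).symm) (φ' 0 q)) := by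
    rw [Function.comp_apply, hl]
    exact differentiableAt_transition (h.mem ε hε.le) (h'.mem ε hε.le) (h'.mem_target hε.le hq)
      (by rw [h'.left_inv hε.le hq]; exact h.sub ε hε.le hq)
  have hcomp : (φ ε ∘ (φ' ε).symm) ∘ (φ' ε ∘ (φ' 0).symm) =ᶠ[𝓝 (φ' 0 q)]
      (φ ε ∘ (φ 0).symm) ∘ (φ 0 ∘ (φ' 0).symm) := by
    have hUq : (φ' 0).symm ⁻¹' U ∈ 𝓝 (φ' 0 q) :=
      ((φ' 0).continuousAt_symm hy).preimage_mem_nhds (h.isOpen.mem_nhds (by rwa [hl]))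
    filter_upwards [hUq] with w hw
    simp only [Function.comp, h'.left_inv hε.le hw, h.left_inv le_rfl hw]
  have hder := hcomp.fderiv_eq (𝕜 := ℝ)
  rw [fderiv_comp _ hd4 hd3, fderiv_comp _ hd1 hd2] at hder
  have e1 : (φ' ε ∘ (φ' 0).symm) (φ' 0 q) = φ' ε q := by simp [hl]
  have e2 : (φ 0 ∘ (φ' 0).symm) (φ' 0 q) = φ 0 q := by simp [hl]
  rw [e1, e2] at hder
  have hder' : fderiv ℝ (φ ε ∘ (φ' ε).symm) (φ' ε q) * D' (ε, q) = D (ε, q) * T q := hder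
  rw [← hder', mul_assoc, Ring.mul_inverse_cancel _ hz, mul_one]

/-- The images by `φ_ε` of a neighbourhood of `x₀` contain balls of fixed radius. -/
theorem exists_ball_subset_image (h : ConvergingCharts U φ) (hK : IsCompact K) (hKU : K ⊆ U)
    {x : ℝ → M} {x₀ : M} (hx : Tendsto x (𝓝[>] (0 : ℝ)) (𝓝 x₀)) (hx₀ : x₀ ∈ interior K) :
    ∃ δ > 0, ∀ᶠ ε in 𝓝[>] (0 : ℝ), Metric.ball (φ ε (x ε)) δ ⊆ φ ε '' K := by
  have hfr : IsCompact (frontier K) := hK.of_isClosed_subset isClosed_frontier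
    hK.isClosed.frontier_subset
  have hfrK : frontier K ⊆ K := hK.isClosed.frontier_subset
  -- `c` separates the image of `x₀` from the image of the compact frontier; it is positive since `φ
  -- 0` is injective and `x₀` is interior.
  obtain ⟨c, hc, hcb⟩ : ∃ c > 0, ∀ q ∈ frontier K, c ≤ dist (φ 0 q) (φ 0 x₀) := by
    rcases (frontier K).eq_empty_or_nonempty with he | hne
    · exact ⟨1, one_pos, by simp [he]⟩
    · obtain ⟨q₀, hq₀, hmin⟩ := hfr.exists_isMinOn hne
        (f := fun q => dist (φ 0 q) (φ 0 x₀)) (by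
          have := (φ 0).continuousOn.mono ((hfrK.trans hKU).trans (h.sub 0 le_rfl))
          fun_prop)
      refine ⟨_, ?_, fun q hq => hmin hq⟩
      refine dist_pos.2 fun heq => ?_
      have := (φ 0).injOn (h.sub 0 le_rfl (hKU (hfrK hq₀)))
        (h.sub 0 le_rfl (hKU (interior_subset hx₀))) heq
      rw [this] at hq₀
      exact hq₀.2 hx₀
  refine ⟨c / 2, half_pos hc, ?_⟩
  have h1 := Metric.tendstoUniformlyOn_iff.1 (h.tendstoUniformlyOn hK hKU) (c / 4) (by positivity)
  have h2 : ∀ᶠ ε in 𝓝[>] (0 : ℝ), dist (φ ε (x ε)) (φ 0 x₀) < c / 4 :=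
    Metric.tendsto_nhds.1 ((h.tendsto_apply (hKU (interior_subset hx₀))).comp
      (tendsto_id.prodMk hx)) _ (by positivity)
  filter_upwards [h1, h2, eventually_pos, hx.eventually (isOpen_interior.mem_nhds hx₀)]
    with ε h1 h2 hε hxε
  have hs := h.sub ε hε.le
  have hopen : IsOpen (φ ε '' interior K) :=
    (φ ε).isOpen_image_of_subset_source isOpen_interior ((interior_subset.trans hKU).trans hs)
  have hclosed : IsClosed (φ ε '' K) :=
    (hK.image_of_continuousOn ((φ ε).continuousOn.mono (hKU.trans hs))).isClosed
  -- No point of this ball is the image of a frontier point, since `c / 4 + c / 2 + c / 4 = c`. So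
  -- the ball is covered by the disjoint open sets `φ ε '' interior K` and the complement of `φ ε ''
  -- K`; being connected and meeting the first at its center, it lies in it.
  have hsub : Metric.ball (φ ε (x ε)) (c / 2) ⊆ φ ε '' interior K := by
    refine (convex_ball _ _).isPreconnected.subset_left_of_subset_union hopen hclosed.isOpen_compl
      ?_ ?_ ?_
    · exact disjoint_compl_right.mono_left (image_mono interior_subset)
    · intro y hy
      by_cases hyK : y ∈ φ ε '' K
      · obtain ⟨q, hq, rfl⟩ := hyK
        left
        refine mem_image_of_mem _ ?_
        by_contra hqi
        have hqf : q ∈ frontier K := ⟨subset_closure hq, hqi⟩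
        have h3 := hcb q hqf
        have h4 := h1 q hq
        rw [Metric.mem_ball] at hy
        have h5 := dist_triangle4 (φ 0 q) (φ ε q) (φ ε (x ε)) (φ 0 x₀)
        linarith
      · exact Or.inr hyK
    · exact ⟨φ ε (x ε), Metric.mem_ball_self (half_pos hc), mem_image_of_mem _ hxε⟩
  exact hsub.trans (image_mono interior_subset)

end ConvergingCharts

theorem IsNormalChartFamily.exists_convergingCharts
    [RiemannianBundle (fun p : M => TangentSpace 𝓘(ℝ, Euc n) p)] {r : ℝ} {x₀ : M} {x : ℝ → M}
    {φ : ℝ → OpenPartialHomeomorph M (Euc n)} (h : IsNormalChartFamily r x₀ x φ) :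
    ∃ U, Metric.closedBall x₀ r ⊆ U ∧ ConvergingCharts U φ := by
  obtain ⟨U, hU, hb, h1, -, h2⟩ := h
  exact ⟨U, hb, hU, fun ε hε => (h1 ε hε).1, fun ε hε => (h1 ε hε).2, h2⟩

section Bounds

variable [RiemannianBundle (fun p : M => TangentSpace 𝓘(ℝ, Euc n) p)]
  [IsContMDiffRiemannianBundle 𝓘(ℝ, Euc n) ∞ (Euc n)
      (fun p : M => TangentSpace 𝓘(ℝ, Euc n) p)]
  [IsRiemannianManifold 𝓘(ℝ, Euc n) M] [MeasurableSpace M] [BorelSpace M]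

/-- The differentials of `φ ε ∘ (φ 0).symm` tend uniformly to the identity, near which the
determinant stays in `[1/2, 2]` and lengths change by a factor at most 2. One constant therefore
serves for all small `ε`. -/
theorem ConvergingCharts.exists_chartBounds {U K : Set M}
    {φ : ℝ → OpenPartialHomeomorph M (Euc n)}
    (h : ConvergingCharts U φ) (hK : IsCompact K) (hKU : K ⊆ U) :
    ∃ C : ℝ≥0, ChartBounds K C (φ 0) ∧ ∀ᶠ ε in 𝓝[>] (0 : ℝ), ChartBounds K C (φ ε) := by
  obtain ⟨C, hC⟩ := BubbleFamilies.exists_chartBounds (h.mem 0 le_rfl) hK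
    (hKU.trans (h.sub 0 le_rfl))
  have hdet : ∀ᶠ A : Euc n →L[ℝ] Euc n in 𝓝 (ContinuousLinearMap.id ℝ (Euc n)),
      |A.det| ∈ Icc (1 / 2 : ℝ) 2 ∧ dist (ContinuousLinearMap.id ℝ (Euc n)) A < 1 / 2 := by
    have h1 : ContinuousAt (fun A : Euc n →L[ℝ] Euc n => |A.det|)
        (ContinuousLinearMap.id ℝ (Euc n)) :=
      ContinuousLinearMap.continuous_det.abs.continuousAt
    have h2 : |(ContinuousLinearMap.id ℝ (Euc n)).det| = 1 := by
      simp [ContinuousLinearMap.det]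
    refine (h1.eventually ?_).and ?_
    · change Icc (1 / 2 : ℝ) 2 ∈ 𝓝 |(ContinuousLinearMap.id ℝ (Euc n)).det|
      rw [h2]
      exact Icc_mem_nhds (by norm_num) (by norm_num)
    · filter_upwards [Metric.ball_mem_nhds _ (show (0 : ℝ) < 1 / 2 by norm_num)] with A hA
      rwa [dist_comm]
  obtain ⟨η, hη, hηb⟩ := Metric.eventually_nhds_iff.1 hdet
  have h1 := Metric.tendstoUniformlyOn_iff.1 (h.tendstoUniformlyOn_fderiv hK hKU) η hη
  refine ⟨2 * C, ?_, ?_⟩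
  -- The identity transition is used here only to enlarge the constant of `φ 0` to the common one.
  · refine hC.of_transition hK (h.mem 0 le_rfl) (hKU.trans (h.sub 0 le_rfl)) ?_ ?_
    all_goals
      intro z hz
      obtain ⟨q, hq, rfl⟩ := hz
      rw [(chart_comp_symm_eventuallyEq (φ 0) (h.mem_target le_rfl (hKU hq))).fderiv_eq, fderiv_id]
    · simp only [ContinuousLinearMap.det, ContinuousLinearMap.coe_id, LinearMap.det_id, abs_one]
      norm_num
    · intro e
      simp only [ContinuousLinearMap.id_apply]
      constructor <;> linarith [norm_nonneg e]
  filter_upwards [h1, eventually_pos] with ε hε hpos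
  refine hC.of_transition hK (h.mem ε hpos.le) (hKU.trans (h.sub ε hpos.le))
    (fun z hz => (hηb (by rw [dist_comm]; exact hε z hz)).1) fun z hz e => ?_
  have h2 := (hηb (by rw [dist_comm]; exact hε z hz)).2
  rw [dist_eq_norm] at h2
  have h3 := ContinuousLinearMap.le_opNorm
    (ContinuousLinearMap.id ℝ (Euc n) - fderiv ℝ (φ ε ∘ (φ 0).symm) z) e
  simp only [sub_apply, ContinuousLinearMap.id_apply] at h3
  have h4 : ‖e - fderiv ℝ (φ ε ∘ (φ 0).symm) z e‖ ≤ 1 / 2 * ‖e‖ :=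
    h3.trans (by gcongr)
  have h5 := norm_sub_norm_le e (fderiv ℝ (φ ε ∘ (φ 0).symm) z e)
  have h6 := norm_sub_norm_le (fderiv ℝ (φ ε ∘ (φ 0).symm) z e) e
  rw [norm_sub_rev] at h6
  constructor <;> linarith [norm_nonneg e]

end Bounds

end ChartFamilies
end BubbleFamilies
end

open Set Filter Topology MeasureTheory Bundle Manifold
open scoped ENNReal NNReal ContDiff

noncomputable section

set_option linter.unusedSectionVars false

namespace BubbleFamilies

/-! ### The gradient norm and the `H¹` norm as a completion -/

section SobolevNorm

attribute [local instance 2000] chartedSpaceSelf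

variable {n : ℕ} {M : Type*} [MetricSpace M] [ChartedSpace (Euc n) M]
  [IsManifold 𝓘(ℝ, Euc n) ∞ M]
  [RiemannianBundle (fun p : M => TangentSpace 𝓘(ℝ, Euc n) p)]

theorem differential_add {u v : M → ℝ} {p : M}
    (hu : MDifferentiableAt 𝓘(ℝ, Euc n) 𝓘(ℝ, ℝ) u p)
    (hv : MDifferentiableAt 𝓘(ℝ, Euc n) 𝓘(ℝ, ℝ) v p) :
    differential (n := n) (u + v) p = differential (n := n) u p + differential (n := n) v p :=
  (hu.hasMFDerivAt.add hv.hasMFDerivAt).mfderiv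

theorem differential_neg (u : M → ℝ) (p : M) :
    differential (n := n) (-u) p = -differential (n := n) u p :=
  mfderiv_neg

theorem differential_mul {u v : M → ℝ} {p : M}
    (hu : MDifferentiableAt 𝓘(ℝ, Euc n) 𝓘(ℝ, ℝ) u p)
    (hv : MDifferentiableAt 𝓘(ℝ, Euc n) 𝓘(ℝ, ℝ) v p) :
    differential (n := n) (u * v) p =
      u p • differential (n := n) v p + v p • differential (n := n) u p :=
  (hu.hasMFDerivAt.mul hv.hasMFDerivAt).mfderiv

theorem gradNorm_add_le {u v : M → ℝ} {p : M}
    (hu : MDifferentiableAt 𝓘(ℝ, Euc n) 𝓘(ℝ, ℝ) u p)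
    (hv : MDifferentiableAt 𝓘(ℝ, Euc n) 𝓘(ℝ, ℝ) v p) :
    gradNorm (n := n) (u + v) p ≤ gradNorm (n := n) u p + gradNorm (n := n) v p := by
  unfold gradNorm
  rw [differential_add hu hv]
  exact norm_add_le (E := TangentSpace 𝓘(ℝ, Euc n) p →L[ℝ] ℝ) _ _

theorem gradNorm_neg (u : M → ℝ) (p : M) :
    gradNorm (n := n) (-u) p = gradNorm (n := n) u p := by
  unfold gradNorm
  rw [differential_neg]
  exact norm_neg (E := TangentSpace 𝓘(ℝ, Euc n) p →L[ℝ] ℝ) _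

theorem gradNorm_mul_le {u v : M → ℝ} {p : M}
    (hu : MDifferentiableAt 𝓘(ℝ, Euc n) 𝓘(ℝ, ℝ) u p)
    (hv : MDifferentiableAt 𝓘(ℝ, Euc n) 𝓘(ℝ, ℝ) v p) :
    gradNorm (n := n) (u * v) p ≤
      |u p| * gradNorm (n := n) v p + |v p| * gradNorm (n := n) u p := by
  unfold gradNorm
  rw [differential_mul hu hv]
  refine ContinuousLinearMap.opNorm_le_bound _ (add_nonneg
    (mul_nonneg (abs_nonneg _) (gradNorm_nonneg v p))
    (mul_nonneg (abs_nonneg _) (gradNorm_nonneg u p))) fun w => ?_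
  have h1 : |differential (n := n) v p w| ≤ gradNorm (n := n) v p * ‖w‖ :=
    (differential (n := n) v p).le_opNorm w
  have h2 : |differential (n := n) u p w| ≤ gradNorm (n := n) u p * ‖w‖ :=
    (differential (n := n) u p).le_opNorm w
  change |u p * differential (n := n) v p w + v p * differential (n := n) u p w| ≤
    (|u p| * gradNorm (n := n) v p + |v p| * gradNorm (n := n) u p) * ‖w‖
  refine (abs_add_le _ _).trans ?_
  rw [abs_mul, abs_mul, add_mul, mul_assoc, mul_assoc]
  gcongr

theorem gradNorm_congr {u v : M → ℝ} {p : M} (h : u =ᶠ[𝓝 p] v) :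
    gradNorm (n := n) u p = gradNorm (n := n) v p := by
  unfold gradNorm differential
  rw [h.mfderiv_eq]

theorem gradNorm_zero (p : M) : gradNorm (n := n) (0 : M → ℝ) p = 0 := by
  have h : differential (n := n) (0 : M → ℝ) p = 0 := mfderiv_const
  unfold gradNorm
  rw [h]
  exact norm_zero (E := TangentSpace 𝓘(ℝ, Euc n) p →L[ℝ] ℝ)

variable [IsContMDiffRiemannianBundle 𝓘(ℝ, Euc n) ∞ (Euc n)
      (fun p : M => TangentSpace 𝓘(ℝ, Euc n) p)]
  [MeasurableSpace M] [BorelSpace M]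

theorem smoothH1Norm_zero : smoothH1Norm n (0 : M → ℝ) = 0 := by
  have h : gradNorm (n := n) (0 : M → ℝ) = 0 := funext gradNorm_zero
  simp [smoothH1Norm, h]

theorem smoothH1Norm_neg (u : M → ℝ) : smoothH1Norm n (-u) = smoothH1Norm n u := by
  have h : gradNorm (n := n) (-u) = gradNorm (n := n) u := funext (gradNorm_neg u)
  simp [smoothH1Norm, h, eLpNorm_neg]

variable [CompactSpace M]

theorem smoothH1Norm_add_le {u v : M → ℝ} (hu : ContMDiff 𝓘(ℝ, Euc n) 𝓘(ℝ, ℝ) ∞ u)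
    (hv : ContMDiff 𝓘(ℝ, Euc n) 𝓘(ℝ, ℝ) ∞ v) :
    smoothH1Norm n (u + v) ≤ smoothH1Norm n u + smoothH1Norm n v := by
  have h1 := eLpNorm_add_le (μ := vol n) (p := 2) hu.continuous.aestronglyMeasurable
    hv.continuous.aestronglyMeasurable (by norm_num)
  have h2 := eLpNorm_add_le (μ := vol n) (p := 2)
    (measurable_gradNorm (n := n) hu).aestronglyMeasurable
    (measurable_gradNorm (n := n) hv).aestronglyMeasurable (by norm_num)
  have h3 : eLpNorm (gradNorm (n := n) (u + v)) 2 (vol n) ≤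
      eLpNorm (gradNorm (n := n) u + gradNorm (n := n) v) 2 (vol n) := by
    refine eLpNorm_mono_real fun p => ?_
    rw [Real.norm_of_nonneg (gradNorm_nonneg _ _)]
    exact gradNorm_add_le (hu.mdifferentiable (by simp) p) (hv.mdifferentiable (by simp) p)
  unfold smoothH1Norm
  calc _ ≤ (eLpNorm u 2 (vol n) + eLpNorm v 2 (vol n)) +
        (eLpNorm (gradNorm (n := n) u) 2 (vol n) + eLpNorm (gradNorm (n := n) v) 2 (vol n)) :=
        add_le_add h1 (h3.trans h2)
    _ = _ := by abel

theorem IsH1Approx.add {w w' : M → ℝ} {u u' : ℕ → M → ℝ} (h : IsH1Approx n w u)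
    (h' : IsH1Approx n w' u') : IsH1Approx n (w + w') (fun k => u k + u' k) where
  aesm := h.aesm.add h'.aesm
  smooth k := (h.smooth k).add (h'.smooth k)
  cauchy := by
    refine tendsto_of_tendsto_of_tendsto_of_le_of_le tendsto_const_nhds
      (by simpa using h.cauchy.add h'.cauchy) (fun _ => zero_le) fun q => ?_
    have : (u q.1 + u' q.1) - (u q.2 + u' q.2) = (u q.1 - u q.2) + (u' q.1 - u' q.2) := by abel
    simp only [this]
    exact smoothH1Norm_add_le ((h.smooth _).sub (h.smooth _)) ((h'.smooth _).sub (h'.smooth _))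
  tendsto := by
    refine tendsto_of_tendsto_of_tendsto_of_le_of_le tendsto_const_nhds
      (by simpa using h.tendsto.add h'.tendsto) (fun _ => zero_le) fun k => ?_
    have : (u k + u' k) - (w + w') = (u k - w) + (u' k - w') := by abel
    simp only [this]
    exact eLpNorm_add_le ((h.smooth k).continuous.aestronglyMeasurable.sub h.aesm)
      ((h'.smooth k).continuous.aestronglyMeasurable.sub h'.aesm) (by norm_num)

theorem IsH1Approx.neg {w : M → ℝ} {u : ℕ → M → ℝ} (h : IsH1Approx n w u) :
    IsH1Approx n (-w) (fun k => -u k) where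
  aesm := h.aesm.neg
  smooth k := (h.smooth k).neg
  cauchy := by
    refine h.cauchy.congr fun q => ?_
    rw [← smoothH1Norm_neg]
    congr 1
    abel
  tendsto := by
    refine h.tendsto.congr fun q => ?_
    rw [← eLpNorm_neg]
    congr 1
    abel

theorem IsH1Approx.congr {w w' : M → ℝ} {u : ℕ → M → ℝ} (h : IsH1Approx n w u)
    (hw : w =ᵐ[vol n] w') : IsH1Approx n w' u where
  aesm := h.aesm.congr hw
  smooth := h.smooth
  cauchy := h.cauchy
  tendsto := by
    refine h.tendsto.congr fun k => eLpNorm_congr_ae ?_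
    filter_upwards [hw] with p hp
    simp [hp]

theorem IsH1Approx.const {w : M → ℝ} (hw : ContMDiff 𝓘(ℝ, Euc n) 𝓘(ℝ, ℝ) ∞ w) :
    IsH1Approx n w (fun _ => w) where
  aesm := hw.continuous.aestronglyMeasurable
  smooth _ := hw
  cauchy := by simp [smoothH1Norm_zero]
  tendsto := by simp

theorem h1Norm_le {w : M → ℝ} {u : ℕ → M → ℝ} (h : IsH1Approx n w u) :
    h1Norm n w ≤ limsup (fun k => smoothH1Norm n (u k)) atTop :=
  iInf₂_le u h

theorem h1Norm_zero : h1Norm n (0 : M → ℝ) = 0 := by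
  have := h1Norm_le (IsH1Approx.const (n := n) (w := (0 : M → ℝ)) contMDiff_const)
  simpa [smoothH1Norm_zero] using this

/-- As `h1Norm` is an infimum over approximating sequences, it suffices to add two almost optimal
ones; independence of the limit from the sequence is not needed. If one function is outside `H¹` the
right side is infinite. -/
theorem h1Norm_add_le (w w' : M → ℝ) : h1Norm n (w + w') ≤ h1Norm n w + h1Norm n w' := by
  refine le_of_forall_gt fun c hc => ?_
  obtain ⟨a, ha, b, hb, hab⟩ := ENNReal.exists_add_lt_of_add_lt hc
  simp only [h1Norm, iInf_lt_iff] at ha hb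
  obtain ⟨u, hu, ha⟩ := ha
  obtain ⟨u', hu', hb⟩ := hb
  refine ((h1Norm_le (hu.add hu')).trans ?_).trans_lt hab
  refine limsup_le_of_le (by isBoundedDefault) ?_
  filter_upwards [eventually_lt_of_limsup_lt ha, eventually_lt_of_limsup_lt hb] with k h1 h2
  exact (smoothH1Norm_add_le (hu.smooth k) (hu'.smooth k)).trans (add_le_add h1.le h2.le)

theorem h1Norm_neg_le (w : M → ℝ) : h1Norm n (-w) ≤ h1Norm n w := by
  refine le_iInf₂ fun u hu => ?_
  refine (h1Norm_le hu.neg).trans ?_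
  simp [smoothH1Norm_neg]

theorem h1Norm_neg (w : M → ℝ) : h1Norm n (-w) = h1Norm n w :=
  le_antisymm (h1Norm_neg_le w) (by simpa using h1Norm_neg_le (-w))

theorem h1Norm_congr_ae {w w' : M → ℝ} (h : w =ᵐ[vol n] w') : h1Norm n w = h1Norm n w' := by
  have key : ∀ {w w' : M → ℝ}, w =ᵐ[vol n] w' → h1Norm n w ≤ h1Norm n w' := fun h =>
    le_iInf₂ fun u hu => h1Norm_le (hu.congr h.symm)
  exact le_antisymm (key h) (key h.symm)

theorem TendstoZeroH1.add {w w' : ℝ → M → ℝ} (h : TendstoZeroH1 n w) (h' : TendstoZeroH1 n w') :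
    TendstoZeroH1 n (fun ε => w ε + w' ε) :=
  tendsto_of_tendsto_of_tendsto_of_le_of_le tendsto_const_nhds
    (by simpa using Tendsto.add h h') (fun _ => zero_le) fun _ => h1Norm_add_le _ _

theorem TendstoZeroH1.neg {w : ℝ → M → ℝ} (h : TendstoZeroH1 n w) :
    TendstoZeroH1 n (fun ε => -w ε) := by
  refine Tendsto.congr (fun ε => ?_) h
  rw [h1Norm_neg]

theorem TendstoZeroH1.congr_ae {w w' : ℝ → M → ℝ} (h : TendstoZeroH1 n w)
    (hw : ∀ᶠ ε in 𝓝[>] (0 : ℝ), w ε =ᵐ[vol n] w' ε) : TendstoZeroH1 n w' := by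
  refine Tendsto.congr' ?_ h
  filter_upwards [hw] with ε hε using h1Norm_congr_ae hε

theorem tendstoZeroH1_zero : TendstoZeroH1 n (fun _ => (0 : M → ℝ)) := by
  simp [TendstoZeroH1, h1Norm_zero]

end SobolevNorm
end BubbleFamilies
end

open Set Filter Topology MeasureTheory Bundle Manifold
open scoped ENNReal NNReal ContDiff

noncomputable section

set_option linter.unusedSectionVars false

namespace BubbleFamilies

/-! ### Mollification of Lipschitz functions on Euclidean space -/

section Mollification

/-- A function which is Lipschitz on a set and vanishes outside of its interior is Lipschitz. -/
theorem lipschitzWith_of_lipschitzOnWith {E : Type*} [NormedAddCommGroup E] [NormedSpace ℝ E]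
    {f : E → ℝ} {L : ℝ≥0} {W K : Set E} (hW : IsOpen W) (hWK : closure W ⊆ K)
    (hf : LipschitzOnWith L f K) (h0 : ∀ y ∉ W, f y = 0) : LipschitzWith L f := by
  have key : ∀ y ∈ W, ∀ y' ∉ W, dist (f y) (f y') ≤ L * dist y y' := by
    intro y hy y' hy'
    -- The segment leaves the open set `W` through a frontier point `b`, where `f` vanishes; the
    -- Lipschitz bound between `y` and `b` then suffices because `b` lies between `y` and `y'`.
    obtain ⟨b, hb, hbf⟩ : (segment ℝ y y' ∩ frontier W).Nonempty :=
      by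
      by_contra hne
      obtain ⟨z, -, hz, hz'⟩ := (convex_segment (𝕜 := ℝ) y y').isPreconnected W (closure W)ᶜ hW
        isClosed_closure.isOpen_compl (fun z hz => by
          by_contra h
          simp only [mem_union, mem_compl_iff, not_or, not_not] at h
          exact hne ⟨z, hz, by rw [hW.frontier_eq]; exact ⟨h.2, h.1⟩⟩)
        ⟨y, left_mem_segment ℝ y y', hy⟩
        ⟨y', right_mem_segment ℝ y y', fun h => hne
          ⟨y', right_mem_segment ℝ y y', by rw [hW.frontier_eq]; exact ⟨h, hy'⟩⟩⟩
      exact hz' (subset_closure hz)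
    have hbW : b ∉ W := by
      rw [hW.frontier_eq] at hbf
      exact hbf.2
    rw [h0 y' hy', ← h0 b hbW]
    refine (hf.dist_le_mul y (hWK (subset_closure hy)) b (hWK hbf.1)).trans ?_
    gcongr
    have := dist_add_dist_of_mem_segment hb
    linarith [dist_nonneg (x := b) (y := y')]
  refine LipschitzWith.of_dist_le_mul fun y y' => ?_
  by_cases hy : y ∈ W <;> by_cases hy' : y' ∈ W
  · exact hf.dist_le_mul y (hWK (subset_closure hy)) y' (hWK (subset_closure hy'))
  · exact key y hy y' hy'
  · rw [dist_comm, dist_comm y]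
    exact key y' hy' y hy
  · rw [h0 y hy, h0 y' hy', dist_self]
    positivity

variable {n : ℕ}

theorem lipschitzWith_normed_convolution (ρ : ContDiffBump (0 : Euc n)) {F : Euc n → ℝ} {L : ℝ≥0}
    (hF : LipschitzWith L F) :
    LipschitzWith L (fun y => ∫ t, ρ.normed volume t • F (y - t)) := by
  have hint : ∀ y, Integrable (fun t => ρ.normed volume t • F (y - t)) := fun y =>
    (ρ.continuous_normed.smul (hF.continuous.comp (by fun_prop))).integrable_of_hasCompactSupport
      ρ.hasCompactSupport_normed.smul_right
  refine LipschitzWith.of_dist_le_mul fun y y' => ?_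
  rw [dist_eq_norm, ← integral_sub (hint y) (hint y')]
  refine (norm_integral_le_of_norm_le (g := fun t => ρ.normed volume t * (L * dist y y'))
    (ρ.integrable_normed.mul_const _) (Eventually.of_forall fun t => ?_)).trans_eq ?_
  · rw [← smul_sub, norm_smul, Real.norm_of_nonneg (ρ.nonneg_normed t), ← dist_eq_norm]
    refine mul_le_mul_of_nonneg_left ?_ (ρ.nonneg_normed t)
    simpa using hF.dist_le_mul (y - t) (y' - t)
  · rw [integral_mul_const, ρ.integral_normed, one_mul]

/-- By Rademacher's theorem `F` is differentiable at `y - t` for almost every `t`, and the Lipschitz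
constant dominates the difference quotients. The derivative thus falls on `F` rather than on the
kernel, and the gradient of the mollification is the mollification of the gradient. -/
theorem hasFDerivAt_normed_convolution (ρ : ContDiffBump (0 : Euc n)) {F : Euc n → ℝ} {L : ℝ≥0}
    (hF : LipschitzWith L F) (y : Euc n) :
    HasFDerivAt (fun y => ∫ t, ρ.normed volume t • F (y - t))
      (∫ t, ρ.normed volume t • fderiv ℝ F (y - t)) y := by
  have hcont : ∀ y, Continuous (fun t => ρ.normed volume t • F (y - t)) := fun y =>
    ρ.continuous_normed.smul (hF.continuous.comp (by fun_prop))
  have hae : ∀ᵐ t : Euc n, DifferentiableAt ℝ F (y - t) :=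
    (Measure.measurePreserving_sub_left volume y).quasiMeasurePreserving.ae hF.ae_differentiableAt
  refine (hasFDerivAt_integral_of_dominated_loc_of_lip (𝕜 := ℝ)
    (F := fun y t => ρ.normed volume t • F (y - t))
    (F' := fun t => ρ.normed volume t • fderiv ℝ F (y - t))
    (bound := fun t => ρ.normed volume t * L) univ_mem
    (Eventually.of_forall fun z => (hcont z).aestronglyMeasurable)
    ((hcont y).integrable_of_hasCompactSupport ρ.hasCompactSupport_normed.smul_right)
    ?_ (Eventually.of_forall fun t => ?_) (ρ.integrable_normed.mul_const _) ?_).2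
  · exact (ρ.continuous_normed.measurable.smul
      ((measurable_fderiv ℝ F).comp (measurable_const.sub measurable_id))).aestronglyMeasurable
  · refine LipschitzWith.lipschitzOnWith (LipschitzWith.of_dist_le_mul fun a b => ?_)
    rw [Real.coe_nnabs, abs_of_nonneg (mul_nonneg (ρ.nonneg_normed t) L.coe_nonneg), dist_eq_norm,
      ← smul_sub, norm_smul, Real.norm_of_nonneg (ρ.nonneg_normed t), mul_assoc, ← dist_eq_norm]
    refine mul_le_mul_of_nonneg_left ?_ (ρ.nonneg_normed t)
    simpa using hF.dist_le_mul (a - t) (b - t)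
  · filter_upwards [hae] with t ht
    have h1 : HasFDerivAt (fun z => F (z - t)) (fderiv ℝ F (y - t)) y := by
      have h2 := HasFDerivAt.comp y (g := F) (f := fun z => z - t) ht.hasFDerivAt
        ((hasFDerivAt_id y).sub_const t)
      rw [ContinuousLinearMap.comp_id] at h2
      exact h2
    exact h1.fun_const_smul _

/-- Mollification of a compactly supported Lipschitz function. -/
theorem exists_smooth_approx_of_lipschitz {F : Euc n → ℝ} {L : ℝ≥0} (hF : LipschitzWith L F)
    {S W : Set (Euc n)} (hS : IsCompact S) (hW : IsOpen W) (hSW : S ⊆ W)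
    (hFS : ∀ y ∉ S, F y = 0) :
    ∃ G : ℕ → Euc n → ℝ, (∀ j, ContDiff ℝ ∞ (G j)) ∧
      (∃ T, IsCompact T ∧ T ⊆ W ∧ ∀ j, ∀ y ∉ T, G j y = 0) ∧
      (∀ j y, ‖fderiv ℝ (G j) y‖ ≤ L) ∧
      (∃ a : ℕ → ℝ, Tendsto a atTop (𝓝 0) ∧ ∀ j y, |G j y - F y| ≤ a j) ∧
      Tendsto (fun q : ℕ × ℕ =>
        eLpNorm (fun y => fderiv ℝ (G q.1) y - fderiv ℝ (G q.2) y) 2 volume) atTop (𝓝 0) := by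
  obtain ⟨δ, hδ, hδW⟩ := hS.exists_cthickening_subset_open hW hSW
  -- Outer radii at most `δ` keep all supports in the `δ`-thickening of `S`, inside `W`. The fixed
  -- ratio 2 between the radii is what Lebesgue differentiation requires below.
  let ρ : ℕ → ContDiffBump (0 : Euc n) := fun j =>
    ⟨δ / (j + 1) / 2, δ / (j + 1), by positivity, half_lt_self (by positivity)⟩
  have hρle : ∀ j, (ρ j).rOut ≤ δ := fun j => div_le_self hδ.le (by linarith [j.cast_nonneg (α := ℝ)])
  have hρ0 : Tendsto (fun j => (ρ j).rOut) atTop (𝓝 0) := by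
    have := (tendsto_one_div_add_atTop_nhds_zero_nat (𝕜 := ℝ)).const_mul δ
    rw [mul_zero] at this
    refine this.congr fun j => ?_
    change δ * (1 / ((j : ℝ) + 1)) = δ / (j + 1)
    ring
  let G : ℕ → Euc n → ℝ := fun j y => ∫ t, (ρ j).normed volume t • F (y - t)
  have hGeq : ∀ j, G j = convolution ((ρ j).normed volume) F (ContinuousLinearMap.lsmul ℝ ℝ)
    volume := fun j => rfl
  have hsm : ∀ j, ContDiff ℝ ∞ (G j) := fun j => by
    rw [hGeq]
    exact (ρ j).hasCompactSupport_normed.contDiff_convolution_left _ (ρ j).contDiff_normed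
      hF.continuous.locallyIntegrable
  have hT : ∀ j, ∀ y ∉ Metric.cthickening δ S, G j y = 0 := fun j y hy => by
    refine integral_eq_zero_of_ae (Eventually.of_forall fun t => ?_)
    by_cases ht : t ∈ Metric.ball (0 : Euc n) (ρ j).rOut
    · have : y - t ∉ S := fun h => hy (Metric.mem_cthickening_of_dist_le _ (y - t) _ _ h (by
        rw [dist_eq_norm, sub_sub_cancel]
        exact (mem_ball_zero_iff.1 ht).le.trans (hρle j)))
      simp [hFS _ this]
    · rw [← (ρ j).support_normed_eq (μ := volume), Function.notMem_support] at ht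
      simp [ht]
  have hLip : ∀ j, LipschitzWith L (G j) := fun j => lipschitzWith_normed_convolution _ hF
  set D : Euc n → (Euc n →L[ℝ] ℝ) := fderiv ℝ F
  have hfd : ∀ j y, fderiv ℝ (G j) y = ∫ t, (ρ j).normed volume t • D (y - t) := fun j y =>
    (hasFDerivAt_normed_convolution (ρ j) hF y).fderiv
  have hDL : ∀ y, ‖D y‖ ≤ L := fun y => norm_fderiv_le_of_lipschitz ℝ hF
  have hGL : ∀ j y, ‖fderiv ℝ (G j) y‖ ≤ L := fun j y => norm_fderiv_le_of_lipschitz ℝ (hLip j)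
  have hDm : Measurable D := measurable_fderiv ℝ F
  have hDloc : LocallyIntegrable D volume := by
    refine (locallyIntegrable_const (L : ℝ)).mono hDm.aestronglyMeasurable
      (Eventually.of_forall fun y => ?_)
    simpa using hDL y
  have hTc : IsCompact (Metric.cthickening δ S) := hS.cthickening
  have hzero : ∀ {H : Euc n → ℝ}, (∀ y ∉ Metric.cthickening δ S, H y = 0) →
      ∀ y ∉ Metric.cthickening δ S, fderiv ℝ H y = 0 := by
    intro H hH y hy
    have : H =ᶠ[𝓝 y] fun _ => 0 := by
      filter_upwards [Metric.isClosed_cthickening.isOpen_compl.mem_nhds hy] with z hz using hH z hz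
    rw [this.fderiv_eq, fderiv_fun_const]
    rfl
  have hDz : ∀ y ∉ Metric.cthickening δ S, D y = 0 := hzero fun y hy =>
    hFS y fun h => hy (Metric.self_subset_cthickening S h)
  -- Almost everywhere convergence at Lebesgue points of `D`. Together with the bound `2 L` on a
  -- compact set, it gives convergence in `L²`; uniform convergence of gradients cannot be expected.
  have hae : ∀ᵐ y : Euc n, Tendsto (fun j => fderiv ℝ (G j) y) atTop (𝓝 (D y)) := by
    have := ContDiffBump.ae_convolution_tendsto_right_of_locallyIntegrable (φ := ρ) (l := atTop)
      (K := 2) (μ := (volume : Measure (Euc n))) (g := D) hρ0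
      (Eventually.of_forall fun j => by
        change δ / (j + 1) ≤ 2 * (δ / (j + 1) / 2)
        linarith) hDloc
    filter_upwards [this] with y hy
    refine hy.congr fun j => ?_
    rw [hfd]
    rfl
  have hconv : Tendsto (fun j => eLpNorm (fun y => fderiv ℝ (G j) y - D y) 2 volume)
      atTop (𝓝 0) := by
    have h1 : Tendsto (fun j => ∫⁻ y, ‖fderiv ℝ (G j) y - D y‖ₑ ^ (2 : ℝ)) atTop
        (𝓝 (∫⁻ _ : Euc n, 0)) := by
      refine tendsto_lintegral_of_dominated_convergence
        ((Metric.cthickening δ S).indicator fun _ => (2 * L : ℝ≥0∞) ^ (2 : ℝ)) (fun j => ?_)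
        (fun j => Eventually.of_forall fun y => ?_) ?_ ?_
      · exact (((measurable_fderiv ℝ (G j)).sub hDm).enorm).pow_const _
      · by_cases hy : y ∈ Metric.cthickening δ S
        · rw [indicator_of_mem hy]
          dsimp only
          gcongr
          refine (enorm_sub_le).trans ?_
          rw [two_mul]
          refine add_le_add ?_ ?_
          · have h : ‖fderiv ℝ (G j) y‖₊ ≤ L := hGL j y
            exact ENNReal.coe_le_coe.2 h
          · have h : ‖D y‖₊ ≤ L := hDL y
            exact ENNReal.coe_le_coe.2 h
        · rw [indicator_of_notMem hy]
          dsimp only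
          rw [hzero (hT j) y hy, hDz y hy, sub_zero, ← ofReal_norm, norm_zero]
          simp
      · rw [lintegral_indicator_const hTc.isClosed.measurableSet]
        exact ENNReal.mul_ne_top (by finiteness) hTc.measure_lt_top.ne
      · filter_upwards [hae] with y hy
        have h2 : Tendsto (fun j => ‖fderiv ℝ (G j) y - D y‖ₑ) atTop (𝓝 0) := by
          have h3 := (hy.sub_const (D y)).enorm
          rwa [sub_self, ← ofReal_norm (0 : Euc n →L[ℝ] ℝ), norm_zero, ENNReal.ofReal_zero] at h3
        have h4 := (ENNReal.continuous_rpow_const (y := 2)).tendsto 0 |>.comp h2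
        rw [ENNReal.zero_rpow_of_pos (by norm_num)] at h4
        exact h4
    rw [lintegral_zero] at h1
    have h5 := (ENNReal.continuous_rpow_const (y := 1 / 2)).tendsto 0 |>.comp h1
    rw [ENNReal.zero_rpow_of_pos (by norm_num)] at h5
    refine h5.congr fun j => ?_
    rw [eLpNorm_eq_lintegral_rpow_enorm_toReal (by norm_num) (by norm_num)]
    simp
  refine ⟨G, hsm, ⟨_, hTc, hδW, hT⟩, hGL, ⟨fun j => L * (ρ j).rOut, ?_, fun j y => ?_⟩, ?_⟩
  · simpa using hρ0.const_mul (L : ℝ)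
  · rw [hGeq, ← Real.dist_eq]
    refine (ρ j).dist_normed_convolution_le hF.continuous.aestronglyMeasurable fun z hz => ?_
    refine (hF.dist_le_mul z y).trans ?_
    exact mul_le_mul_of_nonneg_left (Metric.mem_ball.1 hz).le L.coe_nonneg
  · have h1 : Tendsto (fun q : ℕ × ℕ => eLpNorm (fun y => fderiv ℝ (G q.1) y - D y) 2 volume +
        eLpNorm (fun y => fderiv ℝ (G q.2) y - D y) 2 volume) atTop (𝓝 0) := by
      rw [← prod_atTop_atTop_eq]
      simpa using (hconv.comp tendsto_fst).add (hconv.comp tendsto_snd)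
    refine tendsto_of_tendsto_of_tendsto_of_le_of_le tendsto_const_nhds h1 (fun _ => zero_le)
      fun q => ?_
    have h2 := eLpNorm_sub_le (μ := volume) (p := 2)
      (f := fun y => fderiv ℝ (G q.1) y - D y) (g := fun y => fderiv ℝ (G q.2) y - D y)
      ((measurable_fderiv ℝ (G q.1)).sub hDm).aestronglyMeasurable
      ((measurable_fderiv ℝ (G q.2)).sub hDm).aestronglyMeasurable (by norm_num)
    refine le_trans (le_of_eq ?_) h2
    congr 1
    ext1 y
    simp

end Mollification
end BubbleFamilies
end

open Set Filter Topology MeasureTheory Bundle Manifold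
open scoped ENNReal NNReal ContDiff

noncomputable section

set_option linter.unusedSectionVars false

namespace BubbleFamilies

/-! ### Products with compactly supported functions -/

section Cutoff

attribute [local instance 2000] chartedSpaceSelf

variable {n : ℕ} {M : Type*} [MetricSpace M] [ChartedSpace (Euc n) M]
  [IsManifold 𝓘(ℝ, Euc n) ∞ M]
  [RiemannianBundle (fun p : M => TangentSpace 𝓘(ℝ, Euc n) p)]
  [IsContMDiffRiemannianBundle 𝓘(ℝ, Euc n) ∞ (Euc n)
      (fun p : M => TangentSpace 𝓘(ℝ, Euc n) p)]
  [MeasurableSpace M] [BorelSpace M]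

variable (n) in
/-- `‖h‖₂ + ‖∇h‖₂` on the set `K`. -/
def localH1Norm (K : Set M) (h : M → ℝ) : ℝ≥0∞ :=
  eLpNorm h 2 ((vol n).restrict K) + eLpNorm (gradNorm (n := n) h) 2 ((vol n).restrict K)

theorem gradNorm_eq_zero_of_notMem {T : Set M} (hT : IsClosed T) {F : M → ℝ}
    (hF : ∀ q ∉ T, F q = 0) {q : M} (hq : q ∉ T) : gradNorm (n := n) F q = 0 := by
  rw [gradNorm_congr (v := 0), gradNorm_zero]
  filter_upwards [hT.isOpen_compl.mem_nhds hq] with z hz using hF z hz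

/-- Common part of the two product estimates below: a function controlled pointwise on `K`, with its
gradient, by the first-order jet of `a`. The factor 2 adds the contributions of the function and of
its gradient. -/
theorem smoothH1Norm_le_localH1Norm {K T U : Set M} (hK : MeasurableSet K) (hU : IsOpen U)
    (hKU : K ⊆ U) (hT : IsClosed T) (hTK : T ⊆ K) {F a : M → ℝ} {c : ℝ≥0}
    (ha : ContMDiffOn 𝓘(ℝ, Euc n) 𝓘(ℝ, ℝ) ∞ a U) (hF0 : ∀ q ∉ T, F q = 0)
    (hF : ∀ q ∈ K, |F q| ≤ c * |a q|)
    (hF' : ∀ q ∈ K, gradNorm (n := n) F q ≤ c * |a q| + c * gradNorm (n := n) a q) :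
    smoothH1Norm n F ≤ 2 * c * localH1Norm n K a := by
  have hm := (ha.continuousOn.mono hKU).aestronglyMeasurable (μ := vol n) hK
  have hm' := aestronglyMeasurable_gradNorm (n := n) hU ha hK hKU (vol n)
  have e1 : eLpNorm F 2 (vol n) = eLpNorm F 2 ((vol n).restrict K) :=
    (eLpNorm_restrict_eq_of_support_subset fun q hq => by
      by_contra h
      exact hq (hF0 q fun hT' => h (hTK hT'))).symm
  have e2 : eLpNorm (gradNorm (n := n) F) 2 (vol n) =
      eLpNorm (gradNorm (n := n) F) 2 ((vol n).restrict K) :=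
    (eLpNorm_restrict_eq_of_support_subset fun q hq => by
      by_contra h
      exact hq (gradNorm_eq_zero_of_notMem hT hF0 fun hT' => h (hTK hT'))).symm
  have hc : ‖(c : ℝ)‖ₑ = c := by simp
  have h1 : eLpNorm F 2 ((vol n).restrict K) ≤ c * eLpNorm a 2 ((vol n).restrict K) := by
    rw [← hc]
    refine le_trans (eLpNorm_mono_ae ?_) (eLpNorm_const_smul_le (c := (c : ℝ)))
    filter_upwards [ae_restrict_mem hK] with q hq
    simpa [abs_mul] using hF q hq
  have h2 : eLpNorm (gradNorm (n := n) F) 2 ((vol n).restrict K) ≤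
      c * localH1Norm n K a := by
    have h3 : eLpNorm (gradNorm (n := n) F) 2 ((vol n).restrict K) ≤
        eLpNorm ((c : ℝ) • ((fun q => |a q|) + gradNorm (n := n) a)) 2 ((vol n).restrict K) := by
      refine eLpNorm_mono_ae_real ?_
      filter_upwards [ae_restrict_mem hK] with q hq
      rw [Real.norm_of_nonneg (gradNorm_nonneg _ _)]
      simpa [mul_add] using hF' q hq
    refine h3.trans (eLpNorm_const_smul_le.trans ?_)
    rw [hc]
    gcongr
    refine (eLpNorm_add_le hm.norm hm' (by norm_num)).trans_eq ?_
    unfold localH1Norm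
    congr 1
    exact eLpNorm_norm a
  unfold smoothH1Norm
  rw [e1, e2]
  calc _ ≤ c * localH1Norm n K a + c * localH1Norm n K a := by
        refine add_le_add (h1.trans ?_) h2
        gcongr
        exact le_self_add
    _ = _ := by ring

theorem contMDiff_mul_of_support {T U : Set M} (hU : IsOpen U) (hT : IsClosed T) (hTU : T ⊆ U)
    {g h : M → ℝ} (hg : ContMDiff 𝓘(ℝ, Euc n) 𝓘(ℝ, ℝ) ∞ g) (hg0 : ∀ q ∉ T, g q = 0)
    (hh : ContMDiffOn 𝓘(ℝ, Euc n) 𝓘(ℝ, ℝ) ∞ h U) :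
    ContMDiff 𝓘(ℝ, Euc n) 𝓘(ℝ, ℝ) ∞ (g * h) := by
  intro q
  by_cases hq : q ∈ T
  · exact (hg q).mul (hh.contMDiffAt (hU.mem_nhds (hTU hq)))
  · have : (g * h) =ᶠ[𝓝 q] fun _ => (0 : ℝ) := by
      filter_upwards [hT.isOpen_compl.mem_nhds hq] with z hz
      simp [hg0 z hz]
    exact contMDiffAt_const.congr_of_eventuallyEq this

theorem smoothH1Norm_mul_le_left {K T U : Set M} (hK : MeasurableSet K) (hU : IsOpen U)
    (hKU : K ⊆ U) (hT : IsClosed T) (hTK : T ⊆ K) {g h : M → ℝ} {A : ℝ≥0}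
    (hg : ContMDiff 𝓘(ℝ, Euc n) 𝓘(ℝ, ℝ) ∞ g) (hg0 : ∀ q ∉ T, g q = 0)
    (hgA : ∀ q, |g q| ≤ A) (hgA' : ∀ q, gradNorm (n := n) g q ≤ A)
    (hh : ContMDiffOn 𝓘(ℝ, Euc n) 𝓘(ℝ, ℝ) ∞ h U) :
    smoothH1Norm n (g * h) ≤ 2 * A * localH1Norm n K h := by
  refine smoothH1Norm_le_localH1Norm hK hU hKU hT hTK hh (fun q hq => by simp [hg0 q hq])
    (fun q _ => ?_) fun q hq => ?_
  · rw [Pi.mul_apply, abs_mul]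
    gcongr
    exact hgA q
  · refine (gradNorm_mul_le (hg.mdifferentiable (by simp) q)
      ((hh.contMDiffAt (hU.mem_nhds (hKU hq))).mdifferentiableAt (by simp))).trans ?_
    rw [add_comm, mul_comm |h q|]
    have := gradNorm_nonneg (n := n) h q
    gcongr
    · exact hgA' q
    · exact hgA q

/-- Here the bounds are on `h` and the smallness is in `g`, the opposite of the previous lemma. Both
are needed, since neither factor of the products below converges in `C¹`. -/
theorem smoothH1Norm_mul_le_right {K T U : Set M} (hK : MeasurableSet K) (hU : IsOpen U)
    (hKU : K ⊆ U) (hT : IsClosed T) (hTK : T ⊆ K) {g h : M → ℝ} {B : ℝ≥0}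
    (hg : ContMDiff 𝓘(ℝ, Euc n) 𝓘(ℝ, ℝ) ∞ g) (hg0 : ∀ q ∉ T, g q = 0)
    (hhB : ∀ q ∈ K, |h q| ≤ B) (hhB' : ∀ q ∈ K, gradNorm (n := n) h q ≤ B)
    (hh : ContMDiffOn 𝓘(ℝ, Euc n) 𝓘(ℝ, ℝ) ∞ h U) :
    smoothH1Norm n (g * h) ≤ 2 * B * localH1Norm n K g := by
  refine smoothH1Norm_le_localH1Norm hK hU hKU hT hTK hg.contMDiffOn
    (fun q hq => by simp [hg0 q hq]) (fun q hq => ?_) fun q hq => ?_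
  · rw [Pi.mul_apply, abs_mul, mul_comm]
    gcongr
    exact hhB q hq
  · refine (gradNorm_mul_le (hg.mdifferentiable (by simp) q)
      ((hh.contMDiffAt (hU.mem_nhds (hKU hq))).mdifferentiableAt (by simp))).trans ?_
    rw [mul_comm |g q|]
    have := gradNorm_nonneg (n := n) g q
    gcongr
    · exact hhB' q hq
    · exact hhB q hq

/-- Functions smooth near a compact set, and their gradients, are bounded there. -/
theorem ChartBounds.exists_bound {K U : Set M} (hK : IsCompact K) {C : ℝ≥0}
    {φ : OpenPartialHomeomorph M (Euc n)} (hφ : ChartBounds K C φ) (hU : IsOpen U) (hKU : K ⊆ U)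
    {h : M → ℝ} (hh : ContMDiffOn 𝓘(ℝ, Euc n) 𝓘(ℝ, ℝ) ∞ h U) :
    ∃ B : ℝ≥0, (∀ q ∈ K, |h q| ≤ B) ∧ ∀ q ∈ K, gradNorm (n := n) h q ≤ B := by
  have hopen : IsOpen (φ.target ∩ φ.symm ⁻¹' U) := φ.symm.isOpen_inter_preimage hU
  have hsub : φ '' K ⊆ φ.target ∩ φ.symm ⁻¹' U := by
    rintro _ ⟨q, hq, rfl⟩
    exact ⟨φ.map_source (hφ.sub hq), by rw [mem_preimage, φ.left_inv (hφ.sub hq)]; exact hKU hq⟩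
  have hK' : IsCompact (φ '' K) := hK.image_of_continuousOn (φ.continuousOn.mono hφ.sub)
  obtain ⟨B₁, hB₁⟩ := hK.exists_bound_of_continuousOn (hh.continuousOn.mono hKU)
  obtain ⟨B₂, hB₂⟩ := hK'.exists_bound_of_continuousOn
    (((contDiffOn_comp_chart_symm hφ.mem hh).continuousOn_fderiv_of_isOpen hopen
      (by simp)).mono hsub)
  refine ⟨max B₁.toNNReal (B₂.toNNReal * C), fun q hq => ?_, fun q hq => ?_⟩
  · refine (hB₁ q hq).trans ((Real.le_coe_toNNReal B₁).trans ?_)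
    exact_mod_cast le_max_left _ _
  · have h1 := gradNorm_le_of_forall (n := n) hφ.mem (u := h) (y := φ q) (c := B₂.toNNReal * C)
      (φ.map_source (hφ.sub hq)) (by
        rw [φ.left_inv (hφ.sub hq)]
        exact (hh.contMDiffAt (hU.mem_nhds (hKU hq))).mdifferentiableAt (by simp))
      (by positivity) fun e => by
        refine ((fderiv ℝ (h ∘ φ.symm) (φ q)).le_opNorm e).trans ?_
        rw [mul_assoc]
        exact mul_le_mul ((hB₂ _ (mem_image_of_mem _ hq)).trans (Real.le_coe_toNNReal B₂))
          (hφ.norm_le q hq e) (norm_nonneg _) (by positivity)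
    rw [φ.left_inv (hφ.sub hq)] at h1
    refine h1.trans ?_
    exact_mod_cast le_max_right _ _

variable (n) in
/-- `f` is the limit, uniformly and in `H¹`, of smooth functions `g_j` supported in a common compact
subset of the interior of `K` and bounded by `A` together with their gradients. -/
structure CutoffApprox (K : Set M) (A : ℝ≥0) (f : M → ℝ) (g : ℕ → M → ℝ) : Prop where
  continuous : Continuous f
  smooth : ∀ j, ContMDiff 𝓘(ℝ, Euc n) 𝓘(ℝ, ℝ) ∞ (g j)
  support : ∃ T, IsCompact T ∧ T ⊆ interior K ∧ ∀ j, ∀ q ∉ T, g j q = 0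
  le : ∀ j q, |g j q| ≤ A
  grad_le : ∀ j q, gradNorm (n := n) (g j) q ≤ A
  tendsto : ∃ a : ℕ → ℝ, Tendsto a atTop (𝓝 0) ∧ ∀ j q, |g j q - f q| ≤ a j
  cauchy : Tendsto (fun q : ℕ × ℕ => eLpNorm (gradNorm (n := n) (g q.1 - g q.2)) 2 (vol n))
    atTop (𝓝 0)

end Cutoff
end BubbleFamilies
end

open Set Filter Topology MeasureTheory Bundle Manifold
open scoped ENNReal NNReal ContDiff

noncomputable section

set_option linter.unusedSectionVars false

namespace BubbleFamilies

/-! ### Approximation in `H¹` of products with Lipschitz cutoffs -/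

section CutoffProduct

attribute [local instance 2000] chartedSpaceSelf

variable {n : ℕ} {M : Type*} [MetricSpace M] [ChartedSpace (Euc n) M]
  [IsManifold 𝓘(ℝ, Euc n) ∞ M]
  [RiemannianBundle (fun p : M => TangentSpace 𝓘(ℝ, Euc n) p)]
  [IsContMDiffRiemannianBundle 𝓘(ℝ, Euc n) ∞ (Euc n)
      (fun p : M => TangentSpace 𝓘(ℝ, Euc n) p)]
  [MeasurableSpace M] [BorelSpace M]

theorem ChartBounds.measure_lt_top {K : Set M} (hK : IsCompact K) {C : ℝ≥0}
    {φ : OpenPartialHomeomorph M (Euc n)} (hφ : ChartBounds K C φ) : vol n K < ⊤ := by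
  have h := hφ.lintegral_le fun _ => 1
  rw [setLIntegral_one, setLIntegral_one] at h
  exact h.trans_lt (ENNReal.mul_lt_top ENNReal.coe_lt_top
    (hK.image_of_continuousOn (φ.continuousOn.mono hφ.sub)).measure_lt_top)

theorem CutoffApprox.sub_bounds {K : Set M} {A : ℝ≥0} {f : M → ℝ} {g : ℕ → M → ℝ}
    (hg : CutoffApprox n K A f g) (k l : ℕ) (q : M) :
    |(g k - g l) q| ≤ (2 * A : ℝ≥0) ∧ gradNorm (n := n) (g k - g l) q ≤ (2 * A : ℝ≥0) := by
  constructor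
  · refine (abs_sub _ _).trans ?_
    push_cast
    linarith [hg.le k q, hg.le l q]
  · have h1 : g k - g l = g k + -g l := sub_eq_add_neg _ _
    rw [h1]
    refine (gradNorm_add_le ((hg.smooth k).mdifferentiable (by simp) q)
      ((hg.smooth l).neg.mdifferentiable (by simp) q)).trans ?_
    change _ + gradNorm (n := n) (-g l) q ≤ _
    rw [gradNorm_neg]
    push_cast
    linarith [hg.grad_le k q, hg.grad_le l q]

theorem CutoffApprox.tendsto_localH1Norm {K : Set M} {A : ℝ≥0} {f : M → ℝ} {g : ℕ → M → ℝ}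
    (hg : CutoffApprox n K A f g) (hK : vol n K < ⊤) :
    Tendsto (fun q : ℕ × ℕ => localH1Norm n K (g q.1 - g q.2)) atTop (𝓝 0) := by
  obtain ⟨a, ha, hga⟩ := hg.tendsto
  have h1 : Tendsto (fun q : ℕ × ℕ => vol n K ^ (1 / 2 : ℝ) * ENNReal.ofReal (a q.1 + a q.2))
      atTop (𝓝 0) := by
    have h2 : Tendsto (fun q : ℕ × ℕ => a q.1 + a q.2) atTop (𝓝 0) := by
      rw [← prod_atTop_atTop_eq]
      simpa using (ha.comp tendsto_fst).add (ha.comp tendsto_snd)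
    have h3 := ENNReal.Tendsto.const_mul (a := vol n K ^ (1 / 2 : ℝ))
      (ENNReal.tendsto_ofReal h2) (Or.inr (by finiteness))
    simpa using h3
  refine tendsto_of_tendsto_of_tendsto_of_le_of_le tendsto_const_nhds
    (by simpa using h1.add hg.cauchy) (fun _ => zero_le) fun q => ?_
  refine add_le_add ?_ (eLpNorm_mono_measure _ Measure.restrict_le_self)
  refine (eLpNorm_le_of_ae_bound (C := a q.1 + a q.2) (Eventually.of_forall fun p => ?_)).trans ?_
  · have h4 := abs_sub_le (g q.1 p) (f p) (g q.2 p)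
    have h5 := hga q.1 p
    have h6 := hga q.2 p
    rw [abs_sub_comm] at h6
    exact h4.trans (add_le_add h5 h6)
  · rw [Measure.restrict_apply_univ]
    simp

variable [CompactSpace M]

/-- The gradients of `g k` are bounded but converge only in `L²`, so a bound on `(g k - g l) * u l`
is not immediate. It is split through a fixed `u m`: the part with `u l - u m` is small because `g k
- g l` is bounded in `C¹`, and the part with `u m` is small because `u m` is bounded in `C¹` on `K`
and `g k - g l` is small in `H¹`. -/
theorem CutoffApprox.isH1Approx_mul {K U : Set M} {A : ℝ≥0} {f : M → ℝ} {g : ℕ → M → ℝ}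
    (hg : CutoffApprox n K A f g) (hK : IsCompact K) {C : ℝ≥0}
    {φ : OpenPartialHomeomorph M (Euc n)} (hφ : ChartBounds K C φ) (hU : IsOpen U) (hKU : K ⊆ U)
    {h : M → ℝ} {u : ℕ → M → ℝ} (hu : ∀ k, ContMDiffOn 𝓘(ℝ, Euc n) 𝓘(ℝ, ℝ) ∞ (u k) U)
    (hm : AEStronglyMeasurable h ((vol n).restrict K))
    (hlim : Tendsto (fun k => eLpNorm (u k - h) 2 ((vol n).restrict K)) atTop (𝓝 0))
    (hcau : Tendsto (fun q : ℕ × ℕ => localH1Norm n K (u q.1 - u q.2)) atTop (𝓝 0)) :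
    IsH1Approx n (f * h) (fun k => g k * u k) := by
  obtain ⟨T, hT, hTK, hT0⟩ := hg.support
  obtain ⟨a, ha, hga⟩ := hg.tendsto
  have hKm : MeasurableSet K := hK.isClosed.measurableSet
  have hTK' : T ⊆ K := hTK.trans interior_subset
  have hfin := hφ.measure_lt_top hK
  have hf0 : ∀ q ∉ T, f q = 0 := fun q hq => by
    have h1 : Tendsto (fun j => |g j q - f q|) atTop (𝓝 0) :=
      squeeze_zero (fun _ => abs_nonneg _) (fun j => hga j q) ha
    simp only [hT0 _ q hq, zero_sub, abs_neg] at h1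
    exact abs_eq_zero.1 (tendsto_nhds_unique tendsto_const_nhds h1)
  have humem : ∀ k, eLpNorm (u k) 2 ((vol n).restrict K) < ⊤ := fun k => by
    obtain ⟨B, hB, -⟩ := hφ.exists_bound hK hU hKU (hu k)
    have : Fact (vol n K < ⊤) := ⟨hfin⟩
    refine (eLpNorm_le_of_ae_bound (C := B) ?_).trans_lt ?_
    · filter_upwards [ae_restrict_mem hKm] with q hq using hB q hq
    · rw [Measure.restrict_apply_univ]
      finiteness
  have hum : ∀ k, AEStronglyMeasurable (u k) ((vol n).restrict K) := fun k =>
    ((hu k).continuousOn.mono hKU).aestronglyMeasurable hKm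
  refine ⟨?_, fun k => contMDiff_mul_of_support hU hT.isClosed (hTK'.trans hKU) (hg.smooth k)
    (hT0 k) (hu k), ?_, ?_⟩
  · have h1 : f * h = K.indicator (f * h) := by
      refine (indicator_eq_self.2 fun q hq => ?_).symm
      by_contra hqK
      exact hq (by simp [hf0 q fun hqT => hqK (hTK' hqT)])
    rw [h1, aestronglyMeasurable_indicator_iff hKm]
    exact hg.continuous.aestronglyMeasurable.mul hm
  · refine ENNReal.tendsto_nhds_zero.2 fun η hη => ?_
    have hη3 : 0 < η / 3 := ENNReal.div_pos hη.ne' (by norm_num)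
    -- `4 * A` covers both the factor `2 * A` coming from `g k` and the factor `2 * (2 * A)` coming
    -- from `g k - g l`.
    have e1 : Tendsto (fun q : ℕ × ℕ => (4 * A : ℝ≥0∞) * localH1Norm n K (u q.1 - u q.2)) atTop
        (𝓝 0) := by
      simpa using ENNReal.Tendsto.const_mul (a := (4 * A : ℝ≥0∞)) hcau (Or.inr (by finiteness))
    obtain ⟨q₀, hq₀⟩ := eventually_atTop.1 (ENNReal.tendsto_nhds_zero.1 e1 _ hη3)
    set m := max q₀.1 q₀.2
    obtain ⟨B, hB, hB'⟩ := hφ.exists_bound hK hU hKU (hu m)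
    have e2 : Tendsto (fun q : ℕ × ℕ => (2 * B : ℝ≥0∞) * localH1Norm n K (g q.1 - g q.2)) atTop
        (𝓝 0) := by
      simpa using ENNReal.Tendsto.const_mul (a := (2 * B : ℝ≥0∞)) (hg.tendsto_localH1Norm hfin)
        (Or.inr (by finiteness))
    filter_upwards [ENNReal.tendsto_nhds_zero.1 e2 _ hη3, eventually_ge_atTop (m, m)]
      with q hq hqm
    obtain ⟨k, l⟩ := q
    have hkl : q₀ ≤ (k, l) := ⟨(le_max_left _ _).trans hqm.1, (le_max_right _ _).trans hqm.2⟩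
    have hlm : q₀ ≤ (l, m) := ⟨(le_max_left _ _).trans hqm.2, le_max_right _ _⟩
    have hgs : ContMDiff 𝓘(ℝ, Euc n) 𝓘(ℝ, ℝ) ∞ (g k - g l) := (hg.smooth k).sub (hg.smooth l)
    have hg0 : ∀ q ∉ T, (g k - g l) q = 0 := fun q hq => by simp [hT0 _ q hq]
    have d1 : ContMDiffOn 𝓘(ℝ, Euc n) 𝓘(ℝ, ℝ) ∞ (u k - u l) U := (hu k).sub (hu l)
    have d2 : ContMDiffOn 𝓘(ℝ, Euc n) 𝓘(ℝ, ℝ) ∞ (u l - u m) U := (hu l).sub (hu m)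
    have t1 := smoothH1Norm_mul_le_left hKm hU hKU hT.isClosed hTK' (hg.smooth k) (hT0 k)
      (hg.le k) (hg.grad_le k) d1
    have t2 := smoothH1Norm_mul_le_left hKm hU hKU hT.isClosed hTK' hgs hg0
      (fun q => (hg.sub_bounds k l q).1) (fun q => (hg.sub_bounds k l q).2) d2
    have t3 := smoothH1Norm_mul_le_right hKm hU hKU hT.isClosed hTK' hgs hg0 hB hB' (hu m)
    have s1 := contMDiff_mul_of_support hU hT.isClosed (hTK'.trans hKU) (hg.smooth k) (hT0 k) d1
    have s2 := contMDiff_mul_of_support hU hT.isClosed (hTK'.trans hKU) hgs hg0 d2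
    have s3 := contMDiff_mul_of_support hU hT.isClosed (hTK'.trans hKU) hgs hg0 (hu m)
    have hsplit : g k * u k - g l * u l =
        g k * (u k - u l) + ((g k - g l) * (u l - u m) + (g k - g l) * u m) := by ring
    dsimp only
    rw [hsplit]
    refine (smoothH1Norm_add_le s1 (s2.add s3)).trans ?_
    refine (add_le_add le_rfl (smoothH1Norm_add_le s2 s3)).trans ?_
    have b1 : (2 * A : ℝ≥0∞) * localH1Norm n K (u k - u l) ≤ η / 3 :=
      le_trans (by gcongr; norm_num) (hq₀ _ hkl)
    have b2 : (2 * (2 * A : ℝ≥0) : ℝ≥0∞) * localH1Norm n K (u l - u m) ≤ η / 3 := by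
      refine le_trans (le_of_eq ?_) (hq₀ _ hlm)
      dsimp only
      push_cast
      ring
    calc _ ≤ η / 3 + (η / 3 + η / 3) :=
          add_le_add (t1.trans b1) (add_le_add (t2.trans b2) (t3.trans hq))
      _ = η := by rw [← add_assoc, ENNReal.add_thirds]
  · have hh : eLpNorm h 2 ((vol n).restrict K) < ⊤ := by
      obtain ⟨k, hk⟩ := (ENNReal.tendsto_nhds_zero.1 hlim 1 one_pos).exists
      have h1 := eLpNorm_sub_le (p := 2) (hum k) ((hum k).sub hm) (by norm_num)
      rw [sub_sub_cancel] at h1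
      exact h1.trans_lt (ENNReal.add_lt_top.2 ⟨humem k, hk.trans_lt ENNReal.one_lt_top⟩)
    have e1 : Tendsto (fun k => (A : ℝ≥0∞) * eLpNorm (u k - h) 2 ((vol n).restrict K) +
        ‖a k‖ₑ * eLpNorm h 2 ((vol n).restrict K)) atTop (𝓝 0) := by
      have e2 : Tendsto (fun k => ‖a k‖ₑ) atTop (𝓝 0) := by simpa using ha.enorm
      simpa using (ENNReal.Tendsto.const_mul (a := (A : ℝ≥0∞)) hlim (Or.inr (by finiteness))).add
        (ENNReal.Tendsto.mul_const e2 (Or.inr hh.ne))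
    refine tendsto_of_tendsto_of_tendsto_of_le_of_le tendsto_const_nhds e1 (fun _ => zero_le)
      fun k => ?_
    have h1 : eLpNorm (g k * u k - f * h) 2 (vol n) =
        eLpNorm (g k * u k - f * h) 2 ((vol n).restrict K) :=
      (eLpNorm_restrict_eq_of_support_subset fun q hq => by
        by_contra hqK
        have hqT : q ∉ T := fun hqT => hqK (hTK' hqT)
        exact hq (by simp [hT0 _ q hqT, hf0 q hqT])).symm
    have h2 : g k * u k - f * h = g k * (u k - h) + (g k - f) * h := by ring
    dsimp only
    rw [h1, h2]
    refine (eLpNorm_add_le ((hg.smooth k).continuous.aestronglyMeasurable.mul ((hum k).sub hm))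
      (((hg.smooth k).continuous.sub hg.continuous).aestronglyMeasurable.mul hm)
      (by norm_num)).trans (add_le_add ?_ ?_)
    · have hA : ‖(A : ℝ)‖ₑ = A := by simp
      rw [← hA]
      refine le_trans (eLpNorm_mono fun q => ?_) (eLpNorm_const_smul_le (c := (A : ℝ)))
      simp only [Pi.mul_apply, Pi.smul_apply, smul_eq_mul, norm_mul]
      gcongr
      simpa using hg.le k q
    · refine le_trans (eLpNorm_mono fun q => ?_) (eLpNorm_const_smul_le (c := a k))
      simp only [Pi.mul_apply, Pi.smul_apply, smul_eq_mul, norm_mul]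
      gcongr
      exact (hga k q).trans (le_abs_self _)

theorem CutoffApprox.h1Norm_mul_le {K U : Set M} {A : ℝ≥0} {f : M → ℝ} {g : ℕ → M → ℝ}
    (hg : CutoffApprox n K A f g) (hK : IsCompact K) {C : ℝ≥0}
    {φ : OpenPartialHomeomorph M (Euc n)} (hφ : ChartBounds K C φ) (hU : IsOpen U) (hKU : K ⊆ U)
    {h : M → ℝ} {u : ℕ → M → ℝ} (hu : ∀ k, ContMDiffOn 𝓘(ℝ, Euc n) 𝓘(ℝ, ℝ) ∞ (u k) U)
    (hm : AEStronglyMeasurable h ((vol n).restrict K))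
    (hlim : Tendsto (fun k => eLpNorm (u k - h) 2 ((vol n).restrict K)) atTop (𝓝 0))
    (hcau : Tendsto (fun q : ℕ × ℕ => localH1Norm n K (u q.1 - u q.2)) atTop (𝓝 0))
    {R : ℝ≥0∞} (hR : ∀ᶠ k in atTop, localH1Norm n K (u k) ≤ R) :
    h1Norm n (f * h) ≤ 2 * A * R := by
  obtain ⟨T, hT, hTK, hT0⟩ := hg.support
  refine (h1Norm_le (hg.isH1Approx_mul hK hφ hU hKU hu hm hlim hcau)).trans ?_
  refine limsup_le_of_le (h := ?_)
  filter_upwards [hR] with k hk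
  refine (smoothH1Norm_mul_le_left hK.isClosed.measurableSet hU hKU hT.isClosed
    (hTK.trans interior_subset) (hg.smooth k) (hT0 k) (hg.le k) (hg.grad_le k) (hu k)).trans ?_
  gcongr

theorem CutoffApprox.h1Norm_mul_le_of_contMDiffOn {K U : Set M} {A : ℝ≥0} {f : M → ℝ}
    {g : ℕ → M → ℝ} (hg : CutoffApprox n K A f g) (hK : IsCompact K) {C : ℝ≥0}
    {φ : OpenPartialHomeomorph M (Euc n)} (hφ : ChartBounds K C φ) (hU : IsOpen U) (hKU : K ⊆ U)
    {h : M → ℝ} (hh : ContMDiffOn 𝓘(ℝ, Euc n) 𝓘(ℝ, ℝ) ∞ h U) :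
    h1Norm n (f * h) ≤ 2 * A * localH1Norm n K h := by
  have h0 : localH1Norm n K (0 : M → ℝ) = 0 := by
    have h1 : gradNorm (n := n) (0 : M → ℝ) = 0 := funext gradNorm_zero
    simp [localH1Norm, h1]
  exact hg.h1Norm_mul_le hK hφ hU hKU (u := fun _ => h) (fun _ => hh)
    ((hh.continuousOn.mono hKU).aestronglyMeasurable hK.isClosed.measurableSet)
    (by simp) (by simp [h0]) (Eventually.of_forall fun _ => le_rfl)

end CutoffProduct
end BubbleFamilies
end

open Set Filter Topology MeasureTheory Bundle Manifold
open scoped ENNReal NNReal ContDiff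

noncomputable section

set_option linter.unusedSectionVars false

namespace BubbleFamilies

/-! ### Construction of the smooth approximations of cutoffs -/

section CutoffExistence

attribute [local instance 2000] chartedSpaceSelf

variable {n : ℕ} {M : Type*} [MetricSpace M] [ChartedSpace (Euc n) M]
  [IsManifold 𝓘(ℝ, Euc n) ∞ M]
  [RiemannianBundle (fun p : M => TangentSpace 𝓘(ℝ, Euc n) p)]
  [IsContMDiffRiemannianBundle 𝓘(ℝ, Euc n) ∞ (Euc n)
      (fun p : M => TangentSpace 𝓘(ℝ, Euc n) p)]
  [MeasurableSpace M] [BorelSpace M]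

/-- `L^p` norms of functions read in a chart. -/
theorem ChartBounds.eLpNorm_comp_le {K : Set M} {C : ℝ≥0} {φ : OpenPartialHomeomorph M (Euc n)}
    (hφ : ChartBounds K C φ) {E : Type*} [NormedAddCommGroup E] (F : Euc n → E) {p : ℝ≥0∞}
    (hp : p ≠ 0) (hp' : p ≠ ⊤) :
    eLpNorm (fun q => F (φ q)) p ((vol n).restrict K) ≤
      (C : ℝ≥0∞) ^ (1 / p.toReal) * eLpNorm F p (volume.restrict (φ '' K)) := by
  rw [eLpNorm_eq_lintegral_rpow_enorm_toReal hp hp', eLpNorm_eq_lintegral_rpow_enorm_toReal hp hp',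
    ← ENNReal.mul_rpow_of_nonneg _ _ (by positivity)]
  gcongr
  exact hφ.lintegral_le fun y => ‖F y‖ₑ ^ p.toReal

/-- The gradient of a function read in a chart. -/
theorem ChartBounds.gradNorm_comp_le {K : Set M} {C : ℝ≥0} {φ : OpenPartialHomeomorph M (Euc n)}
    (hφ : ChartBounds K C φ) {F : Euc n → ℝ} (hF : ContDiff ℝ ∞ F) {q : M} (hq : q ∈ K)
    {u : M → ℝ} (hu : u =ᶠ[𝓝 q] F ∘ φ) :
    gradNorm (n := n) u q ≤ C * ‖fderiv ℝ F (φ q)‖ := by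
  have hs := hφ.sub hq
  have hsm : ContMDiffAt 𝓘(ℝ, Euc n) 𝓘(ℝ, ℝ) ∞ (F ∘ φ) q :=
    hF.contMDiff.contMDiffAt.comp q
      (contMDiffOn_of_mem_maximalAtlas hφ.mem |>.contMDiffAt (φ.open_source.mem_nhds hs))
  have h1 := gradNorm_le_of_forall (n := n) hφ.mem (u := F ∘ φ) (y := φ q)
    (c := C * ‖fderiv ℝ F (φ q)‖) (φ.map_source hs)
    (by rw [φ.left_inv hs]; exact hsm.mdifferentiableAt (by simp)) (by positivity) fun e => by
      have h2 : (F ∘ φ) ∘ φ.symm =ᶠ[𝓝 (φ q)] F := by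
        filter_upwards [chart_comp_symm_eventuallyEq φ (φ.map_source hs)] with y hy
        exact congrArg F hy
      rw [h2.fderiv_eq]
      refine ((fderiv ℝ F (φ q)).le_opNorm e).trans ?_
      calc _ ≤ ‖fderiv ℝ F (φ q)‖ * (C * coordNorm φ (φ q) e) := by
            gcongr
            exact hφ.norm_le q hq e
        _ = _ := by ring
  rw [φ.left_inv hs] at h1
  rwa [gradNorm_congr hu]

variable [IsRiemannianManifold 𝓘(ℝ, Euc n) M]

/-- Read in the chart and extended by zero, `f` is a Lipschitz function supported in `φ '' S`; it is
mollified inside `φ '' interior K` and pulled back. The constant `c` depends only on the chart and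
on `K`, which makes the bounds uniform over cutoffs centered at different points. -/
theorem exists_cutoffApprox {φ : OpenPartialHomeomorph M (Euc n)} {K : Set M} (hK : IsCompact K)
    {C : ℝ≥0} (hφ : ChartBounds K C φ) : ∃ c : ℝ≥0, ∀ (L A : ℝ≥0) (f : M → ℝ) (S : Set M),
      LipschitzWith L f → (∀ q, |f q| ≤ A) → IsCompact S → S ⊆ interior K →
      (∀ q ∉ S, f q = 0) → ∃ g, CutoffApprox n K (A + 1 + c * L) f g := by
  have hK' : IsCompact (φ '' K) := hK.image_of_continuousOn (φ.continuousOn.mono hφ.sub)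
  have hKt : φ '' K ⊆ φ.target := by
    rintro _ ⟨q, hq, rfl⟩
    exact φ.map_source (hφ.sub hq)
  obtain ⟨D, hD⟩ := exists_lipschitzOnWith_chart_symm hφ.mem hK' hKt
  refine ⟨C * D, fun L A f S hfL hfA hS hSK hfS => ?_⟩
  classical
  set F : Euc n → ℝ := (φ '' K).indicator (f ∘ φ.symm)
  set W : Set (Euc n) := φ '' interior K
  have hWo : IsOpen W := φ.isOpen_image_of_subset_source isOpen_interior
    (interior_subset.trans hφ.sub)
  have hWK : W ⊆ φ '' K := image_mono interior_subset
  have hSs : S ⊆ φ.source := (hSK.trans interior_subset).trans hφ.sub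
  have hFK : ∀ q ∈ K, F (φ q) = f q := fun q hq => by
    simp only [F]
    rw [indicator_of_mem (mem_image_of_mem _ hq), Function.comp_apply, φ.left_inv (hφ.sub hq)]
  have hF0 : ∀ y ∉ φ '' S, F y = 0 := fun y hy => by
    by_cases hyK : y ∈ φ '' K
    · obtain ⟨q, hq, rfl⟩ := hyK
      rw [hFK q hq, hfS q fun h => hy (mem_image_of_mem _ h)]
    · exact indicator_of_notMem hyK _
  have hFlip : LipschitzWith (L * D) F := by
    refine lipschitzWith_of_lipschitzOnWith hWo (hK'.isClosed.closure_subset_iff.2 hWK) ?_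
      fun y hy => hF0 y fun h => hy (image_mono hSK h)
    have h1 : LipschitzOnWith (L * D) (f ∘ φ.symm) (φ '' K) :=
      (hfL.lipschitzOnWith (s := univ)).comp hD (mapsTo_univ _ _)
    intro y hy y' hy'
    simp only [F]
    rw [indicator_of_mem hy, indicator_of_mem hy']
    exact h1 hy hy'
  obtain ⟨G, hGs, ⟨T, hT, hTW, hGT⟩, hGL, ⟨a, ha, hGa⟩, hGc⟩ :=
    exists_smooth_approx_of_lipschitz hFlip
      (hS.image_of_continuousOn (φ.continuousOn.mono hSs)) hWo (image_mono hSK)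
      hF0
  -- Dropping the first `N` terms makes the uniform error at most 1, hence the bound `A + 1` on the
  -- values.
  obtain ⟨N, hN⟩ := eventually_atTop.1 (ha.eventually_le_const one_pos)
  set T' : Set M := φ.symm '' T
  have hT' : IsCompact T' := hT.image_of_continuousOn
    (φ.continuousOn_symm.mono ((hTW.trans hWK).trans hKt))
  have hT'K : T' ⊆ interior K := by
    rintro _ ⟨y, hy, rfl⟩
    obtain ⟨q, hq, rfl⟩ := hTW hy
    rwa [φ.left_inv (hφ.sub (interior_subset hq))]
  set g : ℕ → M → ℝ := fun j => φ.source.indicator (G (j + N) ∘ φ)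
  have hg0 : ∀ j, ∀ q ∉ T', g j q = 0 := fun j q hq => by
    by_cases hqs : q ∈ φ.source
    · simp only [g]
      rw [indicator_of_mem hqs, Function.comp_apply, hGT]
      exact fun h => hq ⟨φ q, h, φ.left_inv hqs⟩
    · exact indicator_of_notMem hqs _
  have hgloc : ∀ j, ∀ q ∈ K, g j =ᶠ[𝓝 q] G (j + N) ∘ φ := fun j q hq => by
    filter_upwards [φ.open_source.mem_nhds (hφ.sub hq)] with z hz using indicator_of_mem hz _
  have hT'K' : T' ⊆ K := hT'K.trans interior_subset
  have hcD : ((C * (L * D) : ℝ≥0) : ℝ) ≤ (A + 1 + C * D * L : ℝ≥0) := by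
    norm_cast
    rw [mul_comm L, mul_assoc]
    exact le_add_self
  refine ⟨g, hfL.continuous, fun j q => ?_, ⟨T', hT', hT'K, hg0⟩, fun j q => ?_, fun j q => ?_,
    ⟨fun j => a (j + N), (tendsto_add_atTop_iff_nat N).2 ha, fun j q => ?_⟩, ?_⟩
  · by_cases hq : q ∈ T'
    · have hqK := hT'K' hq
      refine ContMDiffAt.congr_of_eventuallyEq ?_ (hgloc j q hqK)
      exact (hGs (j + N)).contMDiff.contMDiffAt.comp q
        ((contMDiffOn_of_mem_maximalAtlas hφ.mem).contMDiffAt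
          (φ.open_source.mem_nhds (hφ.sub hqK)))
    · refine (contMDiffAt_const (c := (0 : ℝ))).congr_of_eventuallyEq ?_
      filter_upwards [hT'.isClosed.isOpen_compl.mem_nhds hq] with z hz using hg0 j z hz
  · by_cases hq : q ∈ T'
    · have hqK := hT'K' hq
      have h1 := hGa (j + N) (φ q)
      have h2 := hN (j + N) (Nat.le_add_left _ _)
      rw [hFK q hqK, ← Function.comp_apply (f := G (j + N)), ← (hgloc j q hqK).self_of_nhds] at h1
      have h3 := abs_sub_abs_le_abs_sub (g j q) (f q)
      push_cast
      have : (0 : ℝ) ≤ C * D * L := by positivity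
      linarith [hfA q]
    · rw [hg0 j q hq, abs_zero]
      positivity
  · by_cases hq : q ∈ T'
    · have hqK := hT'K' hq
      refine (hφ.gradNorm_comp_le (hGs (j + N)) hqK (hgloc j q hqK)).trans (le_trans ?_ hcD)
      rw [NNReal.coe_mul C]
      gcongr
      exact hGL _ _
    · rw [gradNorm_eq_zero_of_notMem hT'.isClosed (hg0 j) hq]
      positivity
  · by_cases hq : q ∈ K
    · have h1 := hGa (j + N) (φ q)
      rwa [hFK q hq, ← Function.comp_apply (f := G (j + N)),
        ← (hgloc j q hq).self_of_nhds] at h1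
    · rw [hg0 j q fun h => hq (hT'K' h), hfS q fun h => hq (interior_subset (hSK h)), sub_zero,
        abs_zero]
      exact (abs_nonneg _).trans (hGa (j + N) 0)
  · have hshift : Tendsto (fun q : ℕ × ℕ => (q.1 + N, q.2 + N)) atTop atTop := by
      rw [← prod_atTop_atTop_eq]
      exact (tendsto_add_atTop_nat N).prodMap (tendsto_add_atTop_nat N)
    have h1 := ENNReal.Tendsto.const_mul
      (a := (C : ℝ≥0∞) * (C : ℝ≥0∞) ^ (1 / (2 : ℝ≥0∞).toReal)) (hGc.comp hshift)
      (Or.inr (by finiteness))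
    rw [mul_zero] at h1
    refine tendsto_of_tendsto_of_tendsto_of_le_of_le tendsto_const_nhds h1 (fun _ => zero_le)
      fun q => ?_
    have hz : ∀ p ∉ T', (g q.1 - g q.2) p = 0 := fun p hp => by simp [hg0 _ p hp]
    have e2 : eLpNorm (gradNorm (n := n) (g q.1 - g q.2)) 2 (vol n) =
        eLpNorm (gradNorm (n := n) (g q.1 - g q.2)) 2 ((vol n).restrict K) :=
      (eLpNorm_restrict_eq_of_support_subset fun p hp => by
        by_contra h
        exact hp (gradNorm_eq_zero_of_notMem hT'.isClosed hz fun h' => h (hT'K' h'))).symm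
    have hC : ‖(C : ℝ)‖ₑ = C := by simp
    dsimp only [Function.comp_apply]
    rw [e2]
    calc _ ≤ eLpNorm ((C : ℝ) • fun p => ‖fderiv ℝ (G (q.1 + N)) (φ p) -
            fderiv ℝ (G (q.2 + N)) (φ p)‖) 2 ((vol n).restrict K) := by
          refine eLpNorm_mono_ae_real ?_
          filter_upwards [ae_restrict_mem hK.isClosed.measurableSet] with p hp
          rw [Real.norm_of_nonneg (gradNorm_nonneg _ _)]
          refine (hφ.gradNorm_comp_le ((hGs (q.1 + N)).sub (hGs (q.2 + N))) hp
            ((hgloc q.1 p hp).sub (hgloc q.2 p hp))).trans_eq ?_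
          rw [fderiv_fun_sub ((hGs _).differentiable (by simp) _)
            ((hGs _).differentiable (by simp) _)]
          rfl
      _ ≤ C * eLpNorm (fun p => fderiv ℝ (G (q.1 + N)) (φ p) - fderiv ℝ (G (q.2 + N)) (φ p)) 2
            ((vol n).restrict K) := by
          refine eLpNorm_const_smul_le.trans ?_
          rw [hC, eLpNorm_norm]
      _ ≤ _ := by
          rw [mul_assoc]
          gcongr
          refine (hφ.eLpNorm_comp_le (fun y => fderiv ℝ (G (q.1 + N)) y -
            fderiv ℝ (G (q.2 + N)) y) (by norm_num) (by norm_num)).trans ?_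
          gcongr
          exact Measure.restrict_le_self

end CutoffExistence
end BubbleFamilies
end

open Set Filter Topology MeasureTheory Bundle Manifold
open scoped ENNReal NNReal ContDiff

noncomputable section

set_option linter.unusedSectionVars false

namespace BubbleFamilies

/-! ### Rescaling of norms on Euclidean space -/

section Rescaling

variable {n : ℕ}

theorem eLpNorm_comp_rescale {E : Type*} [NormedAddCommGroup E] (v : Euc n → E) (b : Euc n) {m : ℝ}
    (hm : 0 < m) {p : ℝ≥0∞} (hp : p ≠ ⊤) :
    eLpNorm (fun y => v (m⁻¹ • (y - b))) p volume =
      ENNReal.ofReal (m ^ n) ^ (1 / p).toReal * eLpNorm v p volume := by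
  have hm' : m⁻¹ ≠ 0 := inv_ne_zero hm.ne'
  have h1 : eLpNorm (fun y => v (m⁻¹ • y)) p volume =
      ENNReal.ofReal (m ^ n) ^ (1 / p).toReal * eLpNorm v p volume := by
    have e := (Homeomorph.smulOfNeZero m⁻¹ hm' : Euc n ≃ₜ Euc n).measurableEmbedding
    have h2 := e.eLpNorm_map_measure (g := v) (p := p) (μ := volume)
    have h3 : Measure.map (Homeomorph.smulOfNeZero m⁻¹ hm' : Euc n ≃ₜ Euc n) volume =
        ENNReal.ofReal (m ^ n) • volume := by
      have := Measure.map_addHaar_smul (volume : Measure (Euc n)) hm'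
      rw [finrank_euclideanSpace_fin, inv_pow, inv_inv, abs_of_pos (pow_pos hm n)] at this
      exact this
    rw [h3, eLpNorm_smul_measure_of_ne_top hp, smul_eq_mul] at h2
    exact h2.symm
  rw [← h1]
  have h4 := (Homeomorph.subRight b : Euc n ≃ₜ Euc n).measurableEmbedding.eLpNorm_map_measure
    (g := fun y => v (m⁻¹ • y)) (p := p) (μ := volume)
  have h5 : Measure.map (Homeomorph.subRight b : Euc n ≃ₜ Euc n) volume = volume :=
    (measurePreserving_sub_right (volume : Measure (Euc n)) b).map_eq
  rw [h5] at h4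
  exact h4.symm

theorem quasiMeasurePreserving_rescale (b : Euc n) {m : ℝ} (hm : 0 < m) :
    Measure.QuasiMeasurePreserving (fun y : Euc n => m⁻¹ • (y - b)) volume volume :=
  (Measure.quasiMeasurePreserving_smul volume (inv_ne_zero hm.ne')).comp
    (measurePreserving_sub_right volume b).quasiMeasurePreserving

theorem norm_gradient_eq (u : Euc n → ℝ) (y : Euc n) : ‖gradient u y‖ = ‖fderiv ℝ u y‖ :=
  (InnerProductSpace.toDual ℝ (Euc n)).symm.norm_map _

theorem gradient_fun_sub {u v : Euc n → ℝ} {y : Euc n} (hu : DifferentiableAt ℝ u y)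
    (hv : DifferentiableAt ℝ v y) :
    gradient (fun z => u z - v z) y = gradient u y - gradient v y := by
  unfold gradient
  rw [fderiv_fun_sub hu hv, map_sub]

end Rescaling

/-! ### Scale-invariant bounds for bubbles -/

section Profile

attribute [local instance 2000] chartedSpaceSelf

variable {n : ℕ} {M : Type*} [MetricSpace M] [ChartedSpace (Euc n) M]
  [IsManifold 𝓘(ℝ, Euc n) ∞ M]
  [RiemannianBundle (fun p : M => TangentSpace 𝓘(ℝ, Euc n) p)]
  [IsContMDiffRiemannianBundle 𝓘(ℝ, Euc n) ∞ (Euc n)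
      (fun p : M => TangentSpace 𝓘(ℝ, Euc n) p)]
  [MeasurableSpace M] [BorelSpace M]

/-- The function `m^{-(n-2)/2} V((φ(·) - φ(p)) / m)`. -/
def rescaled (V : Euc n → ℝ) (φ : OpenPartialHomeomorph M (Euc n)) (p : M) (m : ℝ) (q : M) : ℝ :=
  m ^ (-(((n : ℝ) - 2) / 2)) * V (m⁻¹ • (φ q - φ p))

theorem bubbleProfile_eq (χ : ℝ → ℝ) (V : Euc n → ℝ) (φ : OpenPartialHomeomorph M (Euc n)) (p : M)
    (m : ℝ) : bubbleProfile χ V φ p m = (fun q => χ (dist q p)) * rescaled V φ p m :=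
  funext fun _ => mul_assoc _ _ _

theorem ChartBounds.aemeasurable {K : Set M} {C : ℝ≥0} {φ : OpenPartialHomeomorph M (Euc n)}
    (hφ : ChartBounds K C φ) (hK : MeasurableSet K) : AEMeasurable φ ((vol n).restrict K) :=
  (φ.continuousOn.mono hφ.sub).aemeasurable hK

theorem ChartBounds.map_absolutelyContinuous {K : Set M} {C : ℝ≥0}
    {φ : OpenPartialHomeomorph M (Euc n)} (hφ : ChartBounds K C φ) (hK : MeasurableSet K) :
    Measure.map φ ((vol n).restrict K) ≪ volume := by
  refine Measure.AbsolutelyContinuous.mk fun N hN h0 => ?_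
  have h1 := lintegral_map' (μ := (vol n).restrict K) (f := N.indicator fun _ => 1)
    (measurable_const.indicator hN).aemeasurable (hφ.aemeasurable hK)
  rw [lintegral_indicator_const hN, one_mul] at h1
  rw [h1]
  refine le_antisymm ((hφ.lintegral_le _).trans ?_) bot_le
  refine (mul_le_mul_right (lintegral_mono' Measure.restrict_le_self le_rfl) _).trans ?_
  rw [lintegral_indicator_const hN, h0, mul_zero, mul_zero]

theorem ChartBounds.rescaled_congr_ae {K : Set M} {C : ℝ≥0}
    {φ : OpenPartialHomeomorph M (Euc n)} (hφ : ChartBounds K C φ) (hK : MeasurableSet K)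
    {V V' : Euc n → ℝ} (h : V =ᵐ[volume] V') (p : M) {m : ℝ} (hm : 0 < m) :
    rescaled V φ p m =ᵐ[(vol n).restrict K] rescaled V' φ p m := by
  have h1 : ∀ᵐ y, V (m⁻¹ • (y - φ p)) = V' (m⁻¹ • (y - φ p)) :=
    (quasiMeasurePreserving_rescale (φ p) hm).ae h
  have h2 := ae_of_ae_map (hφ.aemeasurable hK) ((hφ.map_absolutelyContinuous hK).ae_le h1)
  filter_upwards [h2] with q hq
  simp only [rescaled, hq]

theorem ChartBounds.aestronglyMeasurable_rescaled {K : Set M} {C : ℝ≥0}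
    {φ : OpenPartialHomeomorph M (Euc n)} (hφ : ChartBounds K C φ) (hK : MeasurableSet K)
    {V : Euc n → ℝ} (h : AEStronglyMeasurable V volume) (p : M) {m : ℝ} (hm : 0 < m) :
    AEStronglyMeasurable (rescaled V φ p m) ((vol n).restrict K) := by
  have h1 : AEStronglyMeasurable (fun y => V (m⁻¹ • (y - φ p))) volume :=
    h.comp_quasiMeasurePreserving (quasiMeasurePreserving_rescale (φ p) hm)
  exact ((h1.mono_ac (hφ.map_absolutelyContinuous hK)).comp_aemeasurable
    (hφ.aemeasurable hK)).const_mul _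

theorem contMDiffOn_rescaled {φ : OpenPartialHomeomorph M (Euc n)}
    (hφ : φ ∈ IsManifold.maximalAtlas 𝓘(ℝ, Euc n) ∞ M) {u : Euc n → ℝ} (hu : ContDiff ℝ ∞ u)
    (p : M) (m : ℝ) :
    ContMDiffOn 𝓘(ℝ, Euc n) 𝓘(ℝ, ℝ) ∞ (rescaled u φ p m) φ.source := by
  have h1 : ContDiff ℝ ∞ fun y : Euc n =>
      m ^ (-(((n : ℝ) - 2) / 2)) * u (m⁻¹ • (y - φ p)) := by fun_prop
  exact h1.contMDiff.comp_contMDiffOn (contMDiffOn_of_mem_maximalAtlas hφ)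

/-- Differentiation costs a factor `m⁻¹`, and `-(n - 2) / 2 - 1 = -n / 2` is the exponent for which
the `L²` norm of the gradient is scale invariant. -/
theorem ChartBounds.gradNorm_rescaled_le {K : Set M} {C : ℝ≥0}
    {φ : OpenPartialHomeomorph M (Euc n)} (hφ : ChartBounds K C φ) {u : Euc n → ℝ}
    (hu : ContDiff ℝ ∞ u) (p : M) {m : ℝ} (hm : 0 < m) {q : M} (hq : q ∈ K) :
    gradNorm (n := n) (rescaled u φ p m) q ≤
      C * (m ^ (-((n : ℝ) / 2)) * ‖fderiv ℝ u (m⁻¹ • (φ q - φ p))‖) := by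
  set s : ℝ := m ^ (-(((n : ℝ) - 2) / 2))
  have hs : 0 < s := Real.rpow_pos_of_pos hm _
  have h1 : ContDiff ℝ ∞ fun y : Euc n => s * u (m⁻¹ • (y - φ p)) := by fun_prop
  refine (hφ.gradNorm_comp_le h1 hq (u := rescaled u φ p m) (Eventually.of_forall fun _ => rfl)).trans
    ?_
  gcongr
  have h2 : HasFDerivAt (fun y : Euc n => m⁻¹ • (y - φ p)) (m⁻¹ • ContinuousLinearMap.id ℝ (Euc n))
      (φ q) := ((hasFDerivAt_id (φ q)).sub_const (φ p)).fun_const_smul m⁻¹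
  have h3 := (((hu.differentiable (by simp) (m⁻¹ • (φ q - φ p))).hasFDerivAt.comp (φ q) h2).const_mul
    s).fderiv
  simp only [Function.comp_def] at h3
  rw [h3, norm_smul, ContinuousLinearMap.comp_smul, norm_smul, ContinuousLinearMap.comp_id,
    Real.norm_of_nonneg hs.le, Real.norm_of_nonneg (inv_nonneg.2 hm.le), ← mul_assoc]
  refine le_of_eq ?_
  congr 1
  rw [← Real.rpow_neg_one, ← Real.rpow_add hm]
  congr 1
  ring

theorem twoStar_pos (hn : 3 ≤ n) : 0 < twoStar n := by
  have : (3 : ℝ) ≤ n := by exact_mod_cast hn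
  unfold twoStar
  exact div_pos (by linarith) (by linarith)

theorem two_le_twoStar (hn : 3 ≤ n) : 2 ≤ twoStar n := by
  have : (3 : ℝ) ≤ n := by exact_mod_cast hn
  unfold twoStar
  rw [le_div_iff₀ (by linarith)]
  linarith

/-- The normalisation of the bubble exactly cancels the Jacobian of the dilation. It is used with `b
= 1 / 2⋆`, `a = (n - 2) / 2` for values and with `b = 1 / 2`, `a = n / 2` for gradients. -/
theorem ofReal_rpow_mul_ofReal_pow_rpow {m a b : ℝ} (hm : 0 < m) (h : (n : ℝ) * b = a) :
    ENNReal.ofReal (m ^ (-a)) * ENNReal.ofReal (m ^ n) ^ b = 1 := by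
  rw [ENNReal.ofReal_rpow_of_pos (pow_pos hm n), ← Real.rpow_natCast, ← Real.rpow_mul hm.le, h,
    ← ENNReal.ofReal_mul (Real.rpow_nonneg hm.le _), ← Real.rpow_add hm, neg_add_cancel,
    Real.rpow_zero, ENNReal.ofReal_one]

theorem ChartBounds.eLpNorm_comp_rescale_le {K : Set M} {C : ℝ≥0}
    {φ : OpenPartialHomeomorph M (Euc n)} (hφ : ChartBounds K C φ) {E : Type*}
    [NormedAddCommGroup E] (v : Euc n → E) (p : M) {m : ℝ} (hm : 0 < m) {a : ℝ} {q : ℝ≥0∞}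
    (hq : q ≠ 0) (hq' : q ≠ ⊤) (ha : (n : ℝ) * (1 / q).toReal = a) :
    ENNReal.ofReal (m ^ (-a)) *
      eLpNorm (fun z => v (m⁻¹ • (φ z - φ p))) q ((vol n).restrict K) ≤
        (C : ℝ≥0∞) ^ (1 / q.toReal) * eLpNorm v q volume := by
  calc _ ≤ ENNReal.ofReal (m ^ (-a)) * ((C : ℝ≥0∞) ^ (1 / q.toReal) *
        (ENNReal.ofReal (m ^ n) ^ (1 / q).toReal * eLpNorm v q volume)) := by
        rw [← eLpNorm_comp_rescale v (φ p) hm hq']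
        gcongr
        refine (hφ.eLpNorm_comp_le (fun y => v (m⁻¹ • (y - φ p))) hq hq').trans ?_
        gcongr
        exact Measure.restrict_le_self
    _ = (C : ℝ≥0∞) ^ (1 / q.toReal) * (ENNReal.ofReal (m ^ (-a)) *
        ENNReal.ofReal (m ^ n) ^ (1 / q).toReal) * eLpNorm v q volume := by ring
    _ = _ := by rw [ofReal_rpow_mul_ofReal_pow_rpow hm ha, mul_one]

/-- The rescaling is bounded, uniformly in the scale, from `L^{2⋆}` to `L²` on compact sets, and
from the gradient seminorm to itself. -/
theorem exists_eLpNorm_rescaled_le (hn : 3 ≤ n) {K : Set M} (hK : MeasurableSet K)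
    (hfin : vol n K < ⊤) (C : ℝ≥0) :
    ∃ D : ℝ≥0, ∀ (φ : OpenPartialHomeomorph M (Euc n)), ChartBounds K C φ → ∀ (p : M) (m : ℝ),
      0 < m → (∀ V : Euc n → ℝ, AEStronglyMeasurable V volume →
        eLpNorm (rescaled V φ p m) 2 ((vol n).restrict K) ≤
          D * eLpNorm V (ENNReal.ofReal (twoStar n)) volume) ∧
      ∀ u : Euc n → ℝ, ContDiff ℝ ∞ u →
        eLpNorm (gradNorm (n := n) (rescaled u φ p m)) 2 ((vol n).restrict K) ≤
          D * eLpNorm (fderiv ℝ u) 2 volume := by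
  have hq := twoStar_pos hn
  have h2q := two_le_twoStar hn
  have hn' : (3 : ℝ) ≤ n := by exact_mod_cast hn
  set q := ENNReal.ofReal (twoStar n) with hqdef
  have hq0 : q ≠ 0 := by simpa [hqdef] using hq
  have hqt : q ≠ ⊤ := ENNReal.ofReal_ne_top
  have hqr : q.toReal = twoStar n := ENNReal.toReal_ofReal hq.le
  have hexp : (n : ℝ) * (1 / q).toReal = ((n : ℝ) - 2) / 2 := by
    rw [ENNReal.toReal_div, hqr, ENNReal.toReal_one, twoStar]
    field_simp
  -- Hölder exponent in the passage from `L^{2⋆}`, where the rescaling is bounded, to `L²` on a set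
  -- of finite volume.
  set e : ℝ := 1 / (2 : ℝ≥0∞).toReal - 1 / q.toReal
  have he : 0 ≤ e := by
    simp only [e, hqr, ENNReal.toReal_ofNat]
    exact sub_nonneg.2 (one_div_le_one_div_of_le (by norm_num) h2q)
  set D₁ : ℝ≥0∞ := (C : ℝ≥0∞) ^ (1 / q.toReal) * vol n K ^ e
  set D₂ : ℝ≥0∞ := C * (C : ℝ≥0∞) ^ (1 / (2 : ℝ≥0∞).toReal)
  have hD₁ : D₁ ≠ ⊤ := by
    refine ENNReal.mul_ne_top (ENNReal.rpow_ne_top_of_nonneg (by positivity) (by finiteness))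
      (ENNReal.rpow_ne_top_of_nonneg he hfin.ne)
  have hD₂ : D₂ ≠ ⊤ := by finiteness
  refine ⟨D₁.toNNReal + D₂.toNNReal, fun φ hφ p m hm => ⟨fun V hV => ?_, fun u hu => ?_⟩⟩
  · have hs : 0 ≤ m ^ (-(((n : ℝ) - 2) / 2)) := Real.rpow_nonneg hm.le _
    have h1 : eLpNorm (rescaled V φ p m) q ((vol n).restrict K) ≤
        (C : ℝ≥0∞) ^ (1 / q.toReal) * eLpNorm V q volume := by
      refine le_trans ?_ (hφ.eLpNorm_comp_rescale_le V p hm hq0 hqt hexp)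
      rw [← Real.enorm_of_nonneg hs]
      exact eLpNorm_const_smul_le (c := m ^ (-(((n : ℝ) - 2) / 2)))
        (f := fun z => V (m⁻¹ • (φ z - φ p)))
    have h2 := eLpNorm_le_eLpNorm_mul_rpow_measure_univ (p := 2) (q := q)
      (by rw [hqdef, ← ENNReal.ofReal_ofNat]; exact ENNReal.ofReal_le_ofReal h2q)
      (hφ.aestronglyMeasurable_rescaled hK hV p hm)
    rw [Measure.restrict_apply_univ] at h2
    calc _ ≤ _ := h2
      _ ≤ (C : ℝ≥0∞) ^ (1 / q.toReal) * eLpNorm V q volume * vol n K ^ e := by gcongr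
      _ = D₁ * eLpNorm V q volume := by ring
      _ ≤ _ := by
        rw [← ENNReal.coe_toNNReal hD₁]
        gcongr
        exact_mod_cast le_self_add
  · have hs : 0 ≤ m ^ (-((n : ℝ) / 2)) := Real.rpow_nonneg hm.le _
    have hC : ‖(C : ℝ) * m ^ (-((n : ℝ) / 2))‖ₑ = C * ENNReal.ofReal (m ^ (-((n : ℝ) / 2))) := by
      rw [enorm_mul, Real.enorm_of_nonneg hs]
      simp
    have h2 := hφ.eLpNorm_comp_rescale_le (fderiv ℝ u) p hm (q := 2) (a := (n : ℝ) / 2)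
      (by norm_num) (by norm_num) (by simp; ring)
    calc _ ≤ eLpNorm (((C : ℝ) * m ^ (-((n : ℝ) / 2))) • fun z =>
          ‖fderiv ℝ u (m⁻¹ • (φ z - φ p))‖) 2 ((vol n).restrict K) := by
          refine eLpNorm_mono_ae_real ?_
          filter_upwards [ae_restrict_mem hK] with z hz
          rw [Real.norm_of_nonneg (gradNorm_nonneg _ _), Pi.smul_apply, smul_eq_mul, mul_assoc]
          exact hφ.gradNorm_rescaled_le hu p hm hz
      _ ≤ C * (ENNReal.ofReal (m ^ (-((n : ℝ) / 2))) *
          eLpNorm (fun z => fderiv ℝ u (m⁻¹ • (φ z - φ p))) 2 ((vol n).restrict K)) := by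
          refine eLpNorm_const_smul_le.trans_eq ?_
          rw [hC, mul_assoc, eLpNorm_norm]
      _ ≤ C * ((C : ℝ≥0∞) ^ (1 / (2 : ℝ≥0∞).toReal) * eLpNorm (fderiv ℝ u) 2 volume) := by gcongr
      _ = D₂ * eLpNorm (fderiv ℝ u) 2 volume := by ring
      _ ≤ _ := by
        rw [← ENNReal.coe_toNNReal hD₂]
        gcongr
        exact_mod_cast le_add_self

variable [IsRiemannianManifold 𝓘(ℝ, Euc n) M] [CompactSpace M]

/-- The cutoff functions `χ(d_g(·, p))` can be approximated with bounds uniform in `p`. -/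
theorem exists_cutoffApprox_dist {r : ℝ} {χ : ℝ → ℝ} (hχ : ContDiff ℝ ∞ χ)
    (hχ0 : ∀ t, r ≤ |t| → χ t = 0) {K : Set M} (hK : IsCompact K) {C : ℝ≥0}
    {φ : OpenPartialHomeomorph M (Euc n)} (hφ : ChartBounds K C φ) :
    ∃ A : ℝ≥0, ∀ p, Metric.closedBall p r ⊆ interior K →
      ∃ g, CutoffApprox n K A (fun q => χ (dist q p)) g := by
  have hsupp : HasCompactSupport χ := by
    refine HasCompactSupport.intro (isCompact_closedBall (0 : ℝ) r) fun t ht => hχ0 t ?_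
    rw [Metric.mem_closedBall, Real.dist_0_eq_abs, not_le] at ht
    exact ht.le
  obtain ⟨L, hL⟩ := hχ.lipschitzWith_of_hasCompactSupport hsupp (by simp)
  obtain ⟨A, hA⟩ := hχ.continuous.bounded_above_of_compact_support hsupp
  obtain ⟨c, hc⟩ := exists_cutoffApprox hK hφ
  refine ⟨A.toNNReal + 1 + c * L, fun p hp => hc L A.toNNReal _ _ ?_ (fun q => ?_)
    (isCompact_closedBall p r) hp fun q hq => hχ0 _ ?_⟩
  · have h := hL.comp (LipschitzWith.dist_left p)
    rw [mul_one] at h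
    exact h
  · exact (hA _).trans (Real.le_coe_toNNReal A)
  · rw [abs_of_nonneg dist_nonneg]
    exact (not_le.1 hq).le

/-- Bubbles are bounded in `H¹` by the norm of their model in `D^{1,2}`. -/
theorem exists_h1Norm_bubbleProfile_le (hn : 3 ≤ n) {r : ℝ} {χ : ℝ → ℝ} (hχ : ContDiff ℝ ∞ χ)
    (hχ0 : ∀ t, r ≤ |t| → χ t = 0) {K : Set M} (hK : IsCompact K) {C : ℝ≥0}
    {φ₀ : OpenPartialHomeomorph M (Euc n)} (hφ₀ : ChartBounds K C φ₀) :
    ∃ D : ℝ≥0, ∀ (φ : OpenPartialHomeomorph M (Euc n)), ChartBounds K C φ → ∀ (p : M) (m : ℝ),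
      0 < m → Metric.closedBall p r ⊆ interior K → ∀ (V : Euc n → ℝ) (G : Euc n → Euc n),
      HasD12Gradient V G → h1Norm n (bubbleProfile χ V φ p m) ≤
        D * (eLpNorm V (ENNReal.ofReal (twoStar n)) volume + eLpNorm G 2 volume) := by
  have hKm := hK.isClosed.measurableSet
  obtain ⟨A, hA⟩ := exists_cutoffApprox_dist hχ hχ0 hK hφ₀
  obtain ⟨D, hD⟩ := exists_eLpNorm_rescaled_le hn hKm (hφ₀.measure_lt_top hK) C
  set q := ENNReal.ofReal (twoStar n) with hqdef
  have hq1 : 1 ≤ q := by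
    rw [hqdef, ← ENNReal.ofReal_one]
    exact ENNReal.ofReal_le_ofReal (by linarith [two_le_twoStar hn])
  refine ⟨2 * A * D, fun φ hφ p m hm hp V G hV => ?_⟩
  obtain ⟨g, hg⟩ := hA p hp
  obtain ⟨hDV, hDu⟩ := hD φ hφ p m hm
  obtain ⟨u, hu, hlim, hlim'⟩ := hV.approx
  have hdiff : ∀ k, Differentiable ℝ (u k) := fun k => (hu k).1.differentiable (by simp)
  have hgm : ∀ k, AEStronglyMeasurable (gradient (u k)) volume := fun k =>
    ((InnerProductSpace.toDual ℝ (Euc n)).symm.continuous.comp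
      ((hu k).1.continuous_fderiv (by simp))).aestronglyMeasurable
  have hVm : AEStronglyMeasurable V volume := hV.memLp.1
  have hGm : AEStronglyMeasurable G volume := hV.memLp_grad.1
  have hum : ∀ k, AEStronglyMeasurable (u k) volume := fun k =>
    (hu k).1.continuous.aestronglyMeasurable
  have hsub : ∀ v w : Euc n → ℝ, rescaled v φ p m - rescaled w φ p m =
      rescaled (fun y => v y - w y) φ p m := fun v w => funext fun z => by
    simp only [rescaled, Pi.sub_apply]
    ring
  have hgrad : ∀ v : Euc n → ℝ, eLpNorm (fderiv ℝ v) 2 volume = eLpNorm (gradient v) 2 volume :=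
    fun v => eLpNorm_congr_norm_ae (Eventually.of_forall fun y => (norm_gradient_eq v y).symm)
  have hN : ∀ v : Euc n → ℝ, ContDiff ℝ ∞ v → localH1Norm n K (rescaled v φ p m) ≤
      D * (eLpNorm v q volume + eLpNorm (gradient v) 2 volume) := fun v hv => by
    rw [mul_add, ← hgrad]
    exact add_le_add (hDV v hv.continuous.aestronglyMeasurable) (hDu v hv)
  -- The approximations `u k` of the model, rescaled, are admissible approximations of the rescaled
  -- model; their norms are eventually within `δ` of that of `V`, and `δ` is then sent to zero.
  have hbound : ∀ δ : ℝ≥0∞, 0 < δ → h1Norm n (bubbleProfile χ V φ p m) ≤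
      2 * A * (D * (eLpNorm V q volume + eLpNorm G 2 volume + δ)) := fun δ hδ => by
    rw [bubbleProfile_eq]
    refine hg.h1Norm_mul_le hK hφ₀ φ.open_source hφ.sub (u := fun k => rescaled (u k) φ p m)
      (fun k => contMDiffOn_rescaled hφ.mem (hu k).1 p m)
      (hφ.aestronglyMeasurable_rescaled hKm hVm p hm) ?_ ?_ ?_
    · have h1 := ENNReal.Tendsto.const_mul (a := (D : ℝ≥0∞)) hlim (Or.inr (by finiteness))
      rw [mul_zero] at h1
      refine tendsto_of_tendsto_of_tendsto_of_le_of_le tendsto_const_nhds h1 (fun _ => zero_le)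
        fun k => ?_
      dsimp only
      rw [hsub]
      exact hDV _ ((hum k).sub hVm)
    · have h1 : Tendsto (fun z : ℕ × ℕ => (D : ℝ≥0∞) *
          ((eLpNorm (fun y => u z.1 y - V y) q volume +
            eLpNorm (fun y => u z.2 y - V y) q volume) +
          (eLpNorm (fun y => gradient (u z.1) y - G y) 2 volume +
            eLpNorm (fun y => gradient (u z.2) y - G y) 2 volume))) atTop (𝓝 0) := by
        rw [← prod_atTop_atTop_eq]
        have h2 := ((hlim.comp (tendsto_fst (g := atTop))).add (hlim.comp tendsto_snd)).add
          ((hlim'.comp (tendsto_fst (g := atTop))).add (hlim'.comp tendsto_snd))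
        simpa using ENNReal.Tendsto.const_mul (a := (D : ℝ≥0∞)) h2 (Or.inr (by finiteness))
      refine tendsto_of_tendsto_of_tendsto_of_le_of_le tendsto_const_nhds h1 (fun _ => zero_le)
        fun z => ?_
      dsimp only
      rw [hsub]
      refine (hN _ ((hu z.1).1.sub (hu z.2).1)).trans ?_
      gcongr
      · refine le_trans (le_of_eq ?_)
          (eLpNorm_sub_le ((hum z.1).sub hVm) ((hum z.2).sub hVm) hq1)
        congr 1
        ext1 y
        simp
      · refine le_trans (le_of_eq ?_)
          (eLpNorm_sub_le ((hgm z.1).sub hGm) ((hgm z.2).sub hGm) (by norm_num))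
        congr 1
        ext1 y
        rw [gradient_fun_sub (hdiff _ y) (hdiff _ y)]
        simp
    · have h1 : Tendsto (fun k => eLpNorm (fun y => u k y - V y) q volume +
          eLpNorm (fun y => gradient (u k) y - G y) 2 volume) atTop (𝓝 0) := by
        simpa using hlim.add hlim'
      filter_upwards [ENNReal.tendsto_nhds_zero.1 h1 δ hδ] with k hk
      refine (hN _ (hu k).1).trans (mul_le_mul_right ?_ _)
      have e1 := eLpNorm_add_le (p := q) ((hum k).sub hVm) hVm hq1
      have e2 := eLpNorm_add_le (p := 2) ((hgm k).sub hGm) hGm (by norm_num)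
      rw [sub_add_cancel] at e1 e2
      calc _ ≤ _ := add_le_add e1 e2
        _ = (eLpNorm (u k - V) q volume + eLpNorm (gradient (u k) - G) 2 volume) +
            (eLpNorm V q volume + eLpNorm G 2 volume) := by abel
        _ ≤ δ + (eLpNorm V q volume + eLpNorm G 2 volume) := by
            gcongr
            exact hk
        _ = _ := add_comm _ _
  have hlast : Tendsto (fun δ : ℝ≥0∞ => 2 * A * (D * (eLpNorm V q volume + eLpNorm G 2 volume + δ)))
      (𝓝[>] 0) (𝓝 (2 * A * (D * (eLpNorm V q volume + eLpNorm G 2 volume + 0)))) := by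
    refine ENNReal.Tendsto.const_mul (ENNReal.Tendsto.const_mul ?_ (Or.inr (by finiteness)))
      (Or.inr (by finiteness))
    exact tendsto_const_nhds.add (tendsto_id.mono_left nhdsWithin_le_nhds)
  have h := ge_of_tendsto hlast (eventually_mem_nhdsWithin.mono fun δ hδ => hbound δ hδ)
  rw [add_zero, ← mul_assoc] at h
  simpa using h

end Profile
end BubbleFamilies
end

open Set Filter Topology MeasureTheory Bundle Manifold
open scoped ENNReal NNReal ContDiff

noncomputable section

set_option linter.unusedSectionVars false

namespace BubbleFamilies

/-! ### Smoothness of transition maps at a common point -/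

section Transition

variable {n : ℕ} {M : Type*} [MetricSpace M] [ChartedSpace (Euc n) M]
  [IsManifold 𝓘(ℝ, Euc n) ∞ M]

theorem contDiffAt_transition {φ φ' : OpenPartialHomeomorph M (Euc n)}
    (hφ : φ ∈ IsManifold.maximalAtlas 𝓘(ℝ, Euc n) ∞ M)
    (hφ' : φ' ∈ IsManifold.maximalAtlas 𝓘(ℝ, Euc n) ∞ M) {p : M}
    (hp : p ∈ φ.source) (hp' : p ∈ φ'.source) : ContDiffAt ℝ ∞ (φ ∘ φ'.symm) (φ' p) :=
  (contDiffOn_transition hφ hφ').contDiffAt ((isOpen_transition φ φ').mem_nhds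
    ⟨φ'.map_source hp', by rwa [mem_preimage, φ'.left_inv hp']⟩)

end Transition

/-! ### First and second derivatives of transitions between normal charts -/

section NormalCharts

attribute [local instance 2000] chartedSpaceSelf

variable {n : ℕ} {M : Type*} [MetricSpace M] [ChartedSpace (Euc n) M]
  [IsManifold 𝓘(ℝ, Euc n) ∞ M]
  [RiemannianBundle (fun p : M => TangentSpace 𝓘(ℝ, Euc n) p)]
  [IsContMDiffRiemannianBundle 𝓘(ℝ, Euc n) ∞ (Euc n)
      (fun p : M => TangentSpace 𝓘(ℝ, Euc n) p)]

theorem IsNormalAt.coordInner_eq {φ : OpenPartialHomeomorph M (Euc n)} {p : M}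
    (h : IsNormalAt φ p) (e e' : Euc n) : coordInner φ (φ p) e e' = inner ℝ e e' := by
  rw [coordInner_eq_sum, h.2.1]
  simp [Matrix.one_apply, PiLp.inner_apply, mul_comm]

theorem pd_eq_zero_iff {f : Euc n → ℝ} {y : Euc n} :
    (∀ k, pd k f y = 0) ↔ fderiv ℝ f y = 0 := by
  refine ⟨fun h => ?_, fun h k => by simp [pd, h]⟩
  refine ContinuousLinearMap.coe_injective
    ((EuclideanSpace.basisFun (Fin n) ℝ).toBasis.ext fun k => ?_)
  simpa [pd] using h k

theorem isNormalAt_of_coordInner {φ : OpenPartialHomeomorph M (Euc n)} {p : M}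
    (hp : p ∈ φ.source) (h : ∀ e e', coordInner φ (φ p) e e' = inner ℝ e e')
    (h' : ∀ e e', fderiv ℝ (fun y => coordInner φ y e e') (φ p) = 0) : IsNormalAt φ p := by
  refine ⟨hp, ?_, fun i j k => ?_⟩
  · ext i j
    rw [chartMetric_apply, h]
    simp [Matrix.one_apply, EuclideanSpace.inner_single_left]
  · simp only [chartMetric_apply]
    exact pd_eq_zero_iff.2 (h' _ _) k

/-- The first derivatives of the metric in a chart `φ'`, in terms of a chart normal at `p`. -/
theorem IsNormalAt.fderiv_coordInner {φ φ' : OpenPartialHomeomorph M (Euc n)}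
    (hφ : φ ∈ IsManifold.maximalAtlas 𝓘(ℝ, Euc n) ∞ M)
    (hφ' : φ' ∈ IsManifold.maximalAtlas 𝓘(ℝ, Euc n) ∞ M) {p : M} (h : IsNormalAt φ p)
    (hp' : p ∈ φ'.source) (e e' k : Euc n) :
    fderiv ℝ (fun y => coordInner φ' y e e') (φ' p) k =
      inner ℝ (fderiv ℝ (fderiv ℝ (φ ∘ φ'.symm)) (φ' p) k e) (fderiv ℝ (φ ∘ φ'.symm) (φ' p) e') +
      inner ℝ (fderiv ℝ (φ ∘ φ'.symm) (φ' p) e)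
        (fderiv ℝ (fderiv ℝ (φ ∘ φ'.symm)) (φ' p) k e') := by
  set T := φ ∘ φ'.symm with hTdef
  have hT : ContDiffAt ℝ ∞ T (φ' p) := contDiffAt_transition hφ hφ' h.1 hp'
  have hTp : T (φ' p) = φ p := by simp [hTdef, φ'.left_inv hp']
  have hdT : HasFDerivAt (fderiv ℝ T) (fderiv ℝ (fderiv ℝ T) (φ' p)) (φ' p) :=
    ((hT.fderiv_right (m := 1) (by norm_cast)).differentiableAt (by simp)).hasFDerivAt
  have hT1 : HasFDerivAt T (fderiv ℝ T (φ' p)) (φ' p) := (hT.differentiableAt (by simp)).hasFDerivAt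
  have hcomp : ∀ (v : Euc n) (i : Fin n), HasDerivAt (fun t : ℝ => fderiv ℝ T (φ' p + t • k) v i)
      (fderiv ℝ (fderiv ℝ T) (φ' p) k v i) 0 := fun v i =>
    ((EuclideanSpace.proj (𝕜 := ℝ) i).hasFDerivAt.comp (φ' p)
      ((ContinuousLinearMap.apply ℝ (Euc n) v).hasFDerivAt.comp (φ' p) hdT)).hasLineDerivAt k
  -- Normality of `φ` kills the derivative of the metric coefficients, so only the two factors
  -- `fderiv ℝ T` contribute to the derivative of the pullback metric.
  have hg : ∀ i j, HasDerivAt (fun t : ℝ => chartMetric φ (T (φ' p + t • k)) i j) 0 0 := by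
    intro i j
    have h1 : HasFDerivAt (fun y => chartMetric φ y i j) (0 : Euc n →L[ℝ] ℝ) (T (φ' p)) := by
      have h2 := ((contDiffOn_chartMetric hφ i j).contDiffAt (φ.open_target.mem_nhds
        (φ.map_source h.1))).differentiableAt (by simp) |>.hasFDerivAt
      rw [pd_eq_zero_iff.1 (h.2.2 i j)] at h2
      rwa [hTp]
    exact (h1.comp (φ' p) hT1).hasLineDerivAt k
  have hgv : ∀ i j, chartMetric φ (T (φ' p)) i j = if i = j then 1 else 0 := fun i j => by
    rw [hTp, h.2.1, Matrix.one_apply]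
  have heq : (fun y => coordInner φ' y e e') =ᶠ[𝓝 (φ' p)] fun y =>
      ∑ i, ∑ j, fderiv ℝ T y e i * fderiv ℝ T y e' j * chartMetric φ (T y) i j := by
    filter_upwards [(isOpen_transition φ φ').mem_nhds (x := φ' p)
      ⟨φ'.map_source hp', by rw [mem_preimage, φ'.left_inv hp']; exact h.1⟩] with y hy
    rw [coordInner_transition hφ hφ' hy.1 hy.2, coordInner_eq_sum]
  have hdiff : DifferentiableAt ℝ (fun y => coordInner φ' y e e') (φ' p) :=
    ((contDiffOn_coordInner hφ' e e').contDiffAt (φ'.open_target.mem_nhds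
      (φ'.map_source hp'))).differentiableAt (by simp)
  rw [heq.fderiv_eq]
  have hline := (heq.differentiableAt_iff.1 hdiff).hasFDerivAt.hasLineDerivAt k
  have hsum := HasDerivAt.fun_sum (u := Finset.univ) fun i _ =>
    HasDerivAt.fun_sum (u := Finset.univ) fun j _ =>
      (((hcomp e i).mul (hcomp e' j)).mul (hg i j))
  refine (HasDerivAt.unique hline hsum).trans ?_
  simp only [zero_smul, add_zero, mul_zero, Pi.mul_apply, hgv, mul_ite, mul_one, Finset.sum_ite_eq,
    Finset.mem_univ, if_true, PiLp.inner_apply, RCLike.inner_apply, conj_trivial,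
    Finset.sum_add_distrib]
  congr 1 <;> exact Finset.sum_congr rfl fun _ _ => mul_comm _ _

/-- The transition map between two charts normal at `p` is isometric at `p`. -/
theorem IsNormalAt.inner_fderiv_transition {φ φ' : OpenPartialHomeomorph M (Euc n)}
    (hφ : φ ∈ IsManifold.maximalAtlas 𝓘(ℝ, Euc n) ∞ M)
    (hφ' : φ' ∈ IsManifold.maximalAtlas 𝓘(ℝ, Euc n) ∞ M) {p : M} (h : IsNormalAt φ p)
    (h' : IsNormalAt φ' p) (e e' : Euc n) :
    inner ℝ (fderiv ℝ (φ ∘ φ'.symm) (φ' p) e) (fderiv ℝ (φ ∘ φ'.symm) (φ' p) e') =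
      inner ℝ e e' := by
  have h1 := coordInner_transition hφ hφ' (φ'.map_source h'.1)
    (by rw [φ'.left_inv h'.1]; exact h.1) e e'
  rw [h'.coordInner_eq, Function.comp_apply, φ'.left_inv h'.1, h.coordInner_eq] at h1
  exact h1.symm

/-- The second derivatives of the transition map between two charts normal at `p` vanish at `p`. -/
theorem IsNormalAt.fderiv_fderiv_transition {φ φ' : OpenPartialHomeomorph M (Euc n)}
    (hφ : φ ∈ IsManifold.maximalAtlas 𝓘(ℝ, Euc n) ∞ M)
    (hφ' : φ' ∈ IsManifold.maximalAtlas 𝓘(ℝ, Euc n) ∞ M) {p : M} (h : IsNormalAt φ p)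
    (h' : IsNormalAt φ' p) : fderiv ℝ (fderiv ℝ (φ ∘ φ'.symm)) (φ' p) = 0 := by
  have hsymm : ∀ e e', fderiv ℝ (fderiv ℝ (φ ∘ φ'.symm)) (φ' p) e e' =
      fderiv ℝ (fderiv ℝ (φ ∘ φ'.symm)) (φ' p) e' e := fun e e' =>
    ((contDiffAt_transition hφ hφ' h.1 h'.1).isSymmSndFDerivAt
      (by simpa using WithTop.coe_le_coe.2 (le_top (a := (2 : ℕ∞))))).eq e e'
  -- The first derivatives of the metric vanish in `φ'` as well, which says that `⟨D²T(k, e), DT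
  -- e'⟩` is skew in `(e, e')`.
  have hskew : ∀ k e e', inner ℝ (fderiv ℝ (fderiv ℝ (φ ∘ φ'.symm)) (φ' p) k e)
      (fderiv ℝ (φ ∘ φ'.symm) (φ' p) e') =
      -inner ℝ (fderiv ℝ (fderiv ℝ (φ ∘ φ'.symm)) (φ' p) k e')
        (fderiv ℝ (φ ∘ φ'.symm) (φ' p) e) := fun k e e' => by
    have h0 : fderiv ℝ (fun y => coordInner φ' y e e') (φ' p) = 0 := by
      have h1 : (fun y => coordInner φ' y e e') =
          fun y => ∑ i, ∑ j, e i * e' j * chartMetric φ' y i j :=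
        funext fun y => coordInner_eq_sum φ' y e e'
      have h2 : ∀ i j, HasFDerivAt (fun y => chartMetric φ' y i j) (0 : Euc n →L[ℝ] ℝ) (φ' p) :=
        fun i j => by
          have h2 := ((contDiffOn_chartMetric hφ' i j).contDiffAt (φ'.open_target.mem_nhds
            (φ'.map_source h'.1))).differentiableAt (by simp) |>.hasFDerivAt
          rwa [pd_eq_zero_iff.1 (h'.2.2 i j)] at h2
      have h3 := HasFDerivAt.fun_sum (u := Finset.univ) fun i _ =>
        HasFDerivAt.fun_sum (u := Finset.univ) fun j _ => (h2 i j).const_mul (e i * e' j)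
      rw [h1]
      refine h3.fderiv.trans ?_
      simp
    have h1 := h.fderiv_coordInner hφ hφ' h'.1 e e' k
    rw [h0, _root_.zero_apply, real_inner_comm _ (fderiv ℝ (φ ∘ φ'.symm) (φ' p) e)]
      at h1
    linarith
  -- A trilinear form symmetric in its first two arguments and skew in its last two is zero:
  -- alternating the two symmetries three times gives the form equal to its opposite.
  have hz : ∀ k e e', inner ℝ (fderiv ℝ (fderiv ℝ (φ ∘ φ'.symm)) (φ' p) k e)
      (fderiv ℝ (φ ∘ φ'.symm) (φ' p) e') = 0 := fun k e e' => by
    have h1 := hskew k e e'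
    rw [hsymm k e', hskew e' k e, hsymm e' e, hskew e e' k, hsymm e k] at h1
    linarith
  have hsurj : Function.Surjective (fderiv ℝ (φ ∘ φ'.symm) (φ' p)) := by
    refine (LinearMap.injective_iff_surjective (f := (fderiv ℝ (φ ∘ φ'.symm) (φ' p) :
      Euc n →ₗ[ℝ] Euc n))).1 ((injective_iff_map_eq_zero _).2 fun e he => ?_)
    have h1 := h.inner_fderiv_transition hφ hφ' h' e e
    change fderiv ℝ (φ ∘ φ'.symm) (φ' p) e = 0 at he
    rw [he, inner_zero_left] at h1
    exact inner_self_eq_zero.1 h1.symm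
  ext1 k
  ext1 e
  obtain ⟨e', he'⟩ := hsurj (fderiv ℝ (fderiv ℝ (φ ∘ φ'.symm)) (φ' p) k e)
  have h1 := hz k e e'
  rw [he'] at h1
  exact inner_self_eq_zero.1 h1

/-- The limit of a family of normal charts is normal at the limit of the centers. -/
theorem IsNormalChartFamily.isNormalAt_zero {r : ℝ} (hr : 0 ≤ r) {x₀ : M} {x : ℝ → M}
    (hx : Tendsto x (𝓝[>] (0 : ℝ)) (𝓝 x₀)) {φ : ℝ → OpenPartialHomeomorph M (Euc n)}
    (h : IsNormalChartFamily r x₀ x φ) : IsNormalAt (φ 0) x₀ := by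
  obtain ⟨U, hU, hc⟩ := h.exists_convergingCharts
  have hn := h.choose_spec.2.2.2.1
  have hx₀ : x₀ ∈ U := hU (Metric.mem_closedBall_self hr)
  have h0 := hc.mem 0 le_rfl
  have hs : x₀ ∈ (φ 0).source := hc.sub 0 le_rfl hx₀
  have hpair : Tendsto (fun ε => (ε, x ε)) (𝓝[>] (0 : ℝ)) (𝓝[>] (0 : ℝ) ×ˢ 𝓝 x₀) :=
    tendsto_id.prodMk hx
  have hD := (hc.tendsto_fderiv hx₀).comp hpair
  have hφx : Tendsto (fun ε => φ 0 (x ε)) (𝓝[>] (0 : ℝ)) (𝓝 (φ 0 x₀)) :=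
    ((φ 0).continuousAt hs).tendsto.comp hx
  have hDe : ∀ e, Tendsto (fun ε => fderiv ℝ (φ ε ∘ (φ 0).symm) (φ 0 (x ε)) e) (𝓝[>] (0 : ℝ))
      (𝓝 e) := fun e => (ContinuousLinearMap.apply ℝ (Euc n) e).continuous.tendsto _ |>.comp hD
  have hxU : ∀ᶠ ε in 𝓝[>] (0 : ℝ), x ε ∈ U := hx (hc.isOpen.mem_nhds hx₀)
  have hsm : ∀ e e', ContDiffAt ℝ ∞ (fun y => coordInner (φ 0) y e e') (φ 0 x₀) := fun e e' =>
    (contDiffOn_coordInner h0 e e').contDiffAt ((φ 0).open_target.mem_nhds ((φ 0).map_source hs))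
  refine isNormalAt_of_coordInner hs (fun e e' => ?_) fun e e' => ?_
  -- At `x ε` the metric read in `φ 0` is the pullback of the Euclidean product by the differential
  -- of `φ ε ∘ (φ 0).symm`, which tends to the identity.
  · have h1 := (hsm e e').continuousAt.tendsto.comp hφx
    have h2 := (hDe e).inner (𝕜 := ℝ) (hDe e')
    refine tendsto_nhds_unique (h1.congr' ?_) h2
    filter_upwards [hn, hxU, ConvergingCharts.eventually_pos] with ε hε hxε hpos
    have hsε := hc.sub 0 le_rfl hxε
    rw [Function.comp_apply, coordInner_transition (hc.mem ε hpos.le) h0 ((φ 0).map_source hsε)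
      (by rw [(φ 0).left_inv hsε]; exact hε.1), Function.comp_apply, (φ 0).left_inv hsε,
      hε.coordInner_eq]
  · ext k
    have h1 : Tendsto (fun ε => fderiv ℝ (fun y => coordInner (φ 0) y e e') (φ 0 (x ε)) k)
        (𝓝[>] (0 : ℝ)) (𝓝 (fderiv ℝ (fun y => coordInner (φ 0) y e e') (φ 0 x₀) k)) :=
      ((ContinuousLinearMap.apply ℝ ℝ k).continuous.tendsto _).comp
        ((((hsm e e').fderiv_right (m := 0) (by simp)).continuousAt.tendsto).comp hφx)
    -- By `IsNormalAt.fderiv_coordInner`, the first derivatives of this metric at `x ε` are linear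
    -- in the second derivatives of `φ ε ∘ (φ 0).symm`, which tend to zero.
    obtain ⟨K, hK, hKx, hKU⟩ := hc.exists_compact_mem_nhds hx₀
    have h2 : ∀ v v' : Euc n, Tendsto (fun ε => fderiv ℝ (fderiv ℝ (φ ε ∘ (φ 0).symm))
        (φ 0 (x ε)) v v') (𝓝[>] (0 : ℝ)) (𝓝 0) := fun v v' => by
      rw [Metric.tendsto_nhds]
      intro η hη
      have hη' : 0 < η / (2 * (‖v‖ * ‖v'‖ + 1)) := by positivity
      filter_upwards [hc.eventually_fderiv_fderiv_le hK hKU hη', hx hKx] with ε hε hxε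
      rw [dist_zero_right]
      refine (hε _ (mem_image_of_mem _ hxε) v v').trans_lt ?_
      rw [mul_assoc, div_mul_eq_mul_div, div_lt_iff₀ (by positivity)]
      nlinarith [mul_nonneg (norm_nonneg v) (norm_nonneg v')]
    have h3 := ((h2 k e).inner (𝕜 := ℝ) (hDe e')).add ((hDe e).inner (𝕜 := ℝ) (h2 k e'))
    rw [inner_zero_left, inner_zero_right, add_zero] at h3
    refine tendsto_nhds_unique (h1.congr' ?_) h3
    filter_upwards [hn, hxU, ConvergingCharts.eventually_pos] with ε hε hxε hpos
    exact hε.fderiv_coordInner (hc.mem ε hpos.le) h0 (hc.sub 0 le_rfl hxε) e e' k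

/-- The differentials at the centers of the transition maps between two families of normal charts
converge to an isometry. -/
theorem IsNormalChartFamily.exists_isometry {r : ℝ} (hr : 0 ≤ r) {x₀ : M} {x : ℝ → M}
    (hx : Tendsto x (𝓝[>] (0 : ℝ)) (𝓝 x₀)) {φ φ' : ℝ → OpenPartialHomeomorph M (Euc n)}
    (h : IsNormalChartFamily r x₀ x φ) (h' : IsNormalChartFamily r x₀ x φ') :
    ∃ O : Euc n ≃ₗᵢ[ℝ] Euc n, fderiv ℝ (φ 0 ∘ (φ' 0).symm) (φ' 0 x₀) =
      (O.toContinuousLinearEquiv : Euc n →L[ℝ] Euc n) := by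
  have h0 := h.exists_convergingCharts.choose_spec.2.mem 0 le_rfl
  have h0' := h'.exists_convergingCharts.choose_spec.2.mem 0 le_rfl
  have hiso := (h.isNormalAt_zero hr hx).inner_fderiv_transition h0 h0' (h'.isNormalAt_zero hr hx)
  let L : Euc n →ₗᵢ[ℝ] Euc n :=
    LinearMap.isometryOfInner (fderiv ℝ (φ 0 ∘ (φ' 0).symm) (φ' 0 x₀) : Euc n →ₗ[ℝ] Euc n) hiso
  exact ⟨L.toLinearIsometryEquiv rfl, ContinuousLinearMap.ext fun e => rfl⟩

end NormalCharts
end BubbleFamilies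
end

open Set Filter Topology MeasureTheory Bundle Manifold
open scoped ENNReal NNReal ContDiff

noncomputable section

set_option linter.unusedSectionVars false

namespace BubbleFamilies

/-! ### Pointwise comparison of smooth bubbles in two charts -/

section SmoothModels

attribute [local instance 2000] chartedSpaceSelf

variable {n : ℕ} {M : Type*} [MetricSpace M] [ChartedSpace (Euc n) M]
  [IsManifold 𝓘(ℝ, Euc n) ∞ M]

/-- Near the centers, the transition maps between two converging families of charts are close to
their limiting differential. -/
theorem ConvergingCharts.exists_ball_transition {U : Set M}
    {φ φ' : ℝ → OpenPartialHomeomorph M (Euc n)} (h : ConvergingCharts U φ)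
    (h' : ConvergingCharts U φ') {x : ℝ → M} {x₀ : M} (hx : Tendsto x (𝓝[>] (0 : ℝ)) (𝓝 x₀))
    (hx₀ : x₀ ∈ U) {η : ℝ} (hη : 0 < η) :
    ∃ δ > 0, ∀ᶠ ε in 𝓝[>] (0 : ℝ), ∀ q ∈ (φ' ε).source,
      φ' ε q ∈ Metric.ball (φ' ε (x ε)) δ → q ∈ U ∧
      ‖fderiv ℝ (φ ε ∘ (φ' ε).symm) (φ' ε q) - fderiv ℝ (φ 0 ∘ (φ' 0).symm) (φ' 0 x₀)‖ ≤ η ∧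
      ‖φ ε q - φ ε (x ε) - fderiv ℝ (φ 0 ∘ (φ' 0).symm) (φ' 0 x₀) (φ' ε q - φ' ε (x ε))‖ ≤
        η * ‖φ' ε q - φ' ε (x ε)‖ := by
  set L := fderiv ℝ (φ 0 ∘ (φ' 0).symm) (φ' 0 x₀)
  obtain ⟨P, hP, Q, hQ, hPQ⟩ := eventually_prod_iff.1
    (Metric.tendsto_nhds.1 (h.tendsto_fderiv_transition h' hx₀) η hη)
  obtain ⟨W, hWQ, hW, hxW⟩ := eventually_nhds_iff.1 hQ
  obtain ⟨K, hK, hxK, hKW⟩ := (h.mono (h.isOpen.inter hW) inter_subset_left).exists_compact_mem_nhds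
    ⟨hx₀, hxW⟩
  have hKU : K ⊆ U := hKW.trans inter_subset_left
  obtain ⟨δ, hδ, hball⟩ := h'.exists_ball_subset_image hK hKU hx (mem_interior_iff_mem_nhds.2 hxK)
  refine ⟨δ, hδ, ?_⟩
  filter_upwards [hball, hP, ConvergingCharts.eventually_pos, hx hxK] with ε hb hPε hε hxε
  have hder : ∀ y ∈ Metric.ball (φ' ε (x ε)) δ,
      ‖fderiv ℝ (φ ε ∘ (φ' ε).symm) y - L‖ ≤ η := fun y hy => by
    obtain ⟨q, hq, rfl⟩ := hb hy
    have h1 := hPQ hPε (hWQ q (hKW hq).2)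
    rw [dist_eq_norm] at h1
    exact h1.le
  intro q hqs hq
  have hqK : q ∈ K := by
    obtain ⟨q', hq', he⟩ := hb hq
    rwa [← (φ' ε).injOn (h'.sub ε hε.le (hKU hq')) hqs he]
  refine ⟨hKU hqK, hder _ hq, ?_⟩
  -- Mean value inequality on the ball for the transition map minus its limiting differential: the
  -- remainder is at most `η` times the distance to the center, hence small relative to the scale of
  -- the bubble.
  have h1 := (convex_ball (φ' ε (x ε)) δ).norm_image_sub_le_of_norm_hasFDerivWithin_le'
    (f := φ ε ∘ (φ' ε).symm) (f' := fderiv ℝ (φ ε ∘ (φ' ε).symm)) (φ := L) (C := η)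
    (fun y hy => by
      obtain ⟨z, hz, rfl⟩ := hb hy
      refine (differentiableAt_transition (h.mem ε hε.le) (h'.mem ε hε.le)
        (h'.mem_target hε.le (hKU hz)) ?_).hasFDerivAt.hasFDerivWithinAt
      rw [h'.left_inv hε.le (hKU hz)]
      exact h.sub ε hε.le (hKU hz))
    hder (Metric.mem_ball_self hδ) hq
  rwa [Function.comp_apply, Function.comp_apply, h'.left_inv hε.le (hKU hqK),
    h'.left_inv hε.le (hKU hxε)] at h1

/-- The differential of the difference of two rescaled functions, read in the second chart. -/
theorem fderiv_rescaled_sub {φ φ' : OpenPartialHomeomorph M (Euc n)}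
    (hφ : φ ∈ IsManifold.maximalAtlas 𝓘(ℝ, Euc n) ∞ M)
    (hφ' : φ' ∈ IsManifold.maximalAtlas 𝓘(ℝ, Euc n) ∞ M) {u : Euc n → ℝ} (hu : ContDiff ℝ ∞ u)
    (O : Euc n ≃ₗᵢ[ℝ] Euc n) (p : M) {m : ℝ} (hm : 0 < m) {q : M} (hq : q ∈ φ.source)
    (hq' : q ∈ φ'.source) (e : Euc n) :
    fderiv ℝ ((rescaled u φ p m - rescaled (u ∘ O) φ' p m) ∘ φ'.symm) (φ' q) e =
      m ^ (-((n : ℝ) / 2)) * (fderiv ℝ u (m⁻¹ • (φ q - φ p)) (fderiv ℝ (φ ∘ φ'.symm) (φ' q) e) -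
        fderiv ℝ u (O (m⁻¹ • (φ' q - φ' p))) (O e)) := by
  set s : ℝ := m ^ (-(((n : ℝ) - 2) / 2)) with hs
  have hsm : m ^ (-((n : ℝ) / 2)) = s * m⁻¹ := by
    rw [hs, ← Real.rpow_neg_one, ← Real.rpow_add hm]
    congr 1
    ring
  set T := φ ∘ φ'.symm with hTdef
  have hTq : T (φ' q) = φ q := by simp [hTdef, φ'.left_inv hq']
  have heq : (rescaled u φ p m - rescaled (u ∘ O) φ' p m) ∘ φ'.symm =ᶠ[𝓝 (φ' q)] fun y =>
      s * u (m⁻¹ • (T y - φ p)) - s * u (O (m⁻¹ • (y - φ' p))) := by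
    filter_upwards [φ'.open_target.mem_nhds (φ'.map_source hq')] with y hy
    simp [rescaled, hTdef, φ'.right_inv hy, hs]
  have hT : HasFDerivAt T (fderiv ℝ T (φ' q)) (φ' q) :=
    ((contDiffAt_transition hφ hφ' hq hq').differentiableAt (by simp)).hasFDerivAt
  have hud : ∀ z, HasFDerivAt u (fderiv ℝ u z) z := fun z =>
    (hu.differentiable (by simp) z).hasFDerivAt
  have h1 := (((hud (m⁻¹ • (T (φ' q) - φ p))).comp (φ' q)
    ((hT.sub_const (φ p)).fun_const_smul m⁻¹)).hasLineDerivAt e).const_mul s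
  have h2 := (((hud (O (m⁻¹ • (φ' q - φ' p)))).comp (φ' q)
    ((O.toContinuousLinearEquiv.toContinuousLinearMap.hasFDerivAt).comp (φ' q)
      (((hasFDerivAt_id (φ' q)).sub_const (φ' p)).fun_const_smul m⁻¹))).hasLineDerivAt e).const_mul s
  have hdiff : DifferentiableAt ℝ (fun y => s * u (m⁻¹ • (T y - φ p)) -
      s * u (O (m⁻¹ • (y - φ' p)))) (φ' q) := by
    refine (((hud (m⁻¹ • (T (φ' q) - φ p))).comp (φ' q)
      ((hT.sub_const (φ p)).fun_const_smul m⁻¹)).differentiableAt.const_mul s).sub ?_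
    exact ((hud (O (m⁻¹ • (φ' q - φ' p)))).comp (φ' q)
      ((O.toContinuousLinearEquiv.toContinuousLinearMap.hasFDerivAt).comp (φ' q)
        (((hasFDerivAt_id (φ' q)).sub_const (φ' p)).fun_const_smul m⁻¹))).differentiableAt.const_mul s
  rw [heq.fderiv_eq]
  refine (HasDerivAt.unique (hdiff.hasFDerivAt.hasLineDerivAt e) (h1.sub h2)).trans ?_
  rw [hsm, hTq]
  simp only [ContinuousLinearMap.comp_apply, _root_.smul_apply, map_smul, smul_eq_mul]
  change s * (m⁻¹ * _) - s * (m⁻¹ * fderiv ℝ u (m⁻¹ • O (φ' q - φ' p)) (O e)) = _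
  ring

variable [RiemannianBundle (fun p : M => TangentSpace 𝓘(ℝ, Euc n) p)]
  [IsContMDiffRiemannianBundle 𝓘(ℝ, Euc n) ∞ (Euc n)
      (fun p : M => TangentSpace 𝓘(ℝ, Euc n) p)]
  [MeasurableSpace M] [BorelSpace M]

/-- Pointwise bounds for the difference of two rescaled functions, when the transition map is close
to the isometry `O` at the scale `m`. -/
theorem rescaled_sub_bounds {K : Set M} {C : ℝ≥0} {φ φ' : OpenPartialHomeomorph M (Euc n)}
    (hφ : φ ∈ IsManifold.maximalAtlas 𝓘(ℝ, Euc n) ∞ M) (hφ' : ChartBounds K C φ')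
    {u : Euc n → ℝ} (hu : ContDiff ℝ ∞ u) {R η : ℝ} {L₀ L₁ : ℝ≥0} (hη1 : η ≤ 1)
    (hR : 0 ≤ R) (hsupp : ∀ y, R < ‖y‖ → u y = 0 ∧ fderiv ℝ u y = 0) (hL₀ : LipschitzWith L₀ u)
    (hL₁ : LipschitzWith L₁ (fderiv ℝ u)) (O : Euc n ≃ₗᵢ[ℝ] Euc n) (p : M) {m : ℝ} (hm : 0 < m)
    (hm1 : m ≤ 1) {q : M} (hqK : q ∈ K) (hq : q ∈ φ.source)
    (hfar : ‖φ q - φ p‖ ≤ R * m → ‖φ' q - φ' p‖ ≤ 2 * R * m)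
    (hnear : ‖φ' q - φ' p‖ ≤ 2 * R * m →
      ‖fderiv ℝ (φ ∘ φ'.symm) (φ' q) - (O.toContinuousLinearEquiv : Euc n →L[ℝ] Euc n)‖ ≤ η ∧
      ‖φ q - φ p - O (φ' q - φ' p)‖ ≤ η * ‖φ' q - φ' p‖) :
    |(rescaled u φ p m - rescaled (u ∘ O) φ' p m) q| ≤ m ^ (-((n : ℝ) / 2)) *
      (Metric.closedBall (0 : Euc n) (2 * R)).indicator (fun _ => η * (2 * R * L₀))
        (m⁻¹ • (φ' q - φ' p)) ∧
    gradNorm (n := n) (rescaled u φ p m - rescaled (u ∘ O) φ' p m) q ≤ m ^ (-((n : ℝ) / 2)) *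
      (Metric.closedBall (0 : Euc n) (2 * R)).indicator (fun _ => η * (C * (4 * R * L₁ + L₀)))
        (m⁻¹ • (φ' q - φ' p)) := by
  have hq' := hφ'.sub hqK
  set t := m ^ (-((n : ℝ) / 2)) with ht
  have ht0 : 0 ≤ t := Real.rpow_nonneg hm.le _
  -- Compared with gradients, values carry an extra factor `m ≤ 1`, which is discarded so that both
  -- bounds have the same shape.
  have htm : m ^ (-(((n : ℝ) - 2) / 2)) = t * m := by
    rw [ht, ← Real.rpow_add_one hm.ne']
    congr 1
    ring
  set Y := m⁻¹ • (φ' q - φ' p) with hY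
  set Z := m⁻¹ • (φ q - φ p) with hZ
  have hval : (rescaled u φ p m - rescaled (u ∘ O) φ' p m) q = t * m * (u Z - u (O Y)) := by
    rw [Pi.sub_apply, rescaled, rescaled, htm, Function.comp_apply]
    ring
  have hnY : ‖φ' q - φ' p‖ = m * ‖Y‖ := by
    rw [hY, norm_smul, norm_inv, Real.norm_of_nonneg hm.le, mul_inv_cancel_left₀ hm.ne']
  have hnZ : ‖φ q - φ p‖ = m * ‖Z‖ := by
    rw [hZ, norm_smul, norm_inv, Real.norm_of_nonneg hm.le, mul_inv_cancel_left₀ hm.ne']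
  have hdiff : MDifferentiableAt 𝓘(ℝ, Euc n) 𝓘(ℝ, ℝ)
      (rescaled u φ p m - rescaled (u ∘ O) φ' p m) (φ'.symm (φ' q)) := by
    rw [φ'.left_inv hq']
    have h1 := (contMDiffOn_rescaled hφ hu p m).contMDiffAt (φ.open_source.mem_nhds hq)
    have h2 := (contMDiffOn_rescaled hφ'.mem (hu.comp O.toContinuousLinearEquiv.contDiff) p
      m).contMDiffAt (φ'.open_source.mem_nhds hq')
    exact (h1.sub h2).mdifferentiableAt (by simp)
  have hgrad : ∀ c : ℝ, 0 ≤ c → (∀ e, |fderiv ℝ u Z (fderiv ℝ (φ ∘ φ'.symm) (φ' q) e) -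
      fderiv ℝ u (O Y) (O e)| ≤ c * ‖e‖) →
      gradNorm (n := n) (rescaled u φ p m - rescaled (u ∘ O) φ' p m) q ≤ t * (C * c) := by
    intro c hc h
    have h1 := gradNorm_le_of_forall (n := n) hφ'.mem (φ'.map_source hq') hdiff (c := t * (C * c))
      (by positivity) fun e => by
        rw [fderiv_rescaled_sub hφ hφ'.mem hu O p hm hq hq' e, abs_mul, abs_of_nonneg ht0,
          mul_assoc]
        refine mul_le_mul_of_nonneg_left ((h e).trans ?_) ht0
        calc c * ‖e‖ ≤ c * (C * coordNorm φ' (φ' q) e) := by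
              gcongr
              exact hφ'.norm_le q hqK e
          _ = _ := by ring
    rwa [φ'.left_inv hq'] at h1
  -- Within distance `2 * R` the points `Z` and `O Y` differ by at most `2 * R * η`, and the
  -- Lipschitz bounds apply. Beyond it, `hfar` puts `Z` outside the ball of radius `R`, and `O Y` is
  -- outside too, so both terms vanish.
  by_cases hYR : ‖Y‖ ≤ 2 * R
  · have hη : 0 ≤ η := (norm_nonneg _).trans (hnear (by rw [hnY]; nlinarith)).1
    obtain ⟨hD, hZY⟩ := hnear (by rw [hnY]; nlinarith)
    have hZY' : ‖Z - O Y‖ ≤ η * (2 * R) := by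
      have h1 : Z - O Y = m⁻¹ • (φ q - φ p - O (φ' q - φ' p)) := by
        rw [hZ, hY, map_smul, ← smul_sub]
      rw [h1, norm_smul, norm_inv, Real.norm_of_nonneg hm.le, inv_mul_le_iff₀ hm]
      refine hZY.trans ?_
      rw [hnY]
      nlinarith [mul_le_mul_of_nonneg_left hYR (mul_nonneg hη hm.le)]
    have hmem : Y ∈ Metric.closedBall (0 : Euc n) (2 * R) := by simpa using hYR
    rw [indicator_of_mem hmem, indicator_of_mem hmem]
    constructor
    · rw [hval, abs_mul, abs_of_nonneg (mul_nonneg ht0 hm.le), mul_assoc]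
      refine mul_le_mul_of_nonneg_left ?_ ht0
      have h1 : |u Z - u (O Y)| ≤ L₀ * (η * (2 * R)) := by
        refine (hL₀.dist_le_mul Z (O Y)).trans ?_
        rw [dist_eq_norm]
        gcongr
      calc m * |u Z - u (O Y)| ≤ 1 * (L₀ * (η * (2 * R))) := by gcongr
        _ = _ := by ring
    · refine (hgrad (η * (4 * R * L₁ + L₀)) (by positivity) fun e => ?_).trans_eq (by ring)
      set D := fderiv ℝ (φ ∘ φ'.symm) (φ' q)
      have hDO : ‖D e - O e‖ ≤ η * ‖e‖ :=
        ((D - (O.toContinuousLinearEquiv : Euc n →L[ℝ] Euc n)).le_opNorm e).trans (by gcongr)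
      have hDe : ‖D e‖ ≤ 2 * ‖e‖ := by
        have h1 := norm_add_le (D e - O e) (O e)
        rw [sub_add_cancel, O.norm_map] at h1
        nlinarith [norm_nonneg e]
      have hL : ‖fderiv ℝ u Z - fderiv ℝ u (O Y)‖ ≤ L₁ * (η * (2 * R)) := by
        rw [← dist_eq_norm]
        refine (hL₁.dist_le_mul Z (O Y)).trans ?_
        rw [dist_eq_norm]
        gcongr
      -- The first term compares the points, using `L₁` and `‖D e‖ ≤ 2 * ‖e‖`, which yields `4 * R *
      -- L₁`; the second compares the linear maps `D` and `O`, using `L₀`.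
      have hsplit : fderiv ℝ u Z (D e) - fderiv ℝ u (O Y) (O e) =
          (fderiv ℝ u Z - fderiv ℝ u (O Y)) (D e) + fderiv ℝ u (O Y) (D e - O e) := by
        rw [map_sub, _root_.sub_apply]
        ring
      rw [hsplit]
      refine (abs_add_le _ _).trans ?_
      have t1 : |(fderiv ℝ u Z - fderiv ℝ u (O Y)) (D e)| ≤ L₁ * (η * (2 * R)) * (2 * ‖e‖) :=
        ((fderiv ℝ u Z - fderiv ℝ u (O Y)).le_opNorm (D e)).trans
          (mul_le_mul hL hDe (norm_nonneg _) (by positivity))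
      have t2 : |fderiv ℝ u (O Y) (D e - O e)| ≤ L₀ * (η * ‖e‖) :=
        ((fderiv ℝ u (O Y)).le_opNorm _).trans
          (mul_le_mul (norm_fderiv_le_of_lipschitz ℝ hL₀) hDO (norm_nonneg _) (by positivity))
      calc _ ≤ _ := add_le_add t1 t2
        _ = _ := by ring
  · have hmem : Y ∉ Metric.closedBall (0 : Euc n) (2 * R) := by simpa using hYR
    have hZR : R < ‖Z‖ := by
      by_contra hZR
      refine hYR ?_
      have h1 := hfar (by rw [hnZ]; nlinarith)
      rw [hnY] at h1
      nlinarith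
    have hOY : R < ‖O Y‖ := by
      rw [O.norm_map]
      linarith [not_le.1 hYR]
    rw [indicator_of_notMem hmem, indicator_of_notMem hmem, hval, (hsupp _ hZR).1, (hsupp _ hOY).1]
    refine ⟨by simp, ?_⟩
    have := hgrad 0 le_rfl fun e => by rw [(hsupp _ hZR).2, (hsupp _ hOY).2]; simp
    simpa using this

end SmoothModels
end BubbleFamilies
end

open Set Filter Topology MeasureTheory Bundle Manifold
open scoped ENNReal NNReal ContDiff

noncomputable section

set_option linter.unusedSectionVars false

namespace BubbleFamilies

/-! ### Change of charts for smooth compactly supported models -/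

section SmoothModelsLimit

attribute [local instance 2000] chartedSpaceSelf

/-- By compactness the complement of `interior K` is at distance strictly more than `r` from `x₀`,
which leaves room to move the center. The cutoffs around `x ε` are thus all supported in `interior
K` for small `ε`. -/
theorem exists_compact_closedBall_subset {X : Type*} [MetricSpace X] [CompactSpace X] {U : Set X}
    (hU : IsOpen U) {r : ℝ} {x₀ : X} (hr : Metric.closedBall x₀ r ⊆ U) {x : ℝ → X}
    (hx : Tendsto x (𝓝[>] (0 : ℝ)) (𝓝 x₀)) :
    ∃ K, IsCompact K ∧ K ⊆ U ∧ Metric.closedBall x₀ r ⊆ interior K ∧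
      ∀ᶠ ε in 𝓝[>] (0 : ℝ), Metric.closedBall (x ε) r ⊆ interior K := by
  obtain ⟨K, hK, hrK, hKU⟩ := exists_compact_between (isCompact_closedBall x₀ r) hU hr
  refine ⟨K, hK, hKU, hrK, ?_⟩
  have hc : IsCompact (interior K)ᶜ := isOpen_interior.isClosed_compl.isCompact
  rcases (interior K)ᶜ.eq_empty_or_nonempty with he | hne
  · exact Eventually.of_forall fun ε q _ => by
      rw [compl_empty_iff.1 he]
      trivial
  · obtain ⟨z, hz, hmin⟩ := hc.exists_isMinOn hne (f := fun q => dist q x₀) (by fun_prop)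
    have hzr : r < dist z x₀ := not_le.1 fun h => hz (hrK h)
    filter_upwards [Metric.tendsto_nhds.1 hx (dist z x₀ - r) (sub_pos.2 hzr)] with ε hε q hq
    by_contra hqK
    have h1 : dist z x₀ ≤ dist q x₀ := hmin hqK
    have h2 := dist_triangle q (x ε) x₀
    rw [Metric.mem_closedBall] at hq
    linarith

variable {n : ℕ} {M : Type*} [MetricSpace M] [ChartedSpace (Euc n) M]
  [IsManifold 𝓘(ℝ, Euc n) ∞ M]
  [RiemannianBundle (fun p : M => TangentSpace 𝓘(ℝ, Euc n) p)]
  [IsContMDiffRiemannianBundle 𝓘(ℝ, Euc n) ∞ (Euc n)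
      (fun p : M => TangentSpace 𝓘(ℝ, Euc n) p)]
  [IsRiemannianManifold 𝓘(ℝ, Euc n) M] [MeasurableSpace M] [BorelSpace M]

theorem ChartBounds.mono {K : Set M} {C C' : ℝ≥0} {φ : OpenPartialHomeomorph M (Euc n)}
    (h : ChartBounds K C φ) (hC : C ≤ C') : ChartBounds K C' φ where
  mem := h.mem
  sub := h.sub
  lintegral_le f := (h.lintegral_le f).trans (by gcongr)
  le_lintegral f := (h.le_lintegral f).trans (by gcongr)
  norm_le q hq e := (h.norm_le q hq e).trans (by
    have := coordNorm_nonneg φ (φ q) e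
    gcongr)
  le_norm q hq e := (h.le_norm q hq e).trans (by gcongr)

/-- The exponent `-n / 2` makes the `L²` norm of the rescaled indicator independent of `m`, so a
pointwise bound of size `η` at scale `m` gives an `L²` bound of size `η`. -/
theorem ChartBounds.eLpNorm_le_of_abs_le_indicator {K : Set M} {C : ℝ≥0}
    {φ : OpenPartialHomeomorph M (Euc n)} (hφ : ChartBounds K C φ) (hK : MeasurableSet K) (p : M) {m : ℝ} (hm : 0 < m)
    {η : ℝ} (hη : 0 ≤ η) {F : M → ℝ} {c : ℝ≥0} {ρ : ℝ}
    (hF : ∀ q ∈ K, |F q| ≤ m ^ (-((n : ℝ) / 2)) *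
      (Metric.closedBall (0 : Euc n) ρ).indicator (fun _ => η * c) (m⁻¹ • (φ q - φ p))) :
    eLpNorm F 2 ((vol n).restrict K) ≤ (C : ℝ≥0∞) ^ (1 / (2 : ℝ≥0∞).toReal) *
      (c * volume (Metric.closedBall (0 : Euc n) ρ) ^ (1 / (2 : ℝ≥0∞).toReal)) *
        ENNReal.ofReal η := by
  set B := Metric.closedBall (0 : Euc n) ρ
  have hs : 0 ≤ m ^ (-((n : ℝ) / 2)) := Real.rpow_nonneg hm.le _
  have h2 := hφ.eLpNorm_comp_rescale_le (B.indicator fun _ => η * (c : ℝ)) p hm (q := 2)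
    (a := (n : ℝ) / 2) (by norm_num) (by norm_num) (by simp; ring)
  have h3 : eLpNorm (B.indicator fun _ => η * (c : ℝ)) 2 volume =
      (c * volume B ^ (1 / (2 : ℝ≥0∞).toReal)) * ENNReal.ofReal η := by
    rw [eLpNorm_indicator_const Metric.isClosed_closedBall.measurableSet (by norm_num)
      (by norm_num), enorm_mul, Real.enorm_of_nonneg hη]
    simp only [Real.enorm_of_nonneg c.coe_nonneg, ENNReal.ofReal_coe_nnreal]
    ring
  rw [h3, ← mul_assoc] at h2
  refine le_trans ?_ h2
  rw [← Real.enorm_of_nonneg hs]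
  refine le_trans (eLpNorm_mono_ae_real ?_) (eLpNorm_const_smul_le (c := m ^ (-((n : ℝ) / 2)))
    (f := fun q => B.indicator (fun _ => η * (c : ℝ)) (m⁻¹ • (φ q - φ p))))
  filter_upwards [ae_restrict_mem hK] with q hq using hF q hq

variable [CompactSpace M]

/-- Two families of normal charts converge on a common neighbourhood of the ball, with common bounds
on a compact neighbourhood of it. -/
theorem IsNormalChartFamily.exists_common_bounds {r : ℝ} {x₀ : M} {x : ℝ → M}
    (hx : Tendsto x (𝓝[>] (0 : ℝ)) (𝓝 x₀)) {φ φ' : ℝ → OpenPartialHomeomorph M (Euc n)}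
    (h : IsNormalChartFamily r x₀ x φ) (h' : IsNormalChartFamily r x₀ x φ') :
    ∃ (U K : Set M) (C : ℝ≥0), ConvergingCharts U φ ∧ ConvergingCharts U φ' ∧
      Metric.closedBall x₀ r ⊆ U ∧ IsCompact K ∧ K ⊆ U ∧ ChartBounds K C (φ 0) ∧
      ∀ᶠ ε in 𝓝[>] (0 : ℝ), ChartBounds K C (φ ε) ∧ ChartBounds K C (φ' ε) ∧
        Metric.closedBall (x ε) r ⊆ interior K := by
  obtain ⟨U, hU, hc⟩ := h.exists_convergingCharts
  obtain ⟨U', hU', hc'⟩ := h'.exists_convergingCharts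
  have hc₁ := hc.mono (hc.isOpen.inter hc'.isOpen) inter_subset_left
  have hc₂ := hc'.mono (hc.isOpen.inter hc'.isOpen) inter_subset_right
  obtain ⟨K, hK, hKU, -, hKx⟩ := exists_compact_closedBall_subset hc₁.isOpen
    (subset_inter hU hU') hx
  obtain ⟨C, hC0, hC⟩ := hc₁.exists_chartBounds hK hKU
  obtain ⟨C', -, hC'⟩ := hc₂.exists_chartBounds hK hKU
  refine ⟨U ∩ U', K, max C C', hc₁, hc₂, subset_inter hU hU', hK, hKU,
    hC0.mono (le_max_left _ _), ?_⟩
  filter_upwards [hC, hC', hKx] with ε h1 h2 h3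
  exact ⟨h1.mono (le_max_left _ _), h2.mono (le_max_right _ _), h3⟩

/-- For smooth models with compact support, changing the charts amounts to composing the model with
the limiting isometry. -/
theorem tendstoZeroH1_bubbleProfile_sub_of_smooth {r : ℝ} (hr : 0 ≤ r)
    {χ : ℝ → ℝ} (hχ : ContDiff ℝ ∞ χ) (hχ0 : ∀ t, r ≤ |t| → χ t = 0) {x₀ : M} {x : ℝ → M}
    (hx : Tendsto x (𝓝[>] (0 : ℝ)) (𝓝 x₀)) {μ : ℝ → ℝ} (hμ_pos : ∀ ε, 0 < ε → 0 < μ ε)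
    (hμ : Tendsto μ (𝓝[>] (0 : ℝ)) (𝓝 0)) {φ φ' : ℝ → OpenPartialHomeomorph M (Euc n)}
    (h : IsNormalChartFamily r x₀ x φ) (h' : IsNormalChartFamily r x₀ x φ')
    {O : Euc n ≃ₗᵢ[ℝ] Euc n} (hO : fderiv ℝ (φ 0 ∘ (φ' 0).symm) (φ' 0 x₀) =
      (O.toContinuousLinearEquiv : Euc n →L[ℝ] Euc n))
    {u : Euc n → ℝ} (hu : ContDiff ℝ ∞ u) (hsupp : HasCompactSupport u) :
    TendstoZeroH1 n (fun ε => bubbleProfile χ u (φ ε) (x ε) (μ ε) -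
      bubbleProfile χ (u ∘ O) (φ' ε) (x ε) (μ ε)) := by
  obtain ⟨U, K, C, hc, hc', hrU, hK, hKU, hC0, hCε⟩ := h.exists_common_bounds hx h'
  have hx₀ : x₀ ∈ U := hrU (Metric.mem_closedBall_self hr)
  obtain ⟨A, hA⟩ := exists_cutoffApprox_dist hχ hχ0 hK hC0
  obtain ⟨O', hO'⟩ := h'.exists_isometry hr hx h
  obtain ⟨L₀, hL₀⟩ := hu.lipschitzWith_of_hasCompactSupport hsupp (by simp)
  obtain ⟨L₁, hL₁⟩ := (hu.fderiv_right (m := ∞) (by simp)).lipschitzWith_of_hasCompactSupport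
    (hsupp.fderiv (𝕜 := ℝ)) (by simp)
  obtain ⟨R₀, hR₀⟩ := hsupp.isCompact.isBounded.subset_closedBall (0 : Euc n)
  set R := max R₀ 0
  have hR : 0 ≤ R := le_max_right _ _
  have hRs : ∀ y, R < ‖y‖ → u y = 0 ∧ fderiv ℝ u y = 0 := fun y hy => by
    have h1 : y ∉ tsupport u := fun h => by
      have := mem_closedBall_zero_iff.1 (hR₀ h)
      exact absurd (this.trans (le_max_left R₀ 0)) (not_le.2 hy)
    exact ⟨image_eq_zero_of_notMem_tsupport h1,
      Function.notMem_support.1 fun h2 => h1 (support_fderiv_subset ℝ h2)⟩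
  set B := Metric.closedBall (0 : Euc n) (2 * R)
  set c₁ : ℝ≥0 := Real.toNNReal (2 * R * L₀)
  set c₂ : ℝ≥0 := Real.toNNReal (C * (4 * R * L₁ + L₀))
  have hc₁ : (c₁ : ℝ) = 2 * R * L₀ := Real.coe_toNNReal _ (by positivity)
  have hc₂ : (c₂ : ℝ) = C * (4 * R * L₁ + L₀) := Real.coe_toNNReal _ (by positivity)
  set Λ : ℝ≥0∞ := 2 * A * ((C : ℝ≥0∞) ^ (1 / (2 : ℝ≥0∞).toReal) *
    ((c₁ + c₂) * volume B ^ (1 / (2 : ℝ≥0∞).toReal)))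
  have hBfin : volume B < ⊤ := measure_closedBall_lt_top
  have hΛ : Λ ≠ ⊤ := by finiteness
  refine ENNReal.tendsto_nhds_zero.2 fun κ hκ => ?_
  obtain ⟨η, ⟨hη0, hη1⟩, hηκ⟩ : ∃ η ∈ Ioc (0 : ℝ) 1, Λ * ENNReal.ofReal η ≤ κ := by
    have h1 : Tendsto (fun η : ℝ => Λ * ENNReal.ofReal η) (𝓝[>] 0) (𝓝 0) := by
      have h2 := ENNReal.Tendsto.const_mul (a := Λ)
        (ENNReal.continuous_ofReal.tendsto (0 : ℝ)) (Or.inr hΛ)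
      rw [ENNReal.ofReal_zero, mul_zero] at h2
      exact h2.mono_left nhdsWithin_le_nhds
    have h3 : ∀ᶠ η in 𝓝[>] (0 : ℝ), η ∈ Ioc (0 : ℝ) 1 := Ioc_mem_nhdsGT one_pos
    exact (h3.and (ENNReal.tendsto_nhds_zero.1 h1 κ hκ)).exists
  obtain ⟨δ, hδ, hb⟩ := hc.exists_ball_transition hc' hx hx₀ hη0
  -- The inverse transition is needed only crudely, with error 1: its limiting differential is an
  -- isometry, so distances to the center grow by a factor at most 2. This gives `hfar`.
  obtain ⟨δ', hδ', hb'⟩ := hc'.exists_ball_transition hc hx hx₀ one_pos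
  have hsmall : ∀ᶠ ε in 𝓝[>] (0 : ℝ), μ ε ≤ 1 ∧ 2 * R * μ ε < δ ∧ R * μ ε < δ' := by
    have e1 := hμ.eventually_le_const one_pos
    have e2 : Tendsto (fun ε => 2 * R * μ ε) (𝓝[>] (0 : ℝ)) (𝓝 0) := by
      simpa using hμ.const_mul (2 * R)
    have e3 : Tendsto (fun ε => R * μ ε) (𝓝[>] (0 : ℝ)) (𝓝 0) := by
      simpa using hμ.const_mul R
    exact e1.and ((e2.eventually_lt_const hδ).and (e3.eventually_lt_const hδ'))
  filter_upwards [hCε, hb, hb', hsmall, ConvergingCharts.eventually_pos] with ε hCε hb hb' hsm hε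
  obtain ⟨hC, hC', hball⟩ := hCε
  have hm := hμ_pos ε hε
  obtain ⟨g, hg⟩ := hA (x ε) hball
  have hbd := fun q (hq : q ∈ K) => rescaled_sub_bounds hC.mem hC' hu hη1 hR hRs hL₀ hL₁ O (x ε)
    hm hsm.1 hq (hC.sub hq)
    (fun hfar => by
      have h1 := (hb' q (hC.sub hq) (mem_ball_iff_norm.2 (hfar.trans_lt hsm.2.2))).2.2
      rw [hO'] at h1
      have h2 := norm_add_le (φ' ε q - φ' ε (x ε) - O' (φ ε q - φ ε (x ε)))
        (O' (φ ε q - φ ε (x ε)))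
      rw [sub_add_cancel, O'.norm_map] at h2
      have h3 : ‖φ' ε q - φ' ε (x ε) - O' (φ ε q - φ ε (x ε))‖ ≤ 1 * ‖φ ε q - φ ε (x ε)‖ := h1
      linarith)
    (fun hnear => by
      have h1 := (hb q (hC'.sub hq) (mem_ball_iff_norm.2 (hnear.trans_lt hsm.2.1))).2
      rw [hO] at h1
      exact h1)
  rw [bubbleProfile_eq, bubbleProfile_eq, ← mul_sub]
  refine (hg.h1Norm_mul_le_of_contMDiffOn hK hC0 hc.isOpen hKU
    (((contMDiffOn_rescaled hC.mem hu _ _).mono (hc.sub ε hε.le)).sub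
      ((contMDiffOn_rescaled hC'.mem (hu.comp O.toContinuousLinearEquiv.contDiff) _ _).mono
        (hc'.sub ε hε.le)))).trans (le_trans ?_ hηκ)
  have f1 := hC'.eLpNorm_le_of_abs_le_indicator hK.isClosed.measurableSet (x ε) hm hη0.le
    (F := rescaled u (φ ε) (x ε) (μ ε) - rescaled (u ∘ O) (φ' ε) (x ε) (μ ε)) (c := c₁) (ρ := 2 * R)
    fun q hq => by
      rw [hc₁]
      exact (hbd q hq).1
  have f2 := hC'.eLpNorm_le_of_abs_le_indicator hK.isClosed.measurableSet (x ε) hm hη0.le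
    (F := gradNorm (n := n) (rescaled u (φ ε) (x ε) (μ ε) - rescaled (u ∘ O) (φ' ε) (x ε) (μ ε)))
    (c := c₂) (ρ := 2 * R) fun q hq => by
      rw [hc₂, abs_of_nonneg (gradNorm_nonneg (n := n) _ _)]
      exact (hbd q hq).2
  unfold localH1Norm
  refine (mul_le_mul_right (add_le_add f1 f2) _).trans_eq ?_
  simp only [Λ]
  ring

end SmoothModelsLimit
end BubbleFamilies
end

open Set Filter Topology MeasureTheory Bundle Manifold
open scoped ENNReal NNReal ContDiff

noncomputable section

set_option linter.unusedSectionVars false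

namespace BubbleFamilies

/-! ### The space `D^{1,2}` and its isometry invariance -/

section FiniteEnergy

variable {n : ℕ}

theorem one_le_ofReal_twoStar (hn : 3 ≤ n) : 1 ≤ ENNReal.ofReal (twoStar n) := by
  rw [← ENNReal.ofReal_one]
  exact ENNReal.ofReal_le_ofReal (by linarith [two_le_twoStar hn])

theorem continuous_gradient {u : Euc n → ℝ} (hu : ContDiff ℝ ∞ u) : Continuous (gradient u) :=
  (InnerProductSpace.toDual ℝ (Euc n)).symm.continuous.comp (hu.continuous_fderiv (by simp))

theorem hasCompactSupport_gradient {u : Euc n → ℝ} (hu : HasCompactSupport u) :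
    HasCompactSupport (gradient u) :=
  (hu.fderiv (𝕜 := ℝ)).comp_left (map_zero (InnerProductSpace.toDual ℝ (Euc n)).symm)

theorem HasD12Gradient.of_smooth {u : Euc n → ℝ} (hu : ContDiff ℝ ∞ u) (hc : HasCompactSupport u) :
    HasD12Gradient u (gradient u) where
  memLp := hu.continuous.memLp_of_hasCompactSupport hc
  memLp_grad := (continuous_gradient hu).memLp_of_hasCompactSupport (hasCompactSupport_gradient hc)
  approx := ⟨fun _ => u, fun _ => ⟨hu, hc⟩, by simp, by simp⟩

theorem HasD12Gradient.congr_ae {V V' : Euc n → ℝ} {G : Euc n → Euc n} (h : HasD12Gradient V G)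
    (hV : V =ᵐ[volume] V') : HasD12Gradient V' G where
  memLp := h.memLp.ae_eq hV
  memLp_grad := h.memLp_grad
  approx := by
    obtain ⟨u, hu, h1, h2⟩ := h.approx
    refine ⟨u, hu, h1.congr fun k => eLpNorm_congr_ae ?_, h2⟩
    filter_upwards [hV] with y hy
    rw [hy]

theorem HasD12Gradient.sub (hn : 3 ≤ n) {V W : Euc n → ℝ} {G H : Euc n → Euc n}
    (h : HasD12Gradient V G) (h' : HasD12Gradient W H) : HasD12Gradient (V - W) (G - H) where
  memLp := h.memLp.sub h'.memLp
  memLp_grad := h.memLp_grad.sub h'.memLp_grad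
  approx := by
    obtain ⟨u, hu, h1, h2⟩ := h.approx
    obtain ⟨v, hv, h3, h4⟩ := h'.approx
    refine ⟨fun k y => u k y - v k y, fun k => ⟨(hu k).1.sub (hv k).1, (hu k).2.sub (hv k).2⟩,
      ?_, ?_⟩
    · refine tendsto_of_tendsto_of_tendsto_of_le_of_le tendsto_const_nhds
        (by simpa using h1.add h3) (fun _ => zero_le) fun k => ?_
      refine le_trans (le_of_eq ?_) (eLpNorm_sub_le
        ((hu k).1.continuous.aestronglyMeasurable.sub h.memLp.1)
        ((hv k).1.continuous.aestronglyMeasurable.sub h'.memLp.1) (one_le_ofReal_twoStar hn))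
      congr 1
      ext1 y
      simp only [Pi.sub_apply]
      ring
    · refine tendsto_of_tendsto_of_tendsto_of_le_of_le tendsto_const_nhds
        (by simpa using h2.add h4) (fun _ => zero_le) fun k => ?_
      refine le_trans (le_of_eq ?_) (eLpNorm_sub_le
        ((continuous_gradient (hu k).1).aestronglyMeasurable.sub h.memLp_grad.1)
        ((continuous_gradient (hv k).1).aestronglyMeasurable.sub h'.memLp_grad.1) (by norm_num))
      congr 1
      ext1 y
      rw [gradient_fun_sub ((hu k).1.differentiable (by simp) y)
        ((hv k).1.differentiable (by simp) y)]
      simp only [Pi.sub_apply]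
      abel

theorem gradient_comp_isometry (O : Euc n ≃ₗᵢ[ℝ] Euc n) {u : Euc n → ℝ} (hu : Differentiable ℝ u)
    (y : Euc n) : gradient (u ∘ O) y = O.symm (gradient u (O y)) := by
  refine ext_inner_right ℝ fun e => ?_
  have h1 := (hu (O y)).hasFDerivAt.comp y
    (O.toContinuousLinearEquiv.toContinuousLinearMap.hasFDerivAt)
  have h2 : inner ℝ (gradient (u ∘ O) y) e = fderiv ℝ (u ∘ O) y e := by simp [gradient]
  have h3 : inner ℝ (gradient u (O y)) (O e) = fderiv ℝ u (O y) (O e) := by simp [gradient]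
  rw [h2, ← O.inner_map_map, O.apply_symm_apply, h3]
  exact congrArg (fun l : Euc n →L[ℝ] ℝ => l e) h1.fderiv

theorem HasD12Gradient.comp_isometry {V : Euc n → ℝ} {G : Euc n → Euc n} (h : HasD12Gradient V G)
    (O : Euc n ≃ₗᵢ[ℝ] Euc n) : HasD12Gradient (V ∘ O) (fun y => O.symm (G (O y))) where
  memLp := h.memLp.comp_measurePreserving O.measurePreserving
  memLp_grad := by
    have h1 := h.memLp_grad.comp_measurePreserving O.measurePreserving
    refine h1.of_le (O.symm.continuous.comp_aestronglyMeasurable h1.1)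
      (Eventually.of_forall fun y => ?_)
    rw [O.symm.norm_map]
    rfl
  approx := by
    obtain ⟨u, hu, h1, h2⟩ := h.approx
    refine ⟨fun k => u k ∘ O, fun k => ⟨(hu k).1.comp O.toContinuousLinearEquiv.contDiff,
      (hu k).2.comp_homeomorph O.toHomeomorph⟩, ?_, ?_⟩
    · refine h1.congr fun k => ?_
      exact (eLpNorm_comp_measurePreserving ((hu k).1.continuous.aestronglyMeasurable.sub h.memLp.1)
        O.measurePreserving).symm
    · refine h2.congr fun k => ?_
      refine (eLpNorm_comp_measurePreserving
        ((continuous_gradient (hu k).1).aestronglyMeasurable.sub h.memLp_grad.1)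
        O.measurePreserving).symm.trans (eLpNorm_congr_norm_ae (Eventually.of_forall fun y => ?_))
      rw [gradient_comp_isometry O ((hu k).1.differentiable (by simp)), ← map_sub, O.symm.norm_map]
      rfl

theorem mem_sigmaSol_congr_ae {V V' : Euc n → ℝ} (hV : V ∈ SigmaSol n) (h : V =ᵐ[volume] V') :
    V' ∈ SigmaSol n := by
  obtain ⟨G, hG, hne, heq⟩ := hV
  refine ⟨G, hG.congr_ae h, fun h0 => hne (h.trans h0), fun ψ hψ hψc => ?_⟩
  rw [heq ψ hψ hψc]
  refine integral_congr_ae ?_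
  filter_upwards [h] with y hy
  rw [hy]

/-- The weak equation for `V ∘ O` tested on `ψ` is that for `V` tested on `ψ ∘ O.symm`, since `O`
preserves Lebesgue measure and the inner product of gradients. -/
theorem comp_isometry_mem_sigmaSol {V : Euc n → ℝ} (hV : V ∈ SigmaSol n)
    (O : Euc n ≃ₗᵢ[ℝ] Euc n) : V ∘ O ∈ SigmaSol n := by
  obtain ⟨G, hG, hne, heq⟩ := hV
  refine ⟨_, hG.comp_isometry O, fun h0 => hne ?_, fun ψ hψ hψc => ?_⟩
  · have h1 := O.symm.measurePreserving.quasiMeasurePreserving.ae h0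
    filter_upwards [h1] with y hy
    simpa using hy
  · have h1 := heq (ψ ∘ O.symm) (hψ.comp O.symm.toContinuousLinearEquiv.contDiff)
      (hψc.comp_homeomorph O.symm.toHomeomorph)
    have hemb : MeasurableEmbedding O := O.toHomeomorph.measurableEmbedding
    rw [← O.measurePreserving.integral_comp hemb
        (fun y => inner ℝ (G y) (gradient (ψ ∘ O.symm) y)),
      ← O.measurePreserving.integral_comp hemb
        (fun y => |V y| ^ (twoStar n - 2) * V y * (ψ ∘ O.symm) y)] at h1
    refine Eq.trans (integral_congr_ae (Eventually.of_forall fun y => ?_))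
      (h1.trans (integral_congr_ae (Eventually.of_forall fun y => ?_)))
    · dsimp only
      rw [gradient_comp_isometry O.symm (hψ.differentiable (by simp)), O.symm_apply_apply,
        ← O.inner_map_map, O.apply_symm_apply]
      rfl
    · simp

end FiniteEnergy

/-! ### Change of charts for models of finite energy -/

section ChangeOfCharts

attribute [local instance 2000] chartedSpaceSelf

variable {n : ℕ} {M : Type*} [MetricSpace M] [ChartedSpace (Euc n) M]
  [IsManifold 𝓘(ℝ, Euc n) ∞ M]
  [RiemannianBundle (fun p : M => TangentSpace 𝓘(ℝ, Euc n) p)]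
  [IsContMDiffRiemannianBundle 𝓘(ℝ, Euc n) ∞ (Euc n)
      (fun p : M => TangentSpace 𝓘(ℝ, Euc n) p)]
  [IsRiemannianManifold 𝓘(ℝ, Euc n) M] [MeasurableSpace M] [BorelSpace M] [CompactSpace M]

theorem bubbleProfile_sub (χ : ℝ → ℝ) (V W : Euc n → ℝ) (φ : OpenPartialHomeomorph M (Euc n))
    (p : M) (m : ℝ) :
    bubbleProfile χ (V - W) φ p m = bubbleProfile χ V φ p m - bubbleProfile χ W φ p m :=
  funext fun q => by
    simp only [bubbleProfile, Pi.sub_apply]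
    ring

/-- Changing the charts amounts to composing the model with the limiting isometry. -/
theorem tendstoZeroH1_bubbleProfile_sub (hn : 3 ≤ n) {r : ℝ} (hr : 0 ≤ r)
    {χ : ℝ → ℝ} (hχ : ContDiff ℝ ∞ χ) (hχ0 : ∀ t, r ≤ |t| → χ t = 0) {x₀ : M} {x : ℝ → M}
    (hx : Tendsto x (𝓝[>] (0 : ℝ)) (𝓝 x₀)) {μ : ℝ → ℝ} (hμ_pos : ∀ ε, 0 < ε → 0 < μ ε)
    (hμ : Tendsto μ (𝓝[>] (0 : ℝ)) (𝓝 0)) {φ φ' : ℝ → OpenPartialHomeomorph M (Euc n)}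
    (h : IsNormalChartFamily r x₀ x φ) (h' : IsNormalChartFamily r x₀ x φ')
    {O : Euc n ≃ₗᵢ[ℝ] Euc n} (hO : fderiv ℝ (φ 0 ∘ (φ' 0).symm) (φ' 0 x₀) =
      (O.toContinuousLinearEquiv : Euc n →L[ℝ] Euc n))
    {V : Euc n → ℝ} {G : Euc n → Euc n} (hV : HasD12Gradient V G) :
    TendstoZeroH1 n (fun ε => bubbleProfile χ V (φ ε) (x ε) (μ ε) -
      bubbleProfile χ (V ∘ O) (φ' ε) (x ε) (μ ε)) := by
  obtain ⟨U, K, C, -, -, -, hK, -, hC0, hCε⟩ := h.exists_common_bounds hx h'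
  obtain ⟨D, hD⟩ := exists_h1Norm_bubbleProfile_le hn hχ hχ0 hK hC0
  obtain ⟨u, hu, h1, h2⟩ := hV.approx
  refine ENNReal.tendsto_nhds_zero.2 fun κ hκ => ?_
  have hκ3 : 0 < κ / 3 := ENNReal.div_pos hκ.ne' (by norm_num)
  have h3 : Tendsto (fun k => (D : ℝ≥0∞) *
      (eLpNorm (fun y => u k y - V y) (ENNReal.ofReal (twoStar n)) volume +
        eLpNorm (fun y => gradient (u k) y - G y) 2 volume)) atTop (𝓝 0) := by
    simpa using ENNReal.Tendsto.const_mul (a := (D : ℝ≥0∞)) (h1.add h2) (Or.inr (by finiteness))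
  obtain ⟨k, hk⟩ := (ENNReal.tendsto_nhds_zero.1 h3 _ hκ3).exists
  have hW := (HasD12Gradient.of_smooth (hu k).1 (hu k).2).sub hn hV
  have hW' := hW.comp_isometry O
  have e1 : eLpNorm ((u k - V) ∘ O) (ENNReal.ofReal (twoStar n)) volume =
      eLpNorm (fun y => u k y - V y) (ENNReal.ofReal (twoStar n)) volume :=
    eLpNorm_comp_measurePreserving hW.memLp.1 O.measurePreserving
  have e2 : eLpNorm (fun y => O.symm ((gradient (u k) - G) (O y))) 2 volume =
      eLpNorm (fun y => gradient (u k) y - G y) 2 volume := by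
    refine Eq.trans (eLpNorm_congr_norm_ae (Eventually.of_forall fun y => ?_))
      (eLpNorm_comp_measurePreserving hW.memLp_grad.1 O.measurePreserving)
    rw [O.symm.norm_map]
    rfl
  have hsm := ENNReal.tendsto_nhds_zero.1 (tendstoZeroH1_bubbleProfile_sub_of_smooth hr hχ hχ0 hx
    hμ_pos hμ h h' hO (hu k).1 (hu k).2) _ hκ3
  filter_upwards [hCε, hsm, ConvergingCharts.eventually_pos] with ε hCε hsm hε
  have b1 := (hD _ hCε.1 (x ε) _ (hμ_pos ε hε) hCε.2.2 _ _ hW).trans hk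
  have b2 := hD _ hCε.2.1 (x ε) _ (hμ_pos ε hε) hCε.2.2 _ _ hW'
  rw [e1, e2] at b2
  -- The two outer terms are bubbles of `u k - V` and of its rotation, small uniformly in `ε` by the
  -- choice of `k`; the middle term is the smooth case for that fixed `k`.
  have hsplit : bubbleProfile χ V (φ ε) (x ε) (μ ε) - bubbleProfile χ (V ∘ O) (φ' ε) (x ε) (μ ε) =
      -bubbleProfile χ (u k - V) (φ ε) (x ε) (μ ε) +
      ((bubbleProfile χ (u k) (φ ε) (x ε) (μ ε) -
        bubbleProfile χ (u k ∘ O) (φ' ε) (x ε) (μ ε)) +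
      bubbleProfile χ ((u k - V) ∘ O) (φ' ε) (x ε) (μ ε)) := by
    have : (u k - V) ∘ O = u k ∘ O - V ∘ O := rfl
    rw [this, bubbleProfile_sub, bubbleProfile_sub]
    abel
  rw [hsplit]
  calc _ ≤ κ / 3 + (κ / 3 + κ / 3) := by
        refine (h1Norm_add_le _ _).trans (add_le_add ?_ ((h1Norm_add_le _ _).trans
          (add_le_add hsm (b2.trans hk))))
        rw [h1Norm_neg]
        exact b1
    _ = κ := by rw [← add_assoc, ENNReal.add_thirds]

end ChangeOfCharts
end BubbleFamilies
end

open Set Filter Topology MeasureTheory Bundle Manifold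
open scoped ENNReal NNReal ContDiff

noncomputable section

set_option linter.unusedSectionVars false

namespace BubbleFamilies

/-! ### Recovering the weak gradient of the model from the bubble -/

section Uniqueness

theorem enorm_integral_mul_le {α : Type*} [MeasurableSpace α] {ν : Measure α} {f g : α → ℝ}
    {p q : ℝ≥0∞} [p.HolderConjugate q] (hf : AEStronglyMeasurable f ν)
    (hg : AEStronglyMeasurable g ν) :
    ‖∫ y, f y * g y ∂ν‖ₑ ≤ eLpNorm f p ν * eLpNorm g q ν := by
  refine (enorm_integral_le_lintegral_enorm _).trans ?_
  rw [← eLpNorm_one_eq_lintegral_enorm]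
  change eLpNorm (f • g) 1 ν ≤ _
  exact eLpNorm_smul_le_mul_eLpNorm (p := p) (q := q) (r := 1) hg hf

attribute [local instance 2000] chartedSpaceSelf

variable {n : ℕ} {M : Type*} [MetricSpace M] [ChartedSpace (Euc n) M]
  [IsManifold 𝓘(ℝ, Euc n) ∞ M]
  [RiemannianBundle (fun p : M => TangentSpace 𝓘(ℝ, Euc n) p)]
  [IsContMDiffRiemannianBundle 𝓘(ℝ, Euc n) ∞ (Euc n)
      (fun p : M => TangentSpace 𝓘(ℝ, Euc n) p)]
  [MeasurableSpace M] [BorelSpace M]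

theorem ChartBounds.eLpNorm_le_comp {K : Set M} {C : ℝ≥0} {φ : OpenPartialHomeomorph M (Euc n)}
    (hφ : ChartBounds K C φ) {E : Type*} [NormedAddCommGroup E] (F : Euc n → E) {p : ℝ≥0∞}
    (hp : p ≠ 0) (hp' : p ≠ ⊤) :
    eLpNorm F p (volume.restrict (φ '' K)) ≤
      (C : ℝ≥0∞) ^ (1 / p.toReal) * eLpNorm (fun q => F (φ q)) p ((vol n).restrict K) := by
  rw [eLpNorm_eq_lintegral_rpow_enorm_toReal hp hp', eLpNorm_eq_lintegral_rpow_enorm_toReal hp hp',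
    ← ENNReal.mul_rpow_of_nonneg _ _ (by positivity)]
  gcongr
  exact hφ.le_lintegral fun y => ‖F y‖ₑ ^ p.toReal

theorem integral_comp_rescale (f : Euc n → ℝ) (b : Euc n) {m : ℝ} (hm : 0 < m) :
    ∫ y, f (m⁻¹ • (y - b)) = m ^ n * ∫ y, f y := by
  rw [integral_sub_right_eq_self (fun y => f (m⁻¹ • y)) b,
    Measure.integral_comp_inv_smul_of_nonneg volume f hm.le, finrank_euclideanSpace_fin, smul_eq_mul]

/-- The weak derivative of a model is controlled by the `H¹` norm of the bubble. -/
theorem ChartBounds.enorm_integral_mul_fderiv_le {K : Set M} {C : ℝ≥0} (hK : IsCompact K)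
    {φ : OpenPartialHomeomorph M (Euc n)} (hφ : ChartBounds K C φ) {χ : ℝ → ℝ} {p : M}
    (hχ : ∀ q ∈ K, χ (dist q p) = 1) {m : ℝ} (hm : 0 < m) {W : Euc n → ℝ}
    (hW : LocallyIntegrable W volume) {ψ : Euc n → ℝ} (hψ : ContDiff ℝ ∞ ψ)
    (hψc : HasCompactSupport ψ)
    (hsupp : ∀ y, m⁻¹ • (y - φ p) ∈ tsupport ψ → y ∈ φ '' K) {S : ℝ≥0∞}
    (hS : h1Norm n (bubbleProfile χ W φ p m) < S) (e : Euc n) :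
    ‖∫ y, W y * fderiv ℝ ψ y e‖ₑ ≤
      (C : ℝ≥0∞) ^ (1 / (2 : ℝ≥0∞).toReal) * (C * ‖e‖ₑ) * S * eLpNorm ψ 2 volume := by
  obtain ⟨v, hv, hvS⟩ : ∃ v, ∃ _ : IsH1Approx n (bubbleProfile χ W φ p m) v,
      limsup (fun k => smoothH1Norm n (v k)) atTop < S := by
    simpa [h1Norm, iInf_lt_iff] using hS
  have hKm : MeasurableSet K := hK.isClosed.measurableSet
  set s : ℝ := m ^ (-(((n : ℝ) - 2) / 2)) with hs
  -- The test function is brought to the scale of the bubble. Its support lies in `φ '' K`, and on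
  -- `K` the cutoff is 1, so there the bubble read in the chart is exactly `W'`.
  set ψ' : Euc n → ℝ := fun y => ψ (m⁻¹ • (y - φ p)) with hψ'
  set W' : Euc n → ℝ := fun y => s * W (m⁻¹ • (y - φ p)) with hW'
  have hK' : IsCompact (φ '' K) := hK.image_of_continuousOn (φ.continuousOn.mono hφ.sub)
  have hK'm := hK'.isClosed.measurableSet
  have hKt : φ '' K ⊆ φ.target := by
    rintro _ ⟨q, hq, rfl⟩
    exact φ.map_source (hφ.sub hq)
  have hψ's : ContDiff ℝ ∞ ψ' := by fun_prop
  have hψ't : tsupport ψ' ⊆ φ '' K := fun y hy => hsupp y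
    (tsupport_comp_subset_preimage ψ (f := fun y : Euc n => m⁻¹ • (y - φ p)) (by fun_prop) hy)
  have hψ'c : HasCompactSupport ψ' := hK'.of_isClosed_subset (isClosed_tsupport _) hψ't
  have hψ'd : ∀ y, fderiv ℝ ψ' y e = m⁻¹ * fderiv ℝ ψ (m⁻¹ • (y - φ p)) e := fun y => by
    have h2 : HasFDerivAt (fun y : Euc n => m⁻¹ • (y - φ p))
        (m⁻¹ • ContinuousLinearMap.id ℝ (Euc n)) y :=
      ((hasFDerivAt_id y).sub_const (φ p)).fun_const_smul m⁻¹
    have h3 := (hψ.differentiable (by simp) (m⁻¹ • (y - φ p))).hasFDerivAt.comp y h2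
    refine (congrArg (fun l : Euc n →L[ℝ] ℝ => l e) h3.fderiv).trans ?_
    simp
  have hψ'0 : ∀ y ∉ φ '' K, fderiv ℝ ψ' y e = 0 := fun y hy => by
    have h1 : fderiv ℝ ψ' y = 0 := Function.notMem_support.1 fun h =>
      hy (hψ't (support_fderiv_subset ℝ h))
    simp [h1]
  have hdc : Continuous fun y => fderiv ℝ ψ' y e :=
    (hψ's.continuous_fderiv (by simp)).clm_apply continuous_const
  have hint : Integrable fun y => W y * fderiv ℝ ψ y e :=
    hW.integrable_smul_right_of_hasCompactSupport
      ((hψ.continuous_fderiv (by simp)).clm_apply continuous_const)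
      ((hψc.fderiv (𝕜 := ℝ)).comp_left (g := fun l : Euc n →L[ℝ] ℝ => l e) rfl)
  have hprod : (fun y => W' y * fderiv ℝ ψ' y e) = fun y =>
      (s * m⁻¹) * (fun z => W z * fderiv ℝ ψ z e) (m⁻¹ • (y - φ p)) := by
    ext1 y
    simp only [hW', hψ'd]
    ring
  have hint' : Integrable fun y => W' y * fderiv ℝ ψ' y e := by
    rw [hprod]
    exact ((hint.comp_smul (inv_ne_zero hm.ne')).comp_sub_right (φ p)).const_mul _
  have hval : ∫ y, W' y * fderiv ℝ ψ' y e = (s * m⁻¹ * m ^ n) * ∫ y, W y * fderiv ℝ ψ y e := by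
    rw [hprod, integral_const_mul, integral_comp_rescale (fun z => W z * fderiv ℝ ψ z e) (φ p) hm,
      mul_assoc (s * m⁻¹)]
  -- This is also the factor by which dilation multiplies `‖ψ‖₂`. The two powers cancel at the end,
  -- leaving a bound independent of `m`.
  have hsm : s * m⁻¹ * m ^ n = m ^ ((n : ℝ) / 2) := by
    rw [hs, ← Real.rpow_neg_one, ← Real.rpow_add hm, ← Real.rpow_natCast, ← Real.rpow_add hm]
    congr 1
    ring
  have hF : ∀ k, ContDiffOn ℝ ∞ (v k ∘ φ.symm) φ.target := fun k => by
    simpa using contDiffOn_comp_chart_symm hφ.mem (hv.smooth k).contMDiffOn (U := univ)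
  have hFd : ∀ k, ∀ y ∈ φ.target, ContDiffAt ℝ ∞ (v k ∘ φ.symm) y := fun k y hy =>
    (hF k).contDiffAt (φ.open_target.mem_nhds hy)
  have hFc : ∀ f : Euc n → ℝ, (∀ y ∈ φ.target, ContinuousAt f y) →
      ∀ g : Euc n → ℝ, Continuous g → (∀ y ∉ φ '' K, g y = 0) →
      Integrable fun y => f y * g y := by
    intro f hf g hg hg0
    have hts : tsupport (fun y => f y * g y) ⊆ φ '' K := by
      refine closure_minimal (fun y hy => ?_) hK'.isClosed
      by_contra h
      exact hy (by simp [hg0 y h])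
    have hcont : Continuous fun y => f y * g y := continuous_of_tsupport fun y hy =>
      (hf y (hKt (hts hy))).mul hg.continuousAt
    exact hcont.integrable_of_hasCompactSupport
      (hK'.of_isClosed_subset (isClosed_tsupport _) hts)
  have hψ'00 : ∀ y ∉ φ '' K, ψ' y = 0 := fun y hy =>
    image_eq_zero_of_notMem_tsupport fun h => hy (hψ't h)
  have hFi : ∀ k, Integrable fun y => (v k ∘ φ.symm) y * fderiv ℝ ψ' y e := fun k =>
    hFc _ (fun y hy => (hFd k y hy).continuousAt) _ hdc hψ'0
  have hFdc : ∀ k, ∀ y ∈ φ.target, ContinuousAt (fun y => fderiv ℝ (v k ∘ φ.symm) y e) y :=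
    fun k y hy => ((hFd k y hy).fderiv_right (m := 0) (by simp)).continuousAt.clm_apply
      continuousAt_const
  have hparts : ∀ k, ∫ y, (v k ∘ φ.symm) y * fderiv ℝ ψ' y e =
      -∫ y, fderiv ℝ (v k ∘ φ.symm) y e * ψ' y := fun k =>
    integral_mul_fderiv_eq_neg_fderiv_mul_of_integrable
      (hFc _ (hFdc k) _ hψ's.continuous hψ'00) (hFi k)
      (hFc _ (fun y hy => (hFd k y hy).continuousAt) _ hψ's.continuous hψ'00)
      (fun y hy => (hFd k y (hKt (hψ't hy))).differentiableAt (by simp))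
      fun y _ => hψ's.differentiable (by simp) y
  have hrestr : ∀ f g : Euc n → ℝ, (∀ y ∉ φ '' K, g y = 0) →
      ∫ y, f y * g y = ∫ y in φ '' K, f y * g y := fun f g hg =>
    (setIntegral_eq_integral_of_forall_compl_eq_zero fun y hy => by simp [hg y hy]).symm
  have hcK : (C : ℝ≥0∞) ^ (1 / (2 : ℝ≥0∞).toReal) ≠ ⊤ := by finiteness
  -- the error made by replacing the bubble with its approximations
  have herr : ∀ k, eLpNorm (fun y => W' y - (v k ∘ φ.symm) y) 2 (volume.restrict (φ '' K)) ≤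
      (C : ℝ≥0∞) ^ (1 / (2 : ℝ≥0∞).toReal) *
        eLpNorm (v k - bubbleProfile χ W φ p m) 2 (vol n) := fun k => by
    refine (hφ.eLpNorm_le_comp _ (by norm_num) (by norm_num)).trans ?_
    gcongr
    rw [eLpNorm_sub_comm]
    refine le_trans (eLpNorm_mono_ae ?_) (eLpNorm_mono_measure _ Measure.restrict_le_self)
    filter_upwards [ae_restrict_mem hKm] with q hq
    refine le_of_eq ?_
    rw [Function.comp_apply, φ.left_inv (hφ.sub hq), Pi.sub_apply, bubbleProfile, hχ q hq, one_mul]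
  have hgrad : ∀ k, eLpNorm (fun y => fderiv ℝ (v k ∘ φ.symm) y e) 2 (volume.restrict (φ '' K)) ≤
      (C : ℝ≥0∞) ^ (1 / (2 : ℝ≥0∞).toReal) * (C * ‖e‖ₑ) * smoothH1Norm n (v k) := fun k => by
    refine (hφ.eLpNorm_le_comp _ (by norm_num) (by norm_num)).trans ?_
    rw [mul_assoc]
    gcongr
    have hCe : ‖(C : ℝ) * ‖e‖‖ₑ = C * ‖e‖ₑ := by rw [enorm_mul, enorm_norm]; simp
    rw [← hCe]
    calc _ ≤ eLpNorm (((C : ℝ) * ‖e‖) • gradNorm (n := n) (v k)) 2 ((vol n).restrict K) := by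
          refine eLpNorm_mono_ae_real ?_
          filter_upwards [ae_restrict_mem hKm] with q hq
          have h1 := abs_fderiv_le_gradNorm_mul hφ.mem (φ.map_source (hφ.sub hq))
            ((hv.smooth k).mdifferentiable (by simp) _) e
          rw [φ.left_inv (hφ.sub hq)] at h1
          refine h1.trans ?_
          rw [Pi.smul_apply, smul_eq_mul, mul_comm]
          exact mul_le_mul_of_nonneg_right (hφ.le_norm q hq e) (gradNorm_nonneg _ _)
      _ ≤ _ := by
          refine eLpNorm_const_smul_le.trans ?_
          gcongr
          exact (eLpNorm_mono_measure _ Measure.restrict_le_self).trans le_add_self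
  have hWm : AEStronglyMeasurable W' volume :=
    (hW.aestronglyMeasurable.comp_quasiMeasurePreserving
      (quasiMeasurePreserving_rescale (φ p) hm)).const_mul s
  have hFm : ∀ k, AEStronglyMeasurable (v k ∘ φ.symm) (volume.restrict (φ '' K)) := fun k =>
    ((hF k).continuousOn.mono hKt).aestronglyMeasurable hK'm
  have hFdm : ∀ k, AEStronglyMeasurable (fun y => fderiv ℝ (v k ∘ φ.symm) y e)
      (volume.restrict (φ '' K)) := fun k =>
    ContinuousOn.aestronglyMeasurable (fun y hy => (hFdc k y (hKt hy)).continuousWithinAt) hK'm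
  -- `W'` is replaced by the smooth `v k ∘ φ.symm`, for which integration by parts moves the
  -- derivative off `ψ'`. The first term, which involves the derivative of `ψ'`, vanishes as `k → ∞`
  -- with `m` fixed.
  have hmain : ∀ k, ‖∫ y, W' y * fderiv ℝ ψ' y e‖ₑ ≤
      (C : ℝ≥0∞) ^ (1 / (2 : ℝ≥0∞).toReal) *
        eLpNorm (v k - bubbleProfile χ W φ p m) 2 (vol n) *
          eLpNorm (fun y => fderiv ℝ ψ' y e) 2 volume +
      (C : ℝ≥0∞) ^ (1 / (2 : ℝ≥0∞).toReal) * (C * ‖e‖ₑ) * smoothH1Norm n (v k) *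
        eLpNorm ψ' 2 volume := fun k => by
    have h1 : ∫ y, W' y * fderiv ℝ ψ' y e =
        (∫ y in φ '' K, (W' y - (v k ∘ φ.symm) y) * fderiv ℝ ψ' y e) -
          ∫ y in φ '' K, fderiv ℝ (v k ∘ φ.symm) y e * ψ' y := by
      rw [← hrestr (fun y => W' y - (v k ∘ φ.symm) y) _ hψ'0, ← hrestr _ _ hψ'00]
      simp only [sub_mul]
      rw [integral_sub hint' (hFi k), hparts]
      ring
    rw [h1]
    refine enorm_sub_le.trans (add_le_add ?_ ?_)
    · refine (enorm_integral_mul_le (p := 2) (q := 2) (hWm.restrict.sub (hFm k))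
        hdc.aestronglyMeasurable).trans ?_
      gcongr
      · exact herr k
      · exact Measure.restrict_le_self
    · refine (enorm_integral_mul_le (p := 2) (q := 2) (hFdm k)
        hψ's.continuous.aestronglyMeasurable).trans ?_
      gcongr
      · exact hgrad k
      · exact Measure.restrict_le_self
  have hfin1 : eLpNorm (fun y => fderiv ℝ ψ' y e) 2 volume ≠ ⊤ :=
    (hdc.memLp_of_hasCompactSupport ((hψ'c.fderiv (𝕜 := ℝ)).comp_left
      (g := fun l : Euc n →L[ℝ] ℝ => l e) rfl)).2.ne
  have hlim := ENNReal.Tendsto.mul_const (b := eLpNorm (fun y => fderiv ℝ ψ' y e) 2 volume)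
    (ENNReal.Tendsto.const_mul (a := (C : ℝ≥0∞) ^ (1 / (2 : ℝ≥0∞).toReal)) hv.tendsto
      (Or.inr hcK)) (Or.inr hfin1)
  rw [mul_zero, zero_mul] at hlim
  have hfinal := ge_of_tendsto (hlim.add_const
    ((C : ℝ≥0∞) ^ (1 / (2 : ℝ≥0∞).toReal) * (C * ‖e‖ₑ) * S * eLpNorm ψ' 2 volume))
    ((eventually_lt_of_limsup_lt hvS).mono fun k hk =>
      (hmain k).trans (add_le_add le_rfl (by gcongr)))
  have hnorm : eLpNorm ψ' 2 volume = ENNReal.ofReal (m ^ ((n : ℝ) / 2)) * eLpNorm ψ 2 volume := by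
    rw [eLpNorm_comp_rescale ψ (φ p) hm (by norm_num), ENNReal.ofReal_rpow_of_pos (pow_pos hm n),
      ← Real.rpow_natCast, ← Real.rpow_mul hm.le]
    congr 3
    simp
    ring
  have hpos : 0 < m ^ ((n : ℝ) / 2) := Real.rpow_pos_of_pos hm _
  rw [zero_add, hval, hsm, enorm_mul, Real.enorm_of_nonneg hpos.le, hnorm, mul_left_comm] at hfinal
  exact (ENNReal.mul_le_mul_iff_right (ENNReal.ofReal_pos.2 hpos).ne' ENNReal.ofReal_ne_top).1
    hfinal

end Uniqueness
end BubbleFamilies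
end

open Set Filter Topology MeasureTheory Bundle Manifold
open scoped ENNReal NNReal ContDiff

noncomputable section

set_option linter.unusedSectionVars false

namespace BubbleFamilies

/-! ### Weak gradients in `D^{1,2}` -/

section WeakGradient

variable {n : ℕ}

theorem HasD12Gradient.locallyIntegrable (hn : 3 ≤ n) {W : Euc n → ℝ} {G : Euc n → Euc n}
    (h : HasD12Gradient W G) : LocallyIntegrable W volume :=
  h.memLp.locallyIntegrable (one_le_ofReal_twoStar hn)

/-- The gradient of a function of `D^{1,2}` is its weak gradient. -/
theorem HasD12Gradient.integral_inner_mul (hn : 3 ≤ n) {W : Euc n → ℝ} {G : Euc n → Euc n}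
    (h : HasD12Gradient W G) {ψ : Euc n → ℝ} (hψ : ContDiff ℝ ∞ ψ) (hψc : HasCompactSupport ψ)
    (e : Euc n) : ∫ y, inner ℝ (G y) e * ψ y = -∫ y, W y * fderiv ℝ ψ y e := by
  obtain ⟨u, hu, h1, h2⟩ := h.approx
  set p := ENNReal.ofReal (twoStar n)
  have hp := one_le_ofReal_twoStar hn
  have hpq : p.HolderConjugate p.conjExponent := ENNReal.HolderConjugate.conjExponent hp
  have hdc : Continuous fun y => fderiv ℝ ψ y e :=
    (hψ.continuous_fderiv (by simp)).clm_apply continuous_const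
  have hdcs : HasCompactSupport fun y => fderiv ℝ ψ y e :=
    (hψc.fderiv (𝕜 := ℝ)).comp_left (g := fun l : Euc n →L[ℝ] ℝ => l e) rfl
  have hud : ∀ k, Differentiable ℝ (u k) := fun k => (hu k).1.differentiable (by simp)
  have huc : ∀ k, Continuous (u k) := fun k => (hu k).1.continuous
  have hgc : ∀ k, Continuous fun y => inner ℝ (gradient (u k) y) e := fun k =>
    (continuous_gradient (hu k).1).inner continuous_const
  have hparts : ∀ k, ∫ y, inner ℝ (gradient (u k) y) e * ψ y = -∫ y, u k y * fderiv ℝ ψ y e :=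
    fun k => by
      have hg : ∀ y, inner ℝ (gradient (u k) y) e = fderiv ℝ (u k) y e := fun y => by
        simp [gradient]
      simp only [hg]
      have h3 := integral_mul_fderiv_eq_neg_fderiv_mul_of_integrable (μ := volume) (f := u k)
        (g := ψ) (v := e) ?_ ?_ ?_ (fun y _ => hud k y) fun y _ => hψ.differentiable (by simp) y
      · rw [h3, neg_neg]
      · exact (((hu k).1.continuous_fderiv (by simp)).clm_apply continuous_const |>.mul
          hψ.continuous).integrable_of_hasCompactSupport hψc.mul_left
      · exact ((huc k).mul hdc).integrable_of_hasCompactSupport hdcs.mul_left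
      · exact ((huc k).mul hψ.continuous).integrable_of_hasCompactSupport hψc.mul_left
  have hlim1 : Tendsto (fun k => ∫ y, u k y * fderiv ℝ ψ y e) atTop
      (𝓝 (∫ y, W y * fderiv ℝ ψ y e)) := by
    rw [tendsto_iff_edist_tendsto_0]
    have hb : Tendsto (fun k => eLpNorm (fun y => u k y - W y) p volume *
        eLpNorm (fun y => fderiv ℝ ψ y e) p.conjExponent volume) atTop (𝓝 0) := by
      simpa using ENNReal.Tendsto.mul_const h1
        (Or.inr (hdc.memLp_of_hasCompactSupport hdcs).2.ne)
    refine tendsto_of_tendsto_of_tendsto_of_le_of_le tendsto_const_nhds hb (fun _ => zero_le)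
      fun k => ?_
    dsimp only
    rw [edist_eq_enorm_sub, ← integral_sub]
    · simp only [← sub_mul]
      exact enorm_integral_mul_le ((huc k).aestronglyMeasurable.sub h.memLp.1)
        hdc.aestronglyMeasurable
    · exact ((huc k).mul hdc).integrable_of_hasCompactSupport hdcs.mul_left
    · exact (h.locallyIntegrable hn).integrable_smul_right_of_hasCompactSupport hdc hdcs
  have hGi : AEStronglyMeasurable (fun y => inner ℝ (G y) e) volume :=
    h.memLp_grad.1.inner aestronglyMeasurable_const
  have hlim2 : Tendsto (fun k => ∫ y, inner ℝ (gradient (u k) y) e * ψ y) atTop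
      (𝓝 (∫ y, inner ℝ (G y) e * ψ y)) := by
    rw [tendsto_iff_edist_tendsto_0]
    have hb : Tendsto (fun k => ‖e‖ₑ * eLpNorm (fun y => gradient (u k) y - G y) 2 volume *
        eLpNorm ψ 2 volume) atTop (𝓝 0) := by
      simpa using ENNReal.Tendsto.mul_const (ENNReal.Tendsto.const_mul (a := ‖e‖ₑ) h2
        (Or.inr (by finiteness))) (Or.inr (hψ.continuous.memLp_of_hasCompactSupport hψc).2.ne)
    refine tendsto_of_tendsto_of_tendsto_of_le_of_le tendsto_const_nhds hb (fun _ => zero_le)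
      fun k => ?_
    dsimp only
    rw [edist_eq_enorm_sub, ← integral_sub]
    · simp only [← sub_mul, ← inner_sub_left]
      refine (enorm_integral_mul_le (p := 2) (q := 2)
        (((continuous_gradient (hu k).1).aestronglyMeasurable.sub h.memLp_grad.1).inner
          aestronglyMeasurable_const) hψ.continuous.aestronglyMeasurable).trans ?_
      gcongr
      rw [← enorm_norm e]
      refine le_trans (eLpNorm_mono_real fun y => ?_) (eLpNorm_const_smul_le (c := ‖e‖)
        (f := fun y => ‖gradient (u k) y - G y‖) |>.trans_eq (by rw [eLpNorm_norm]))
      rw [Pi.smul_apply, smul_eq_mul, mul_comm]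
      exact norm_inner_le_norm _ _
    · exact ((hgc k).mul hψ.continuous).integrable_of_hasCompactSupport hψc.mul_left
    · have hloc : LocallyIntegrable (fun y => inner ℝ (G y) e) volume := by
        have h3 : MemLp (fun y => inner ℝ (G y) e) 2 volume := h.memLp_grad.inner_const e
        exact h3.locallyIntegrable (by norm_num)
      exact hloc.integrable_smul_right_of_hasCompactSupport hψ.continuous hψc
  simp only [hparts] at hlim2
  exact tendsto_nhds_unique hlim2 hlim1.neg

/-- A function of `D^{1,2}` with vanishing gradient vanishes. -/
theorem HasD12Gradient.ae_eq_zero (hn : 3 ≤ n) {W : Euc n → ℝ} {G : Euc n → Euc n}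
    (h : HasD12Gradient W G) (hG : G =ᵐ[volume] 0) : W =ᵐ[volume] 0 := by
  obtain ⟨u, hu, h1, h2⟩ := h.approx
  have hn' : (3 : ℝ) ≤ n := by exact_mod_cast hn
  have hq := twoStar_pos hn
  have h3 : Tendsto (fun k => eLpNorm (fderiv ℝ (u k)) 2 volume) atTop (𝓝 0) := by
    refine h2.congr fun k => eLpNorm_congr_norm_ae ?_
    filter_upwards [hG] with y hy
    rw [hy, Pi.zero_apply, sub_zero, norm_gradient_eq]
  -- The Sobolev inequality for smooth compactly supported functions, with the exponents 2 and `2⋆`.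
  -- Constants are thus excluded as limits of `u k`.
  have h4 : Tendsto (fun k => eLpNorm (u k) (ENNReal.ofReal (twoStar n)) volume) atTop (𝓝 0) := by
    have hb := ENNReal.Tendsto.const_mul
      (a := (eLpNormLESNormFDerivOfEqInnerConst (volume : Measure (Euc n)) ((2 : ℝ≥0) : ℝ) : ℝ≥0∞))
      h3 (Or.inr (by finiteness))
    rw [mul_zero] at hb
    refine tendsto_of_tendsto_of_tendsto_of_le_of_le tendsto_const_nhds hb (fun _ => zero_le)
      fun k => ?_
    refine eLpNorm_le_eLpNorm_fderiv_of_eq_inner volume ((hu k).1.of_le (by simp)) (hu k).2 (p := 2)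
      (p' := (twoStar n).toNNReal) (by norm_num) ?_ ?_
    · rw [finrank_euclideanSpace_fin]
      omega
    · rw [Real.coe_toNNReal _ hq.le, finrank_euclideanSpace_fin, twoStar]
      push_cast
      field_simp
  have h5 : eLpNorm W (ENNReal.ofReal (twoStar n)) volume ≤ 0 := by
    refine ge_of_tendsto (by simpa using h4.add h1) (Eventually.of_forall fun k => ?_)
    have := eLpNorm_sub_le (hu k).1.continuous.aestronglyMeasurable
      ((hu k).1.continuous.aestronglyMeasurable.sub h.memLp.1) (one_le_ofReal_twoStar hn)
    rwa [sub_sub_cancel] at this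
  exact (eLpNorm_eq_zero_iff h.memLp.1 (by simpa using hq)).1 (le_antisymm h5 bot_le)

end WeakGradient

/-! ### Models with vanishing bubbles -/

section Vanishing

attribute [local instance 2000] chartedSpaceSelf

variable {n : ℕ} {M : Type*} [MetricSpace M] [ChartedSpace (Euc n) M]
  [IsManifold 𝓘(ℝ, Euc n) ∞ M]
  [RiemannianBundle (fun p : M => TangentSpace 𝓘(ℝ, Euc n) p)]
  [IsContMDiffRiemannianBundle 𝓘(ℝ, Euc n) ∞ (Euc n)
      (fun p : M => TangentSpace 𝓘(ℝ, Euc n) p)]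
  [IsRiemannianManifold 𝓘(ℝ, Euc n) M] [MeasurableSpace M] [BorelSpace M]

/-- A model whose bubbles vanish asymptotically in `H¹` is zero. -/
theorem ae_eq_zero_of_tendstoZeroH1_bubbleProfile (hn : 3 ≤ n) {r : ℝ} (hr : 0 < r)
    {χ : ℝ → ℝ} (hχ1 : ∀ t, |t| ≤ r / 2 → χ t = 1) {x₀ : M} {x : ℝ → M}
    (hx : Tendsto x (𝓝[>] (0 : ℝ)) (𝓝 x₀)) {μ : ℝ → ℝ} (hμ_pos : ∀ ε, 0 < ε → 0 < μ ε)
    (hμ : Tendsto μ (𝓝[>] (0 : ℝ)) (𝓝 0)) {φ : ℝ → OpenPartialHomeomorph M (Euc n)}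
    (h : IsNormalChartFamily r x₀ x φ) {W : Euc n → ℝ} {G : Euc n → Euc n}
    (hW : HasD12Gradient W G)
    (hz : TendstoZeroH1 n (fun ε => bubbleProfile χ W (φ ε) (x ε) (μ ε))) :
    W =ᵐ[volume] 0 := by
  obtain ⟨U, hU, hc⟩ := h.exists_convergingCharts
  have hr4 : 0 < r / 4 := by positivity
  -- `K` lies within `r / 4` of `x₀`, hence within `r / 2` of `x ε` for small `ε`, where the cutoff
  -- equals 1.
  obtain ⟨K, hK, hxK, hKU⟩ := (hc.mono (hc.isOpen.inter Metric.isOpen_ball)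
    inter_subset_left).exists_compact_mem_nhds (p := x₀)
    ⟨hU (Metric.mem_closedBall_self hr.le), Metric.mem_ball_self hr4⟩
  obtain ⟨C, -, hC⟩ := hc.exists_chartBounds hK (hKU.trans inter_subset_left)
  obtain ⟨δ, hδ, hball⟩ := hc.exists_ball_subset_image hK (hKU.trans inter_subset_left) hx
    (mem_interior_iff_mem_nhds.2 hxK)
  have hweak : ∀ ψ : Euc n → ℝ, ContDiff ℝ ∞ ψ → HasCompactSupport ψ → ∀ e,
      ∫ y, W y * fderiv ℝ ψ y e = 0 := by
    intro ψ hψ hψc e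
    obtain ⟨R, hR⟩ := hψc.isCompact.isBounded.subset_closedBall (0 : Euc n)
    have hRμ : Tendsto (fun ε => R * μ ε) (𝓝[>] (0 : ℝ)) (𝓝 0) := by simpa using hμ.const_mul R
    set c : ℝ≥0∞ := (C : ℝ≥0∞) ^ (1 / (2 : ℝ≥0∞).toReal) * (C * ‖e‖ₑ)
    have hψn : eLpNorm ψ 2 volume ≠ ⊤ := (hψ.continuous.memLp_of_hasCompactSupport hψc).2.ne
    have hc' : c ≠ ⊤ := by finiteness
    have hbound : ∀ S : ℝ≥0∞, 0 < S →
        ‖∫ y, W y * fderiv ℝ ψ y e‖ₑ ≤ c * S * eLpNorm ψ 2 volume := by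
      intro S hS
      have hxr : ∀ᶠ ε in 𝓝[>] (0 : ℝ), dist (x ε) x₀ < r / 4 := Metric.tendsto_nhds.1 hx _ hr4
      -- The left side does not involve `ε` and the constant does not depend on the scale, so a
      -- single parameter with norm below `S` suffices.
      obtain ⟨ε, hCε, hbε, hRε, hSε, hxε, hε⟩ := (hC.and (hball.and
        ((hRμ.eventually_lt_const hδ).and ((hz.eventually_lt_const hS).and
          (hxr.and ConvergingCharts.eventually_pos))))).exists
      have hm := hμ_pos ε hε
      refine hCε.enorm_integral_mul_fderiv_le hK (fun q hq => hχ1 _ ?_) hm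
        (hW.locallyIntegrable hn) hψ hψc (fun y hy => hbε ?_) hSε e
      · rw [abs_of_nonneg dist_nonneg]
        have h1 := Metric.mem_ball.1 (hKU hq).2
        have h3 := dist_triangle_right q (x ε) x₀
        linarith
      · have h1 := mem_closedBall_zero_iff.1 (hR hy)
        rw [norm_smul, norm_inv, Real.norm_of_nonneg hm.le, inv_mul_le_iff₀ hm] at h1
        rw [mem_ball_iff_norm]
        linarith
    have hlim : Tendsto (fun S : ℝ≥0∞ => c * S * eLpNorm ψ 2 volume) (𝓝[>] 0) (𝓝 0) := by
      have h1 := ENNReal.Tendsto.mul_const (b := eLpNorm ψ 2 volume)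
        (ENNReal.Tendsto.const_mul (a := c) (tendsto_id (x := 𝓝 (0 : ℝ≥0∞))) (Or.inr hc'))
        (Or.inr hψn)
      rw [mul_zero, zero_mul] at h1
      exact h1.mono_left nhdsWithin_le_nhds
    have := ge_of_tendsto hlim (eventually_mem_nhdsWithin.mono hbound)
    simpa using this
  refine hW.ae_eq_zero hn ?_
  have hcoord : ∀ i : Fin n, ∀ᵐ y, inner ℝ (G y) (EuclideanSpace.single i (1 : ℝ)) = 0 := by
    intro i
    have h3 : MemLp (fun y => inner ℝ (G y) (EuclideanSpace.single i (1 : ℝ))) 2 volume :=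
      hW.memLp_grad.inner_const _
    refine ae_eq_zero_of_integral_contDiff_smul_eq_zero (h3.locallyIntegrable (by norm_num))
      fun ψ hψ hψc => ?_
    have h4 := hW.integral_inner_mul hn hψ hψc (EuclideanSpace.single i 1)
    rw [hweak ψ hψ hψc, neg_zero] at h4
    simpa [mul_comm] using h4
  filter_upwards [ae_all_iff.2 hcoord] with y hy
  ext i
  simpa [EuclideanSpace.inner_single_right] using hy i

end Vanishing
end BubbleFamilies
end

open Set Filter Topology MeasureTheory Bundle Manifold
open scoped ENNReal NNReal ContDiff

noncomputable section

set_option linter.unusedSectionVars false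

namespace BubbleFamilies

/-! ### Second derivatives at critical points -/

section SecondDerivatives

variable {n : ℕ} {f h : Euc n → ℝ} {y : Euc n}

theorem eventually_differentiableAt (hf : ContDiffAt ℝ 2 f y) :
    ∀ᶠ z in 𝓝 y, DifferentiableAt ℝ f z :=
  (hf.eventually (by simp)).mono fun _ hz => hz.differentiableAt (by simp)

theorem differentiableAt_fderiv (hf : ContDiffAt ℝ 2 f y) : DifferentiableAt ℝ (fderiv ℝ f) y :=
  (hf.fderiv_right (m := 1) (by norm_num)).differentiableAt (by simp)

theorem fderiv_fderiv_apply (hf : ContDiffAt ℝ 2 f y) (a b : Euc n) :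
    fderiv ℝ (fun z => fderiv ℝ f z b) y a = fderiv ℝ (fderiv ℝ f) y a b := by
  have h1 := (differentiableAt_fderiv hf).hasFDerivAt.clm_apply (hasFDerivAt_const b y)
  rw [h1.fderiv]
  simp

theorem fderiv_fderiv_comm (hf : ContDiffAt ℝ 2 f y) (a b : Euc n) :
    fderiv ℝ (fderiv ℝ f) y a b = fderiv ℝ (fderiv ℝ f) y b a :=
  (hf.isSymmSndFDerivAt (by simp)).eq a b

/-- The cross terms of the Leibniz rule contain first derivatives, which vanish at `y`. -/
theorem fderiv_fderiv_mul (hf : ContDiffAt ℝ 2 f y) (hh : ContDiffAt ℝ 2 h y)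
    (hf0 : fderiv ℝ f y = 0) (hh0 : fderiv ℝ h y = 0) (a b : Euc n) :
    fderiv ℝ (fderiv ℝ fun z => f z * h z) y a b =
      f y * fderiv ℝ (fderiv ℝ h) y a b + h y * fderiv ℝ (fderiv ℝ f) y a b := by
  have h1 : fderiv ℝ (fun z => f z * h z) =ᶠ[𝓝 y] fun z =>
      f z • fderiv ℝ h z + h z • fderiv ℝ f z := by
    filter_upwards [eventually_differentiableAt hf, eventually_differentiableAt hh] with z hz hz'
    exact fderiv_fun_mul hz hz'
  have h2 := ((hf.differentiableAt (by simp)).hasFDerivAt.smul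
    (differentiableAt_fderiv hh).hasFDerivAt).add
    ((hh.differentiableAt (by simp)).hasFDerivAt.smul (differentiableAt_fderiv hf).hasFDerivAt)
  rw [h1.fderiv_eq]
  refine (congrArg (fun l : Euc n →L[ℝ] Euc n →L[ℝ] ℝ => l a b) h2.fderiv).trans ?_
  simp [hf0, hh0]

theorem fderiv_mul_eq_zero (hf : DifferentiableAt ℝ f y) (hh : DifferentiableAt ℝ h y)
    (hf0 : fderiv ℝ f y = 0) (hh0 : fderiv ℝ h y = 0) : fderiv ℝ (fun z => f z * h z) y = 0 := by
  rw [fderiv_fun_mul hf hh, hf0, hh0, smul_zero, smul_zero, add_zero]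

theorem fderiv_fderiv_sum {ι : Type*} (s : Finset ι) {F : ι → Euc n → ℝ}
    (hF : ∀ i ∈ s, ContDiffAt ℝ 2 (F i) y) (a b : Euc n) :
    fderiv ℝ (fderiv ℝ fun z => ∑ i ∈ s, F i z) y a b =
      ∑ i ∈ s, fderiv ℝ (fderiv ℝ (F i)) y a b := by
  have h1 : fderiv ℝ (fun z => ∑ i ∈ s, F i z) =ᶠ[𝓝 y] fun z => ∑ i ∈ s, fderiv ℝ (F i) z := by
    filter_upwards [(eventually_all_finset s).2 fun i hi => eventually_differentiableAt (hF i hi)]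
      with z hz
    exact fderiv_fun_sum hz
  rw [h1.fderiv_eq, fderiv_fun_sum fun i hi => differentiableAt_fderiv (hF i hi)]
  simp

theorem fderiv_fderiv_const_mul (hf : ContDiffAt ℝ 2 f y) (c : ℝ) (a b : Euc n) :
    fderiv ℝ (fderiv ℝ fun z => c * f z) y a b = c * fderiv ℝ (fderiv ℝ f) y a b := by
  have h1 : fderiv ℝ (fun z => c * f z) =ᶠ[𝓝 y] fun z => c • fderiv ℝ f z := by
    filter_upwards [eventually_differentiableAt hf] with z hz
    exact fderiv_const_mul hz c
  rw [h1.fderiv_eq, fderiv_fun_const_smul (differentiableAt_fderiv hf)]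
  simp

/-- The Hessian of a composition at a critical point. -/
theorem fderiv_fderiv_comp {T : Euc n → Euc n} (hT : ContDiffAt ℝ 2 T y)
    (hf : ContDiffAt ℝ 2 f (T y)) (hf0 : fderiv ℝ f (T y) = 0) (a b : Euc n) :
    fderiv ℝ (fderiv ℝ fun z => f (T z)) y a b =
      fderiv ℝ (fderiv ℝ f) (T y) (fderiv ℝ T y a) (fderiv ℝ T y b) := by
  have hcomp : ContDiffAt ℝ 2 (fun z => f (T z)) y := hf.comp y hT
  have hTd : ∀ᶠ z in 𝓝 y, DifferentiableAt ℝ T z :=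
    (hT.eventually (by simp)).mono fun _ hz => hz.differentiableAt (by simp)
  have h1 : (fun z => fderiv ℝ (fun z => f (T z)) z b) =ᶠ[𝓝 y] fun z =>
      fderiv ℝ f (T z) (fderiv ℝ T z b) := by
    filter_upwards [hT.continuousAt.eventually (eventually_differentiableAt hf), hTd] with z hz hz'
    have h2 := (hz.hasFDerivAt.comp z hz'.hasFDerivAt).fderiv
    exact congrArg (fun l : Euc n →L[ℝ] ℝ => l b) h2
  have h3 : HasFDerivAt (fderiv ℝ T) (fderiv ℝ (fderiv ℝ T) y) y :=
    ((hT.fderiv_right (m := 1) (by norm_num)).differentiableAt (by simp)).hasFDerivAt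
  have h4 := ((differentiableAt_fderiv hf).hasFDerivAt.comp y
    (hT.differentiableAt (by simp)).hasFDerivAt).clm_apply
      (h3.clm_apply (hasFDerivAt_const b y))
  rw [← fderiv_fderiv_apply hcomp, h1.fderiv_eq]
  refine (congrArg (fun l : Euc n →L[ℝ] ℝ => l a) h4.fderiv).trans ?_
  simp [hf0]

theorem fderiv_fderiv_congr {f g : Euc n → ℝ} (hfg : f =ᶠ[𝓝 y] g) :
    fderiv ℝ (fderiv ℝ f) y = fderiv ℝ (fderiv ℝ g) y :=
  hfg.fderiv.fderiv_eq

/-- The Hessian of a partial derivative is symmetric in its three arguments. -/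
theorem fderiv_fderiv_fderiv_comm (hf : ContDiffAt ℝ 3 f y) (a b v : Euc n) :
    fderiv ℝ (fderiv ℝ fun z => fderiv ℝ f z v) y a b =
      fderiv ℝ (fderiv ℝ fun z => fderiv ℝ f z b) y a v := by
  have h0 : ∀ᶠ z in 𝓝 y, ContDiffAt ℝ 2 f z :=
    (hf.eventually (by simp)).mono fun _ hz => hz.of_le (by norm_num)
  have hP : ∀ v, ContDiffAt ℝ 2 (fun z => fderiv ℝ f z v) y := fun v =>
    (hf.fderiv_right (m := 2) (by norm_num)).clm_apply contDiffAt_const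
  rw [← fderiv_fderiv_apply (hP v), ← fderiv_fderiv_apply (hP b)]
  have h1 : (fun z => fderiv ℝ (fun z => fderiv ℝ f z v) z b) =ᶠ[𝓝 y] fun z =>
      fderiv ℝ (fun z => fderiv ℝ f z b) z v := by
    filter_upwards [h0] with z hz
    rw [fderiv_fderiv_apply hz, fderiv_fderiv_apply hz, fderiv_fderiv_comm hz]
  rw [h1.fderiv_eq]

end SecondDerivatives

/-! ### Curvature at a normal point -/

section NormalCurvature

variable {n : ℕ}

/-- A matrix-valued function which is `1` to first order at `y`. -/
structure MetricNormalAt (g : Euc n → Matrix (Fin n) (Fin n) ℝ) (y : Euc n) : Prop where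
  smooth : ∀ i j, ContDiffAt ℝ 2 (fun z => g z i j) y
  eq_one : g y = 1
  fderiv_eq : ∀ i j, fderiv ℝ (fun z => g z i j) y = 0

/-- The second derivatives `∂_a ∂_b g(v, w)`. -/
def metricHess (g : Euc n → Matrix (Fin n) (Fin n) ℝ) (y a b v w : Euc n) : ℝ :=
  ∑ i, ∑ j, v i * w j * fderiv ℝ (fderiv ℝ fun z => g z i j) y a b

/-- The Riemann tensor at a normal point, as a function of four vectors. -/
def normalRm (g : Euc n → Matrix (Fin n) (Fin n) ℝ) (y i j k l : Euc n) : ℝ :=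
  (1 / 2) * (metricHess g y k j l i - metricHess g y k i l j - metricHess g y l j k i +
    metricHess g y l i k j)

/-- The Ricci tensor at a normal point. -/
def normalRic (g : Euc n → Matrix (Fin n) (Fin n) ℝ) (y j l : Euc n) : ℝ :=
  ∑ i, normalRm g y (EuclideanSpace.single i 1) j (EuclideanSpace.single i 1) l

/-- The scalar curvature at a normal point. -/
def normalScal (g : Euc n → Matrix (Fin n) (Fin n) ℝ) (y : Euc n) : ℝ :=
  ∑ i, normalRic g y (EuclideanSpace.single i 1) (EuclideanSpace.single i 1)

/-- The Weyl tensor at a normal point, as a function of four vectors. -/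
def normalWeyl (g : Euc n → Matrix (Fin n) (Fin n) ℝ) (y i j k l : Euc n) : ℝ :=
  normalRm g y i j k l
    - (1 / ((n : ℝ) - 2)) *
        (normalRic g y i k * inner ℝ j l - normalRic g y i l * inner ℝ j k
          + normalRic g y j l * inner ℝ i k - normalRic g y j k * inner ℝ i l)
    + normalScal g y / (((n : ℝ) - 1) * ((n : ℝ) - 2)) *
        (inner ℝ i k * inner ℝ j l - inner ℝ i l * inner ℝ j k)

variable {g : Euc n → Matrix (Fin n) (Fin n) ℝ} {y : Euc n}

theorem MetricNormalAt.continuousAt (hg : MetricNormalAt g y) : ContinuousAt g y :=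
  continuousAt_pi.2 fun i => continuousAt_pi.2 fun j => (hg.smooth i j).continuousAt

theorem MetricNormalAt.inv_continuousAt (hg : MetricNormalAt g y) (i j : Fin n) :
    ContinuousAt (fun z => (g z)⁻¹ i j) y := by
  have h1 : ContinuousAt (fun z => (g z).det) y :=
    (Continuous.matrix_det continuous_id).continuousAt.comp hg.continuousAt
  have h2 : ContinuousAt (fun z => (g z).adjugate i j) y :=
    ((Continuous.matrix_adjugate continuous_id).matrix_elem i j).continuousAt.comp hg.continuousAt
  have h3 : ContinuousAt (fun z => ((g z).det)⁻¹ * (g z).adjugate i j) y :=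
    (h1.inv₀ (by simp [hg.eq_one])).mul h2
  refine h3.congr (Eventually.of_forall fun z => ?_)
  simp [Matrix.inv_def]

/-- Where `h` vanishes, continuity of the other factor is enough. This is applied to Christoffel
symbols, with `f` an entry of the inverse metric, whose derivatives then never appear. -/
theorem hasFDerivAt_mul_of_eq_zero {f h : Euc n → ℝ} {h' : Euc n →L[ℝ] ℝ} (hf : ContinuousAt f y)
    (hh : HasFDerivAt h h' y) (h0 : h y = 0) : HasFDerivAt (fun z => f z * h z) (f y • h') y := by
  rw [hasFDerivAt_iff_isLittleO] at hh ⊢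
  have h1 : (fun z => f z * (h z - h y - h' (z - y))) =o[𝓝 y] fun z => z - y := by
    simpa using (hf.isBigO_one ℝ).mul_isLittleO hh.norm_right
  have h2 : (fun z => (f z - f y) * h' (z - y)) =o[𝓝 y] fun z => z - y := by
    have h3 : (fun z => f z - f y) =o[𝓝 y] fun _ => (1 : ℝ) := by
      rw [Asymptotics.isLittleO_one_iff]
      simpa using hf.tendsto.sub_const (f y)
    have h4 : (fun z => h' (z - y)) =O[𝓝 y] fun z => ‖z - y‖ :=
      (h'.isBigO_comp _ _).norm_right
    simpa using h3.mul_isBigO h4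
  refine (h1.add h2).congr_left fun z => ?_
  simp only [h0, _root_.smul_apply, smul_eq_mul]
  ring

theorem MetricNormalAt.pd_eq_zero (hg : MetricNormalAt g y) (i j k : Fin n) :
    pd k (fun z => g z i j) y = 0 := by
  simp [pd, hg.fderiv_eq]

theorem MetricNormalAt.christoffel_eq_zero (hg : MetricNormalAt g y) (k i j : Fin n) :
    christoffel g k i j y = 0 := by
  simp [christoffel, hg.pd_eq_zero]

theorem MetricNormalAt.pd_christoffel (hg : MetricNormalAt g y) (s k i j : Fin n) :
    pd s (christoffel g k i j) y = (1 / 2) *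
      (pd s (pd i fun z => g z j k) y + pd s (pd j fun z => g z i k) y -
        pd s (pd k fun z => g z i j) y) := by
  have hd : ∀ a b c, HasFDerivAt (pd c fun z => g z a b)
      (fderiv ℝ (pd c fun z => g z a b) y) y := fun a b c =>
    ((differentiableAt_fderiv (hg.smooth a b)).clm_apply
      (differentiableAt_const _)).hasFDerivAt
  have h1 := HasFDerivAt.fun_sum (u := Finset.univ) fun l _ =>
    hasFDerivAt_mul_of_eq_zero (hg.inv_continuousAt k l)
      (((hd j l i).add (hd i l j)).sub (hd i j l)) (by simp [hg.pd_eq_zero])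
  have h2 := (h1.const_mul (1 / 2)).fderiv
  refine (congrArg (fun l : Euc n →L[ℝ] ℝ => l (EuclideanSpace.single s 1)) h2).trans ?_
  simp only [hg.eq_one, inv_one, Matrix.one_apply, _root_.smul_apply, smul_eq_mul,
    _root_.sum_apply, ite_mul, one_mul, zero_mul, Finset.sum_ite_eq,
    Finset.mem_univ, if_true]
  rfl

theorem metricHess_single (g : Euc n → Matrix (Fin n) (Fin n) ℝ) (y a b : Euc n) (i j : Fin n) :
    metricHess g y a b (EuclideanSpace.single i 1) (EuclideanSpace.single j 1) =
      fderiv ℝ (fderiv ℝ fun z => g z i j) y a b := by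
  simp [metricHess]

/-- The Christoffel symbols vanish at `y`, and so do their products; in the difference of their
derivatives the terms `∂ₖ∂ₗ g_{ij}` cancel by symmetry, leaving four second derivatives. -/
theorem MetricNormalAt.riemann_eq (hg : MetricNormalAt g y) (i j k l : Fin n) :
    riemann g i j k l y = normalRm g y (EuclideanSpace.single i 1) (EuclideanSpace.single j 1)
      (EuclideanSpace.single k 1) (EuclideanSpace.single l 1) := by
  have hpd : ∀ a b s t, pd s (pd t fun z => g z a b) y =
      fderiv ℝ (fderiv ℝ fun z => g z a b) y (EuclideanSpace.single s 1)
        (EuclideanSpace.single t 1) := fun a b s t =>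
    fderiv_fderiv_apply (hg.smooth a b) _ _
  simp only [riemann, riemannUp, hg.christoffel_eq_zero, hg.pd_christoffel, hg.eq_one,
    Matrix.one_apply, mul_zero, sub_zero, Finset.sum_const_zero, add_zero, ite_mul, one_mul,
    zero_mul, Finset.sum_ite_eq, Finset.mem_univ, if_true, normalRm, metricHess_single, hpd]
  rw [fderiv_fderiv_comm (hg.smooth j i) (EuclideanSpace.single l 1)]
  ring

theorem MetricNormalAt.ricci_eq (hg : MetricNormalAt g y) (j l : Fin n) :
    ricci g j l y = normalRic g y (EuclideanSpace.single j 1) (EuclideanSpace.single l 1) := by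
  simp [ricci, normalRic, hg.eq_one, Matrix.one_apply, hg.riemann_eq]

theorem MetricNormalAt.scalarCurv_eq (hg : MetricNormalAt g y) :
    scalarCurv g y = normalScal g y := by
  simp [scalarCurv, normalScal, hg.eq_one, Matrix.one_apply, hg.ricci_eq]

theorem MetricNormalAt.weyl_eq (hg : MetricNormalAt g y) (i j k l : Fin n) :
    weyl g i j k l y = normalWeyl g y (EuclideanSpace.single i 1) (EuclideanSpace.single j 1)
      (EuclideanSpace.single k 1) (EuclideanSpace.single l 1) := by
  have h1 : ∀ a b : Fin n, inner ℝ (EuclideanSpace.single a (1 : ℝ) : Euc n)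
      (EuclideanSpace.single b 1) = if a = b then 1 else 0 := fun a b => by
    simp [EuclideanSpace.inner_single_left]
  simp only [weyl, normalWeyl, hg.riemann_eq, hg.ricci_eq, hg.scalarCurv_eq, hg.eq_one,
    Matrix.one_apply, h1]

end NormalCurvature
end BubbleFamilies
end

open Set Filter Topology MeasureTheory Bundle Manifold
open scoped ENNReal NNReal ContDiff

noncomputable section

set_option linter.unusedSectionVars false

namespace BubbleFamilies

/-! ### Transformation of curvature under a change of normal charts -/

section TensorTransformation

variable {n : ℕ} (g g' : Euc n → Matrix (Fin n) (Fin n) ℝ) (y y' : Euc n)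

/-- Linearity in each slot, here and for the curvature tensors below, allows expansion in the
standard basis and hence invariance of traces under isometries. -/
theorem isLinearMap_metricHess_fst (b v w : Euc n) :
    IsLinearMap ℝ fun a => metricHess g y a b v w := by
  constructor <;> intros <;>
    simp [metricHess, mul_add, Finset.sum_add_distrib, Finset.mul_sum, mul_left_comm]

theorem isLinearMap_metricHess_snd (a v w : Euc n) :
    IsLinearMap ℝ fun b => metricHess g y a b v w := by
  constructor <;> intros <;>
    simp [metricHess, mul_add, Finset.sum_add_distrib, Finset.mul_sum, mul_left_comm]

theorem isLinearMap_metricHess_trd (a b w : Euc n) :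
    IsLinearMap ℝ fun v => metricHess g y a b v w := by
  constructor <;> intros <;>
    simp [metricHess, add_mul, Finset.sum_add_distrib, Finset.mul_sum, mul_assoc]

theorem isLinearMap_metricHess_fth (a b v : Euc n) :
    IsLinearMap ℝ fun w => metricHess g y a b v w := by
  constructor <;> intros <;>
    simp [metricHess, mul_add, add_mul, Finset.sum_add_distrib, Finset.mul_sum, mul_assoc,
      mul_left_comm]

theorem isLinearMap_normalRm_fst (j k l : Euc n) :
    IsLinearMap ℝ fun i => normalRm g y i j k l := by
  constructor <;> intros <;>
    simp only [normalRm, (isLinearMap_metricHess_snd g y _ _ _).map_add,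
      (isLinearMap_metricHess_fth g y _ _ _).map_add,
      (isLinearMap_metricHess_snd g y _ _ _).map_smul,
      (isLinearMap_metricHess_fth g y _ _ _).map_smul, smul_eq_mul] <;> ring

theorem isLinearMap_normalRm_snd (i k l : Euc n) :
    IsLinearMap ℝ fun j => normalRm g y i j k l := by
  constructor <;> intros <;>
    simp only [normalRm, (isLinearMap_metricHess_snd g y _ _ _).map_add,
      (isLinearMap_metricHess_fth g y _ _ _).map_add,
      (isLinearMap_metricHess_snd g y _ _ _).map_smul,
      (isLinearMap_metricHess_fth g y _ _ _).map_smul, smul_eq_mul] <;> ring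

theorem isLinearMap_normalRm_trd (i j l : Euc n) :
    IsLinearMap ℝ fun k => normalRm g y i j k l := by
  constructor <;> intros <;>
    simp only [normalRm, (isLinearMap_metricHess_fst g y _ _ _).map_add,
      (isLinearMap_metricHess_trd g y _ _ _).map_add,
      (isLinearMap_metricHess_fst g y _ _ _).map_smul,
      (isLinearMap_metricHess_trd g y _ _ _).map_smul, smul_eq_mul] <;> ring

theorem isLinearMap_normalRm_fth (i j k : Euc n) :
    IsLinearMap ℝ fun l => normalRm g y i j k l := by
  constructor <;> intros <;>
    simp only [normalRm, (isLinearMap_metricHess_fst g y _ _ _).map_add,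
      (isLinearMap_metricHess_trd g y _ _ _).map_add,
      (isLinearMap_metricHess_fst g y _ _ _).map_smul,
      (isLinearMap_metricHess_trd g y _ _ _).map_smul, smul_eq_mul] <;> ring

theorem isLinearMap_normalRic_fst (l : Euc n) : IsLinearMap ℝ fun j => normalRic g y j l := by
  constructor <;> intros <;>
    simp only [normalRic, (isLinearMap_normalRm_snd g y _ _ _).map_add,
      (isLinearMap_normalRm_snd g y _ _ _).map_smul, Finset.sum_add_distrib, Finset.smul_sum]

theorem isLinearMap_normalRic_snd (j : Euc n) : IsLinearMap ℝ fun l => normalRic g y j l := by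
  constructor <;> intros <;>
    simp only [normalRic, (isLinearMap_normalRm_fth g y _ _ _).map_add,
      (isLinearMap_normalRm_fth g y _ _ _).map_smul, Finset.sum_add_distrib, Finset.smul_sum]

theorem isLinearMap_normalWeyl_fst (j k l : Euc n) :
    IsLinearMap ℝ fun i => normalWeyl g y i j k l := by
  constructor <;> intros <;>
    simp only [normalWeyl, (isLinearMap_normalRm_fst g y _ _ _).map_add,
      (isLinearMap_normalRm_fst g y _ _ _).map_smul, (isLinearMap_normalRic_fst g y _).map_add,
      (isLinearMap_normalRic_fst g y _).map_smul, inner_add_left, real_inner_smul_left,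
      smul_eq_mul] <;> ring

theorem isLinearMap_normalWeyl_snd (i k l : Euc n) :
    IsLinearMap ℝ fun j => normalWeyl g y i j k l := by
  constructor <;> intros <;>
    simp only [normalWeyl, (isLinearMap_normalRm_snd g y _ _ _).map_add,
      (isLinearMap_normalRm_snd g y _ _ _).map_smul, (isLinearMap_normalRic_fst g y _).map_add,
      (isLinearMap_normalRic_fst g y _).map_smul, inner_add_left, real_inner_smul_left,
      smul_eq_mul] <;> ring

theorem isLinearMap_normalWeyl_trd (i j l : Euc n) :
    IsLinearMap ℝ fun k => normalWeyl g y i j k l := by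
  constructor <;> intros <;>
    simp only [normalWeyl, (isLinearMap_normalRm_trd g y _ _ _).map_add,
      (isLinearMap_normalRm_trd g y _ _ _).map_smul, (isLinearMap_normalRic_snd g y _).map_add,
      (isLinearMap_normalRic_snd g y _).map_smul, inner_add_right, real_inner_smul_right,
      smul_eq_mul] <;> ring

theorem isLinearMap_normalWeyl_fth (i j k : Euc n) :
    IsLinearMap ℝ fun l => normalWeyl g y i j k l := by
  constructor <;> intros <;>
    simp only [normalWeyl, (isLinearMap_normalRm_fth g y _ _ _).map_add,
      (isLinearMap_normalRm_fth g y _ _ _).map_smul, (isLinearMap_normalRic_snd g y _).map_add,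
      (isLinearMap_normalRic_snd g y _).map_smul, inner_add_right, real_inner_smul_right,
      smul_eq_mul] <;> ring

theorem IsLinearMap.eq_sum_single {f : Euc n → ℝ} (hf : IsLinearMap ℝ f) (v : Euc n) :
    f v = ∑ i, v i * f (EuclideanSpace.single i 1) := by
  have h1 := congrArg hf.mk' ((EuclideanSpace.basisFun (Fin n) ℝ).sum_repr v)
  simpa using h1.symm

/-- The trace of a bilinear form is invariant under isometries. -/
theorem sum_apply_isometry {B : Euc n → Euc n → ℝ} (h1 : ∀ w, IsLinearMap ℝ fun v => B v w)
    (h2 : ∀ v, IsLinearMap ℝ (B v)) (O : Euc n ≃ₗᵢ[ℝ] Euc n) :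
    ∑ i, B (O (EuclideanSpace.single i 1)) (O (EuclideanSpace.single i 1)) =
      ∑ i, B (EuclideanSpace.single i 1) (EuclideanSpace.single i 1) := by
  have h3 : ∀ v, B v v = ∑ j, ∑ k, v j * v k *
      B (EuclideanSpace.single j 1) (EuclideanSpace.single k 1) := fun v => by
    rw [IsLinearMap.eq_sum_single (h1 v) v]
    refine Finset.sum_congr rfl fun j _ => ?_
    rw [IsLinearMap.eq_sum_single (h2 _) v, Finset.mul_sum]
    simp only [mul_assoc]
  -- Orthonormality of the rows of `O`: by Parseval, the sum is the inner product of the images of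
  -- two basis vectors under `O.symm`.
  have h4 : ∀ j k : Fin n, ∑ i, O (EuclideanSpace.single i 1) j * O (EuclideanSpace.single i 1) k =
      if j = k then 1 else 0 := fun j k => by
    have h5 : ∀ i l : Fin n, O (EuclideanSpace.single i 1) l =
        inner ℝ (O.symm (EuclideanSpace.single l 1)) (EuclideanSpace.basisFun (Fin n) ℝ i) :=
      fun i l => by
        rw [← O.inner_map_map, O.apply_symm_apply]
        simp [EuclideanSpace.inner_single_left]
    have h6 := (EuclideanSpace.basisFun (Fin n) ℝ).sum_inner_mul_inner
      (O.symm (EuclideanSpace.single j 1)) (O.symm (EuclideanSpace.single k 1))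
    rw [O.symm.inner_map_map] at h6
    simp only [h5]
    simpa [EuclideanSpace.inner_single_left, real_inner_comm] using h6
  simp only [h3 (O _)]
  rw [Finset.sum_comm]
  refine Finset.sum_congr rfl fun j _ => ?_
  rw [Finset.sum_comm]
  simp [← Finset.sum_mul, h4]

variable {g g' y y'} {O : Euc n ≃ₗᵢ[ℝ] Euc n}

theorem normalRic_isometry
    (h : ∀ i j k l, normalRm g' y' i j k l = normalRm g y (O i) (O j) (O k) (O l)) (j l : Euc n) :
    normalRic g' y' j l = normalRic g y (O j) (O l) := by
  simp only [normalRic, h]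
  exact sum_apply_isometry (B := fun v w => normalRm g y v (O j) w (O l))
    (fun _ => isLinearMap_normalRm_fst ..) (fun _ => isLinearMap_normalRm_trd ..) O

theorem normalScal_isometry
    (h : ∀ i j k l, normalRm g' y' i j k l = normalRm g y (O i) (O j) (O k) (O l)) :
    normalScal g' y' = normalScal g y := by
  simp only [normalScal, normalRic_isometry h]
  exact sum_apply_isometry (B := normalRic g y)
    (fun _ => isLinearMap_normalRic_fst ..) (fun _ => isLinearMap_normalRic_snd ..) O

theorem normalWeyl_isometry
    (h : ∀ i j k l, normalRm g' y' i j k l = normalRm g y (O i) (O j) (O k) (O l))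
    (i j k l : Euc n) : normalWeyl g' y' i j k l = normalWeyl g y (O i) (O j) (O k) (O l) := by
  simp only [normalWeyl, h, normalRic_isometry h, normalScal_isometry h, O.inner_map_map]

variable {T : Euc n → Euc n}

/-- The third derivatives of `T`, paired with `O w`. -/
def thirdForm (T : Euc n → Euc n) (O : Euc n ≃ₗᵢ[ℝ] Euc n) (y' a b v w : Euc n) : ℝ :=
  ∑ i, O w i * fderiv ℝ (fderiv ℝ fun z => fderiv ℝ T z v i) y' a b

theorem contDiffAt_fderiv_apply (hT : ContDiffAt ℝ 4 T y') (v : Euc n) (i : Fin n) :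
    ContDiffAt ℝ 2 (fun z => fderiv ℝ T z v i) y' := by
  have h1 : ContDiffAt ℝ 2 (fun z => fderiv ℝ T z v) y' :=
    ((hT.of_le (by norm_num : (3 : WithTop ℕ∞) ≤ 4)).fderiv_right (m := 2)
      (by norm_num)).clm_apply contDiffAt_const
  exact contDiffAt_euclidean.1 h1 i

theorem eventually_fderiv_coord (hT : ContDiffAt ℝ 4 T y') (v : Euc n) (i : Fin n) :
    (fun z => fderiv ℝ T z v i) =ᶠ[𝓝 y'] fun z => fderiv ℝ (fun z => T z i) z v := by
  have h1 : ∀ᶠ z in 𝓝 y', DifferentiableAt ℝ T z :=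
    (hT.eventually (by simp)).mono fun _ hz => hz.differentiableAt (by simp)
  filter_upwards [h1] with z hz
  have h2 := ((EuclideanSpace.proj i : Euc n →L[ℝ] ℝ).hasFDerivAt.comp z
    hz.hasFDerivAt).fderiv
  exact (congrArg (fun l : Euc n →L[ℝ] ℝ => l v) h2).symm

theorem thirdForm_comm_left (hT : ContDiffAt ℝ 4 T y') (a b v w : Euc n) :
    thirdForm T O y' a b v w = thirdForm T O y' b a v w := by
  unfold thirdForm
  simp only [fderiv_fderiv_comm (contDiffAt_fderiv_apply hT v _) a b]

/-- Schwarz's theorem for the components of `T`; with `thirdForm_comm_left` it gives full symmetry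
in the first three arguments. -/
theorem thirdForm_comm_right (hT : ContDiffAt ℝ 4 T y') (a b v w : Euc n) :
    thirdForm T O y' a b v w = thirdForm T O y' a v b w := by
  unfold thirdForm
  refine Finset.sum_congr rfl fun i _ => ?_
  rw [fderiv_fderiv_congr (eventually_fderiv_coord hT v i),
    fderiv_fderiv_congr (eventually_fderiv_coord hT b i),
    fderiv_fderiv_fderiv_comm ((contDiffAt_euclidean.1 hT i).of_le (by norm_num)) a b v]

theorem MetricNormalAt.metricHess_eq (hg : MetricNormalAt g y) (a b v w : Euc n) :
    metricHess g y a b v w =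
      fderiv ℝ (fderiv ℝ fun z => ∑ i, ∑ j, v i * w j * g z i j) y a b := by
  rw [fderiv_fderiv_sum _ fun i _ => ContDiffAt.sum fun j _ =>
    contDiffAt_const.mul (hg.smooth i j)]
  unfold metricHess
  refine Finset.sum_congr rfl fun i _ => ?_
  rw [fderiv_fderiv_sum _ fun j _ => contDiffAt_const.mul (hg.smooth i j)]
  refine Finset.sum_congr rfl fun j _ => ?_
  rw [fderiv_fderiv_const_mul (hg.smooth i j)]

/-- The identity `g'(v, w) = g(DT v, DT w)` is differentiated twice. At `y'` each factor has zero
first derivative, because `D²T = 0` and `g` is normal, so both derivatives must fall on the same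
factor: on `g` they give the rotated Hessian, on either `DT` a third derivative of `T`. -/
theorem metricHess_transition (hT : ContDiffAt ℝ 4 T y')
    (hT1 : fderiv ℝ T y' = (O.toContinuousLinearEquiv : Euc n →L[ℝ] Euc n))
    (hT2 : fderiv ℝ (fderiv ℝ T) y' = 0) (hg' : MetricNormalAt g' y')
    (hg : MetricNormalAt g (T y'))
    (heq : ∀ v w, (fun z => ∑ i, ∑ j, v i * w j * g' z i j) =ᶠ[𝓝 y'] fun z =>
      ∑ i, ∑ j, fderiv ℝ T z v i * fderiv ℝ T z w j * g (T z) i j) (a b v w : Euc n) :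
    metricHess g' y' a b v w = metricHess g (T y') (O a) (O b) (O v) (O w) +
      thirdForm T O y' a b v w + thirdForm T O y' a b w v := by
  have hT' : ContDiffAt ℝ 2 T y' := hT.of_le (by norm_num)
  have hP := contDiffAt_fderiv_apply hT
  have hG : ∀ i j, ContDiffAt ℝ 2 (fun z => g (T z) i j) y' := fun i j =>
    (hg.smooth i j).comp y' hT'
  have hG0 : ∀ i j, fderiv ℝ (fun z => g (T z) i j) y' = 0 := fun i j => by
    have h1 := (((hg.smooth i j).differentiableAt (by simp)).hasFDerivAt.comp y'
      (hT'.differentiableAt (by simp)).hasFDerivAt).fderiv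
    refine h1.trans ?_
    simp [hg.fderiv_eq]
  have hP0 : ∀ v i, fderiv ℝ (fun z => fderiv ℝ T z v i) y' = 0 := fun v i => by
    have h3 : HasFDerivAt (fderiv ℝ T) (fderiv ℝ (fderiv ℝ T) y') y' :=
      ((hT'.fderiv_right (m := 1) (by norm_num)).differentiableAt (by simp)).hasFDerivAt
    have h4 := ((EuclideanSpace.proj i : Euc n →L[ℝ] ℝ).hasFDerivAt.comp y'
      (h3.clm_apply (hasFDerivAt_const v y'))).fderiv
    refine h4.trans ?_
    ext c
    simp [hT2]
  have hP1 : ∀ v i, fderiv ℝ T y' v i = O v i := fun v i => by rw [hT1]; rfl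
  rw [hg'.metricHess_eq, fderiv_fderiv_congr (heq v w),
    fderiv_fderiv_sum _ fun i _ => ContDiffAt.sum fun j _ =>
      ((hP v i).mul (hP w j)).mul (hG i j)]
  have h5 : ∀ i j, fderiv ℝ (fderiv ℝ fun z => fderiv ℝ T z v i * fderiv ℝ T z w j * g (T z) i j)
      y' a b = O v i * O w j *
        fderiv ℝ (fderiv ℝ fun z => g z i j) (T y') (O a) (O b) + (if i = j then 1 else 0) *
        (O v i * fderiv ℝ (fderiv ℝ fun z => fderiv ℝ T z w j) y' a b +
          O w j * fderiv ℝ (fderiv ℝ fun z => fderiv ℝ T z v i) y' a b) := fun i j => by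
    rw [fderiv_fderiv_mul ((hP v i).mul (hP w j)) (hG i j)
      (fderiv_mul_eq_zero ((hP v i).differentiableAt (by simp))
        ((hP w j).differentiableAt (by simp)) (hP0 v i) (hP0 w j)) (hG0 i j),
      fderiv_fderiv_mul (hP v i) (hP w j) (hP0 v i) (hP0 w j),
      fderiv_fderiv_comp hT' (hg.smooth i j) (hg.fderiv_eq i j), hP1, hP1, hg.eq_one, hT1]
    simp only [Matrix.one_apply]
    rfl
  have h6 : ∀ i, fderiv ℝ (fderiv ℝ fun z => ∑ j, fderiv ℝ T z v i * fderiv ℝ T z w j *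
      g (T z) i j) y' a b = ∑ j, (O v i * O w j *
        fderiv ℝ (fderiv ℝ fun z => g z i j) (T y') (O a) (O b) + (if i = j then 1 else 0) *
        (O v i * fderiv ℝ (fderiv ℝ fun z => fderiv ℝ T z w j) y' a b +
          O w j * fderiv ℝ (fderiv ℝ fun z => fderiv ℝ T z v i) y' a b)) := fun i => by
    rw [fderiv_fderiv_sum _ fun j _ => ((hP v i).mul (hP w j)).mul (hG i j)]
    simp only [h5]
  simp only [h6, Finset.sum_add_distrib, ite_mul, one_mul, zero_mul, Finset.sum_ite_eq,
    Finset.mem_univ, if_true]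
  unfold metricHess thirdForm
  ring

/-- The four Hessians produce eight third-order terms. Those with the same last argument come in
pairs of opposite sign and cancel by symmetry in the first three, so the third derivatives of `T`,
which need not vanish, do not affect the curvature. -/
theorem normalRm_transition (hT : ContDiffAt ℝ 4 T y')
    (hT1 : fderiv ℝ T y' = (O.toContinuousLinearEquiv : Euc n →L[ℝ] Euc n))
    (hT2 : fderiv ℝ (fderiv ℝ T) y' = 0) (hg' : MetricNormalAt g' y')
    (hg : MetricNormalAt g (T y'))
    (heq : ∀ v w, (fun z => ∑ i, ∑ j, v i * w j * g' z i j) =ᶠ[𝓝 y'] fun z =>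
      ∑ i, ∑ j, fderiv ℝ T z v i * fderiv ℝ T z w j * g (T z) i j) (i j k l : Euc n) :
    normalRm g' y' i j k l = normalRm g (T y') (O i) (O j) (O k) (O l) := by
  unfold normalRm
  simp only [metricHess_transition hT hT1 hT2 hg' hg heq]
  have c1 : thirdForm T O y' k j l i = thirdForm T O y' l j k i := by
    rw [thirdForm_comm_right hT, thirdForm_comm_left hT, thirdForm_comm_right hT]
  have c2 : thirdForm T O y' k i l j = thirdForm T O y' l i k j := by
    rw [thirdForm_comm_right hT, thirdForm_comm_left hT, thirdForm_comm_right hT]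
  rw [c1, c2, thirdForm_comm_right hT k j i l, thirdForm_comm_right hT l j i k]
  ring

end TensorTransformation
end BubbleFamilies
end

open Set Filter Topology MeasureTheory Bundle Manifold
open scoped ENNReal NNReal ContDiff

noncomputable section

set_option linter.unusedSectionVars false

namespace BubbleFamilies

/-! ### Regular representatives and isometries -/

section RegularRepresentative

variable {n : ℕ} {V V' : Euc n → ℝ}

theorem contDiff_c2Rep (V : Euc n → ℝ) : ContDiff ℝ 2 (c2Rep V) := by
  unfold c2Rep
  split_ifs with h
  · exact h.choose_spec.1
  · exact contDiff_const

theorem c2Rep_eq {W : Euc n → ℝ} (hW : ContDiff ℝ 2 W) (h : W =ᵐ[volume] V) : c2Rep V = W := by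
  have h1 : ∃ W : Euc n → ℝ, ContDiff ℝ 2 W ∧ W =ᵐ[volume] V := ⟨W, hW, h⟩
  rw [c2Rep, dif_pos h1]
  exact (Continuous.ae_eq_iff_eq volume h1.choose_spec.1.continuous hW.continuous).1
    (h1.choose_spec.2.trans h.symm)

theorem c2Rep_congr_ae (h : V =ᵐ[volume] V') : c2Rep V = c2Rep V' := by
  by_cases h1 : ∃ W : Euc n → ℝ, ContDiff ℝ 2 W ∧ W =ᵐ[volume] V
  · obtain ⟨W, hW, hWV⟩ := h1
    rw [c2Rep_eq hW hWV, c2Rep_eq hW (hWV.trans h)]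
  · have h2 : ¬ ∃ W : Euc n → ℝ, ContDiff ℝ 2 W ∧ W =ᵐ[volume] V' := fun ⟨W, hW, hWV⟩ =>
      h1 ⟨W, hW, hWV.trans h.symm⟩
    rw [c2Rep, c2Rep, dif_neg h1, dif_neg h2]

theorem ae_eq_comp_isometry (h : V =ᵐ[volume] V') (O : Euc n ≃ₗᵢ[ℝ] Euc n) :
    V ∘ O =ᵐ[volume] V' ∘ O :=
  O.measurePreserving.quasiMeasurePreserving.ae_eq h

/-- `V` has a `C²` representative exactly when `V ∘ O` does, and otherwise both sides are the
default 0. Regularity of solutions is therefore never invoked. -/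
theorem c2Rep_comp_isometry (V : Euc n → ℝ) (O : Euc n ≃ₗᵢ[ℝ] Euc n) :
    c2Rep (V ∘ O) = c2Rep V ∘ O := by
  by_cases h1 : ∃ W : Euc n → ℝ, ContDiff ℝ 2 W ∧ W =ᵐ[volume] V
  · obtain ⟨W, hW, hWV⟩ := h1
    rw [c2Rep_eq hW hWV, c2Rep_eq (hW.comp O.contDiff) (ae_eq_comp_isometry hWV O)]
  · have h2 : ¬ ∃ W : Euc n → ℝ, ContDiff ℝ 2 W ∧ W =ᵐ[volume] V ∘ O := fun ⟨W, hW, hWV⟩ =>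
      h1 ⟨W ∘ O.symm, hW.comp O.symm.contDiff, by
        simpa [Function.comp_assoc] using ae_eq_comp_isometry hWV O.symm⟩
    rw [c2Rep, c2Rep, dif_neg h1, dif_neg h2]
    rfl

theorem fderiv_comp_isometry {W : Euc n → ℝ} (hW : Differentiable ℝ W) (O : Euc n ≃ₗᵢ[ℝ] Euc n)
    (y e : Euc n) : fderiv ℝ (W ∘ O) y e = fderiv ℝ W (O y) (O e) := by
  have h1 := ((hW (O y)).hasFDerivAt.comp y O.toContinuousLinearEquiv.hasFDerivAt).fderiv
  exact congrArg (fun l : Euc n →L[ℝ] ℝ => l e) h1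

theorem fderiv_fderiv_comp_isometry {W : Euc n → ℝ} (hW : ContDiff ℝ 2 W)
    (O : Euc n ≃ₗᵢ[ℝ] Euc n) (y a b : Euc n) :
    fderiv ℝ (fderiv ℝ (W ∘ O)) y a b = fderiv ℝ (fderiv ℝ W) (O y) (O a) (O b) := by
  rw [← fderiv_fderiv_apply (hW.comp O.contDiff).contDiffAt]
  have h1 : (fun z => fderiv ℝ (W ∘ O) z b) = (fun z => fderiv ℝ W z (O b)) ∘ O :=
    funext fun z => fderiv_comp_isometry (hW.differentiable (by simp)) O z b
  have h2 : Differentiable ℝ fun z => fderiv ℝ W z (O b) := fun z =>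
    (differentiableAt_fderiv hW.contDiffAt).clm_apply (differentiableAt_const _)
  rw [h1, fderiv_comp_isometry h2, fderiv_fderiv_apply hW.contDiffAt]

end RegularRepresentative

/-! ### The integrand of the Weyl term -/

section WeylIntegrand

variable {n : ℕ} {g : Euc n → Matrix (Fin n) (Fin n) ℝ} {y : Euc n}

/-- The sums over `a` and `b` are the basis expansions of `z` in the second and fourth slots of the
Weyl tensor; only the two contracted indices remain. -/
theorem MetricNormalAt.sum_weyl_eq (hg : MetricNormalAt g y) (z : Euc n)
    (D : Fin n → Fin n → ℝ) (S : ℝ) :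
    ∑ i, ∑ a, ∑ j, ∑ b, weyl g i a j b y * (z a * z b * D i j * S) =
      (∑ i, ∑ j, normalWeyl g y (EuclideanSpace.single i 1) z (EuclideanSpace.single j 1) z *
        D i j) * S := by
  rw [Finset.sum_mul]
  refine Finset.sum_congr rfl fun i _ => ?_
  rw [Finset.sum_comm, Finset.sum_mul]
  refine Finset.sum_congr rfl fun j _ => ?_
  rw [IsLinearMap.eq_sum_single (isLinearMap_normalWeyl_snd g y _ _ z) z, Finset.sum_mul,
    Finset.sum_mul]
  refine Finset.sum_congr rfl fun a _ => ?_
  rw [IsLinearMap.eq_sum_single (isLinearMap_normalWeyl_fth g y _ _ _) z, Finset.mul_sum,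
    Finset.sum_mul, Finset.sum_mul]
  refine Finset.sum_congr rfl fun b _ => ?_
  rw [hg.weyl_eq]
  ring

/-- The integrand in the definition of `Weyl_g ⊗ B`, at a normal point. -/
def weylDensity (g : Euc n → Matrix (Fin n) (Fin n) ℝ) (y : Euc n) (W : Euc n → ℝ) (z : Euc n) :
    ℝ :=
  (∑ i, ∑ j, normalWeyl g y (EuclideanSpace.single i 1) z (EuclideanSpace.single j 1) z *
    fderiv ℝ (fderiv ℝ W) z (EuclideanSpace.single i 1) (EuclideanSpace.single j 1)) *
    (((n : ℝ) - 2) / 2 * W z + fderiv ℝ W z z)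

theorem MetricNormalAt.weylDensity_eq (hg : MetricNormalAt g y) {W : Euc n → ℝ}
    (hW : ContDiff ℝ 2 W) (z : Euc n) :
    ∑ i, ∑ a, ∑ j, ∑ b, weyl g i a j b y * (z a * z b * pd i (pd j W) z *
      (((n : ℝ) - 2) / 2 * W z + ∑ l, z l * pd l W z)) = weylDensity g y W z := by
  rw [hg.sum_weyl_eq, weylDensity,
    IsLinearMap.eq_sum_single (f := fderiv ℝ W z) ⟨map_add _, map_smul _⟩ z]
  have h1 : ∀ i j, pd i (pd j W) z = fderiv ℝ (fderiv ℝ W) z (EuclideanSpace.single i 1)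
      (EuclideanSpace.single j 1) := fun i j => fderiv_fderiv_apply hW.contDiffAt _ _
  simp only [h1]
  rfl

/-- The density is the contraction of the Weyl form with the Hessian of `W`, times a factor
invariant by the chain rule. The contraction is a double trace, and `sum_apply_isometry` removes the
isometry from one index at a time. -/
theorem weylDensity_comp_isometry {g' : Euc n → Matrix (Fin n) (Fin n) ℝ} {y' : Euc n}
    {O : Euc n ≃ₗᵢ[ℝ] Euc n} (h : ∀ i j k l,
      normalWeyl g' y' i j k l = normalWeyl g y (O i) (O j) (O k) (O l)) {W : Euc n → ℝ}
    (hW : ContDiff ℝ 2 W) (z : Euc n) :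
    weylDensity g' y' (W ∘ O) z = weylDensity g y W (O z) := by
  unfold weylDensity
  rw [fderiv_comp_isometry (hW.differentiable (by simp))]
  simp only [h, fderiv_fderiv_comp_isometry hW, Function.comp_apply]
  congr 1
  have h1 : ∀ v j, IsLinearMap ℝ fun i => normalWeyl g y i v j v := fun v j =>
    isLinearMap_normalWeyl_fst g y _ _ _
  have h2 : ∀ v i, IsLinearMap ℝ fun j => normalWeyl g y i v j v := fun v i =>
    isLinearMap_normalWeyl_trd g y _ _ _
  have h3 := sum_apply_isometry (O := O)
    (B := fun v w => ∑ j, normalWeyl g y v (O z) (O (EuclideanSpace.single j 1)) (O z) *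
      fderiv ℝ (fderiv ℝ W) (O z) w (O (EuclideanSpace.single j 1)))
    (fun w => by
      constructor <;> intros <;>
        simp only [(h1 _ _).map_add, (h1 _ _).map_smul, add_mul, Finset.sum_add_distrib,
          smul_eq_mul, Finset.mul_sum, mul_assoc])
    (fun v => by
      constructor <;> intros <;>
        simp [mul_add, Finset.sum_add_distrib, Finset.mul_sum, mul_left_comm])
  refine h3.trans (Finset.sum_congr rfl fun i _ => ?_)
  exact sum_apply_isometry (O := O)
    (B := fun v w => normalWeyl g y (EuclideanSpace.single i 1) (O z) v (O z) *
      fderiv ℝ (fderiv ℝ W) (O z) (EuclideanSpace.single i 1) w)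
    (fun w => by
      constructor <;> intros <;>
        simp only [(h2 _ _).map_add, (h2 _ _).map_smul, add_mul, smul_eq_mul, mul_assoc])
    (fun v => by
      constructor <;> intros <;> simp [mul_add, mul_left_comm])

end WeylIntegrand

/-! ### Invariance of the Weyl term under a change of normal charts -/

section WeylBubble

attribute [local instance 2000] chartedSpaceSelf

variable {n : ℕ} {M : Type*} [MetricSpace M] [ChartedSpace (Euc n) M] [IsManifold 𝓘(ℝ, Euc n) ∞ M]
  [RiemannianBundle (fun p : M => TangentSpace 𝓘(ℝ, Euc n) p)]
  [IsContMDiffRiemannianBundle 𝓘(ℝ, Euc n) ∞ (Euc n) (fun p : M => TangentSpace 𝓘(ℝ, Euc n) p)]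

theorem IsNormalAt.metricNormalAt {φ : OpenPartialHomeomorph M (Euc n)}
    (hφ : φ ∈ IsManifold.maximalAtlas 𝓘(ℝ, Euc n) ∞ M) {p : M} (h : IsNormalAt φ p) :
    MetricNormalAt (chartMetric φ) (φ p) where
  smooth i j := ((contDiffOn_chartMetric hφ i j).contDiffAt
    (φ.open_target.mem_nhds (φ.map_source h.1))).of_le (WithTop.coe_le_coe.2 (le_top (a := (2:ℕ∞))))
  eq_one := h.2.1
  fderiv_eq i j := pd_eq_zero_iff.1 fun k => h.2.2 i j k

theorem IsNormalAt.normalWeyl_transition {φ φ' : OpenPartialHomeomorph M (Euc n)}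
    (hφ : φ ∈ IsManifold.maximalAtlas 𝓘(ℝ, Euc n) ∞ M)
    (hφ' : φ' ∈ IsManifold.maximalAtlas 𝓘(ℝ, Euc n) ∞ M) {p : M} (h : IsNormalAt φ p)
    (h' : IsNormalAt φ' p) {O : Euc n ≃ₗᵢ[ℝ] Euc n}
    (hO : fderiv ℝ (φ ∘ φ'.symm) (φ' p) = (O.toContinuousLinearEquiv : Euc n →L[ℝ] Euc n))
    (i j k l : Euc n) : normalWeyl (chartMetric φ') (φ' p) i j k l =
      normalWeyl (chartMetric φ) (φ p) (O i) (O j) (O k) (O l) := by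
  have hp : (φ ∘ φ'.symm) (φ' p) = φ p := by simp [φ'.left_inv h'.1]
  have hg := h.metricNormalAt hφ
  rw [← hp] at hg ⊢
  refine normalWeyl_isometry (normalRm_transition
    ((contDiffAt_transition hφ hφ' h.1 h'.1).of_le (WithTop.coe_le_coe.2 (le_top (a := (4:ℕ∞)))))
    hO (h.fderiv_fderiv_transition hφ hφ' h') (h'.metricNormalAt hφ') hg fun v w => ?_) i j k l
  filter_upwards [(isOpen_transition φ φ').mem_nhds
    (show φ' p ∈ φ'.target ∩ φ'.symm ⁻¹' φ.source from
      ⟨φ'.map_source h'.1, by rw [mem_preimage, φ'.left_inv h'.1]; exact h.1⟩)] with z hz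
  rw [← coordInner_eq_sum, ← coordInner_eq_sum, coordInner_transition hφ hφ' hz.1 hz.2]

theorem weylTensorBubble_congr_ae (φ : OpenPartialHomeomorph M (Euc n)) (x₀ : M)
    {V V' : Euc n → ℝ} (h : V =ᵐ[volume] V') :
    weylTensorBubble φ x₀ V = weylTensorBubble φ x₀ V' := by
  have h1 : ∫ y, |V y| ^ twoStar n = ∫ y, |V' y| ^ twoStar n :=
    integral_congr_ae (h.fun_comp fun t => |t| ^ twoStar n)
  unfold weylTensorBubble
  rw [c2Rep_congr_ae h, h1]

theorem IsNormalAt.weylTensorBubble_eq {φ : OpenPartialHomeomorph M (Euc n)}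
    (hφ : φ ∈ IsManifold.maximalAtlas 𝓘(ℝ, Euc n) ∞ M) {p : M} (h : IsNormalAt φ p)
    (V : Euc n → ℝ) : weylTensorBubble φ p V =
      4 * (n : ℝ) / (3 * ((n : ℝ) - 2) ^ 2) * (∫ y, |V y| ^ twoStar n)⁻¹ *
        ∫ z, weylDensity (chartMetric φ) (φ p) (c2Rep V) z := by
  unfold weylTensorBubble
  simp only [(h.metricNormalAt hφ).weylDensity_eq (contDiff_c2Rep V)]

/-- `Weyl_g ⊗ B` does not depend on the normal chart. -/
theorem IsNormalAt.weylTensorBubble_transition {φ φ' : OpenPartialHomeomorph M (Euc n)}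
    (hφ : φ ∈ IsManifold.maximalAtlas 𝓘(ℝ, Euc n) ∞ M)
    (hφ' : φ' ∈ IsManifold.maximalAtlas 𝓘(ℝ, Euc n) ∞ M) {p : M} (h : IsNormalAt φ p)
    (h' : IsNormalAt φ' p) {O : Euc n ≃ₗᵢ[ℝ] Euc n}
    (hO : fderiv ℝ (φ ∘ φ'.symm) (φ' p) = (O.toContinuousLinearEquiv : Euc n →L[ℝ] Euc n))
    (V : Euc n → ℝ) : weylTensorBubble φ' p (V ∘ O) = weylTensorBubble φ p V := by
  have hint : ∀ f : Euc n → ℝ, ∫ y, f (O y) = ∫ y, f y := fun f =>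
    O.measurePreserving.integral_comp O.toHomeomorph.measurableEmbedding f
  rw [h.weylTensorBubble_eq hφ, h'.weylTensorBubble_eq hφ', c2Rep_comp_isometry]
  simp only [weylDensity_comp_isometry (h.normalWeyl_transition hφ hφ' h' hO) (contDiff_c2Rep V)]
  rw [hint (weylDensity (chartMetric φ) (φ p) (c2Rep V)), ← hint fun y => |V y| ^ twoStar n]
  rfl

end WeylBubble
end BubbleFamilies
end

open Set Filter Topology MeasureTheory Bundle Manifold
open scoped ENNReal NNReal ContDiff

noncomputable section

set_option linter.unusedSectionVars false

namespace BubbleFamilies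

/-! ### Composition of charts with an isometry -/

section RotatedCharts

attribute [local instance 2000] chartedSpaceSelf

variable {n : ℕ} {M : Type*} [MetricSpace M] [ChartedSpace (Euc n) M] [IsManifold 𝓘(ℝ, Euc n) ∞ M]

/-- The chart `Q ∘ φ`. -/
def rotatedChart (Q : Euc n ≃ₗᵢ[ℝ] Euc n) (φ : OpenPartialHomeomorph M (Euc n)) :
    OpenPartialHomeomorph M (Euc n) :=
  φ.transHomeomorph Q.toHomeomorph

theorem rotatedChart_mem {φ : OpenPartialHomeomorph M (Euc n)}
    (hφ : φ ∈ IsManifold.maximalAtlas 𝓘(ℝ, Euc n) ∞ M) (Q : Euc n ≃ₗᵢ[ℝ] Euc n) :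
    rotatedChart Q φ ∈ IsManifold.maximalAtlas 𝓘(ℝ, Euc n) ∞ M := by
  refine OpenPartialHomeomorph.mem_maximalAtlas_of_contMDiffOn (I := 𝓘(ℝ, Euc n)) (n := ∞)
    (rotatedChart Q φ) ?_ ?_
  · exact Q.contDiff.contMDiff.comp_contMDiffOn (contMDiffOn_of_mem_maximalAtlas hφ)
  · exact (contMDiffOn_symm_of_mem_maximalAtlas hφ).comp Q.symm.contDiff.contMDiff.contMDiffOn
      fun y hy => hy

theorem comp_rotatedChart_symm (φ : OpenPartialHomeomorph M (Euc n)) (Q : Euc n ≃ₗᵢ[ℝ] Euc n)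
    {p : M} (hp : p ∈ φ.source) :
    φ ∘ (rotatedChart Q φ).symm =ᶠ[𝓝 (rotatedChart Q φ p)] Q.symm.toContinuousLinearEquiv := by
  have h1 := (rotatedChart Q φ).open_target.mem_nhds ((rotatedChart Q φ).map_source (x := p) hp)
  filter_upwards [h1] with y hy
  exact φ.right_inv hy

theorem fderiv_comp_rotatedChart_symm (φ : OpenPartialHomeomorph M (Euc n))
    (Q : Euc n ≃ₗᵢ[ℝ] Euc n) {p : M} (hp : p ∈ φ.source) :
    fderiv ℝ (φ ∘ (rotatedChart Q φ).symm) =ᶠ[𝓝 (rotatedChart Q φ p)]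
      fun _ => (Q.symm.toContinuousLinearEquiv : Euc n →L[ℝ] Euc n) :=
  (comp_rotatedChart_symm φ Q hp).fderiv.trans
    (Eventually.of_forall fun _ => Q.symm.toContinuousLinearEquiv.fderiv)

theorem iteratedFDeriv_conj_isometry (f : Euc n → Euc n) (Q : Euc n ≃ₗᵢ[ℝ] Euc n) (k : ℕ)
    (z : Euc n) : iteratedFDeriv ℝ k (Q ∘ f ∘ Q.symm) z =
      (Q.toContinuousLinearEquiv : Euc n →L[ℝ] Euc n).compContinuousMultilinearMap
        ((iteratedFDeriv ℝ k f (Q.symm z)).compContinuousLinearMap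
          fun _ => (Q.symm.toContinuousLinearEquiv : Euc n →L[ℝ] Euc n)) := by
  refine (Q.toContinuousLinearEquiv.iteratedFDeriv_comp_left).trans (congrArg _ ?_)
  have h1 := Q.symm.toContinuousLinearEquiv.iteratedFDerivWithin_comp_right f
    (uniqueDiffOn_univ (𝕜 := ℝ)) (mem_univ (Q.symm z)) k
  simp only [preimage_univ, iteratedFDerivWithin_univ] at h1
  exact h1

theorem norm_iteratedFDeriv_conj_isometry_sub_le (f h : Euc n → Euc n) (Q : Euc n ≃ₗᵢ[ℝ] Euc n)
    (k : ℕ) (z : Euc n) :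
    ‖iteratedFDeriv ℝ k (Q ∘ f ∘ Q.symm) z - iteratedFDeriv ℝ k (Q ∘ h ∘ Q.symm) z‖ ≤
      ‖iteratedFDeriv ℝ k f (Q.symm z) - iteratedFDeriv ℝ k h (Q.symm z)‖ := by
  rw [iteratedFDeriv_conj_isometry, iteratedFDeriv_conj_isometry]
  refine ContinuousMultilinearMap.opNorm_le_bound (norm_nonneg _) fun m => ?_
  have h1 := (iteratedFDeriv ℝ k f (Q.symm z) - iteratedFDeriv ℝ k h (Q.symm z)).le_opNorm
    fun i => Q.symm (m i)
  simp only [LinearIsometryEquiv.norm_map] at h1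
  refine le_trans (le_of_eq ?_) h1
  simp [← map_sub]

variable [RiemannianBundle (fun p : M => TangentSpace 𝓘(ℝ, Euc n) p)]
  [IsContMDiffRiemannianBundle 𝓘(ℝ, Euc n) ∞ (Euc n) (fun p : M => TangentSpace 𝓘(ℝ, Euc n) p)]

theorem IsNormalAt.rotatedChart {φ : OpenPartialHomeomorph M (Euc n)}
    (hφ : φ ∈ IsManifold.maximalAtlas 𝓘(ℝ, Euc n) ∞ M) {p : M} (h : IsNormalAt φ p)
    (Q : Euc n ≃ₗᵢ[ℝ] Euc n) : IsNormalAt (rotatedChart Q φ) p := by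
  have hQ := rotatedChart_mem hφ Q
  have hp : p ∈ (BubbleFamilies.rotatedChart Q φ).source := h.1
  have hD := fderiv_comp_rotatedChart_symm φ Q h.1
  refine isNormalAt_of_coordInner hp (fun e e' => ?_) fun e e' => ?_
  · have h1 : (φ ∘ (BubbleFamilies.rotatedChart Q φ).symm) (BubbleFamilies.rotatedChart Q φ p) =
        φ p := by
      rw [Function.comp_apply, (BubbleFamilies.rotatedChart Q φ).left_inv hp]
    rw [coordInner_transition hφ hQ ((BubbleFamilies.rotatedChart Q φ).map_source hp)
      (by rw [(BubbleFamilies.rotatedChart Q φ).left_inv hp]; exact h.1), h1, h.coordInner_eq,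
      hD.eq_of_nhds]
    exact Q.symm.inner_map_map e e'
  · ext k
    rw [h.fderiv_coordInner hφ hQ hp, hD.fderiv_eq]
    simp

/-- Rotating all the charts conjugates `φ ε ∘ (φ 0).symm` by `Q`, which does not increase the norms
of differences of derivatives, so `C^k` convergence persists. -/
theorem IsNormalChartFamily.rotatedChart {r : ℝ} {x₀ : M} {x : ℝ → M}
    {φ : ℝ → OpenPartialHomeomorph M (Euc n)} (h : IsNormalChartFamily r x₀ x φ)
    (Q : Euc n ≃ₗᵢ[ℝ] Euc n) : IsNormalChartFamily r x₀ x fun ε => rotatedChart Q (φ ε) := by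
  obtain ⟨U, hU, hb, h1, h2, h3⟩ := h
  refine ⟨U, hU, hb, fun ε hε => ⟨rotatedChart_mem (h1 ε hε).1 Q, (h1 ε hε).2⟩, ?_,
    fun K hK hKU k => ?_⟩
  · filter_upwards [h2, ConvergingCharts.eventually_pos] with ε hε hpos
    exact hε.rotatedChart (h1 ε hpos.le).1 Q
  · rw [Metric.tendstoUniformlyOn_iff]
    intro η hη
    filter_upwards [Metric.tendstoUniformlyOn_iff.1 (h3 K hK hKU k) η hη] with ε hε z hz
    obtain ⟨q, hq, rfl⟩ := hz
    have h4 := hε _ (mem_image_of_mem _ hq)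
    rw [dist_eq_norm] at h4 ⊢
    refine (norm_iteratedFDeriv_conj_isometry_sub_le (φ 0 ∘ (φ 0).symm) (φ ε ∘ (φ 0).symm) Q k
      _).trans_lt ?_
    have h5 : Q.symm (BubbleFamilies.rotatedChart Q (φ 0) q) = φ 0 q := Q.symm_apply_apply _
    rwa [h5]

/-- The rotations of the model and of the chart cancel exactly. This realises every isometry between
models of the same family, with no limiting argument. -/
theorem bubbleProfile_rotatedChart (χ : ℝ → ℝ) (V : Euc n → ℝ)
    (φ : OpenPartialHomeomorph M (Euc n)) (O : Euc n ≃ₗᵢ[ℝ] Euc n) (p : M) (m : ℝ) :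
    bubbleProfile χ (V ∘ O) (rotatedChart O.symm φ) p m = bubbleProfile χ V φ p m := by
  funext q
  have h1 : ∀ q, rotatedChart O.symm φ q = O.symm (φ q) := fun _ => rfl
  simp [bubbleProfile, h1]

end RotatedCharts

/-! ### Equivalence of families of bubbles -/

section BubbleComparison

attribute [local instance 2000] chartedSpaceSelf

variable {n : ℕ} {M : Type*} [MetricSpace M] [ChartedSpace (Euc n) M] [IsManifold 𝓘(ℝ, Euc n) ∞ M]
  [RiemannianBundle (fun p : M => TangentSpace 𝓘(ℝ, Euc n) p)]
  [IsContMDiffRiemannianBundle 𝓘(ℝ, Euc n) ∞ (Euc n) (fun p : M => TangentSpace 𝓘(ℝ, Euc n) p)]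
  [IsRiemannianManifold 𝓘(ℝ, Euc n) M] [MeasurableSpace M] [BorelSpace M] [CompactSpace M]
  {r : ℝ} {χ : ℝ → ℝ} {x₀ : M} {x : ℝ → M} {μ : ℝ → ℝ}
  {φ φ' : ℝ → OpenPartialHomeomorph M (Euc n)} {V V' : Euc n → ℝ} {B B' : ℝ → M → ℝ}
  {O : Euc n ≃ₗᵢ[ℝ] Euc n}

theorem IsNormalChartFamily.tendsto_fderiv_transition (hr : 0 ≤ r)
    (hx : Tendsto x (𝓝[>] (0 : ℝ)) (𝓝 x₀)) (h : IsNormalChartFamily r x₀ x φ)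
    (h' : IsNormalChartFamily r x₀ x φ') :
    Tendsto (fun ε => fderiv ℝ (φ ε ∘ (φ' ε).symm) (φ' ε (x ε))) (𝓝[>] (0 : ℝ))
      (𝓝 (fderiv ℝ (φ 0 ∘ (φ' 0).symm) (φ' 0 x₀))) := by
  obtain ⟨U, K, C, hc, hc', hU, -⟩ := h.exists_common_bounds hx h'
  exact (hc.tendsto_fderiv_transition hc' (hU (Metric.mem_closedBall_self hr))).comp
    (tendsto_id.prodMk hx)

/-- On `K` the chart bounds show that preimages of null sets are null, so rescaled models agree
almost everywhere; outside `K` the cutoff vanishes. -/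
theorem IsNormalChartFamily.bubbleProfile_congr_ae (hχ0 : ∀ t, r ≤ |t| → χ t = 0)
    (hx : Tendsto x (𝓝[>] (0 : ℝ)) (𝓝 x₀)) (hμ_pos : ∀ ε, 0 < ε → 0 < μ ε)
    (h : IsNormalChartFamily r x₀ x φ) (hV : V =ᵐ[volume] V') :
    ∀ᶠ ε in 𝓝[>] (0 : ℝ), bubbleProfile χ V (φ ε) (x ε) (μ ε) =ᵐ[vol n]
      bubbleProfile χ V' (φ ε) (x ε) (μ ε) := by
  obtain ⟨U, K, C, -, -, -, hK, -, -, hCε⟩ := h.exists_common_bounds hx h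
  filter_upwards [hCε, ConvergingCharts.eventually_pos] with ε hε hpos
  have h1 := hε.1.rescaled_congr_ae hK.measurableSet hV (x ε) (hμ_pos ε hpos)
  rw [EventuallyEq, ae_restrict_iff' hK.measurableSet] at h1
  filter_upwards [h1] with q hq
  rw [bubbleProfile_eq, bubbleProfile_eq, Pi.mul_apply, Pi.mul_apply]
  by_cases hqK : q ∈ K
  · rw [hq hqK]
  · have h2 : χ (dist q (x ε)) = 0 := hχ0 _ (by
      rw [abs_of_nonneg dist_nonneg]
      by_contra hlt
      exact hqK (interior_subset (hε.2.2 (Metric.mem_closedBall.2 (not_le.1 hlt).le))))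
    rw [h2, zero_mul, zero_mul]

theorem TendstoZeroH1.sub {w w' : ℝ → M → ℝ} (h : TendstoZeroH1 n w) (h' : TendstoZeroH1 n w') :
    TendstoZeroH1 n (fun ε => w ε - w' ε) := by
  simpa only [sub_eq_add_neg] using h.add h'.neg

theorem IsBubbleFamilyIn.congr_ae (hχ0 : ∀ t, r ≤ |t| → χ t = 0)
    (hx : Tendsto x (𝓝[>] (0 : ℝ)) (𝓝 x₀)) (hμ_pos : ∀ ε, 0 < ε → 0 < μ ε)
    (h : IsBubbleFamilyIn χ r x₀ x μ φ V B) (hV : V =ᵐ[volume] V') :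
    IsBubbleFamilyIn χ r x₀ x μ φ V' B where
  charts := h.charts
  mem_sigma := mem_sigmaSol_congr_ae h.mem_sigma hV
  memH1 := h.memH1
  tendsto := by
    refine h.tendsto.congr_ae ?_
    filter_upwards [h.charts.bubbleProfile_congr_ae hχ0 hx hμ_pos hV] with ε hε
    exact (EventuallyEq.refl _ (B ε)).sub hε

theorem IsBubbleFamilyIn.rotatedChart (h : IsBubbleFamilyIn χ r x₀ x μ φ V B)
    (O : Euc n ≃ₗᵢ[ℝ] Euc n) :
    IsBubbleFamilyIn χ r x₀ x μ (fun ε => rotatedChart O.symm (φ ε)) (V ∘ O) B where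
  charts := h.charts.rotatedChart O.symm
  mem_sigma := comp_isometry_mem_sigmaSol h.mem_sigma O
  memH1 := h.memH1
  tendsto := by simpa only [bubbleProfile_rotatedChart] using h.tendsto

theorem isBubbleFamilyIn_iff_comp_isometry (hn : 3 ≤ n) (hr : 0 ≤ r) (hχ : ContDiff ℝ ∞ χ)
    (hχ0 : ∀ t, r ≤ |t| → χ t = 0) (hx : Tendsto x (𝓝[>] (0 : ℝ)) (𝓝 x₀))
    (hμ_pos : ∀ ε, 0 < ε → 0 < μ ε) (hμ : Tendsto μ (𝓝[>] (0 : ℝ)) (𝓝 0))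
    (h : IsNormalChartFamily r x₀ x φ) (h' : IsNormalChartFamily r x₀ x φ')
    (hO : fderiv ℝ (φ 0 ∘ (φ' 0).symm) (φ' 0 x₀) =
      (O.toContinuousLinearEquiv : Euc n →L[ℝ] Euc n)) :
    IsBubbleFamilyIn χ r x₀ x μ φ V B ↔ IsBubbleFamilyIn χ r x₀ x μ φ' (V ∘ O) B := by
  refine ⟨fun hB => ⟨h', comp_isometry_mem_sigmaSol hB.mem_sigma O, hB.memH1, ?_⟩,
    fun hB => ?_⟩
  · obtain ⟨G, hG, -⟩ := hB.mem_sigma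
    simpa only [sub_add_sub_cancel] using hB.tendsto.add
      (tendstoZeroH1_bubbleProfile_sub hn hr hχ hχ0 hx hμ_pos hμ h h' hO hG)
  · have hV : V ∈ SigmaSol n := by
      simpa [Function.comp_assoc] using comp_isometry_mem_sigmaSol hB.mem_sigma O.symm
    refine ⟨h, hV, hB.memH1, ?_⟩
    obtain ⟨G, hG, -⟩ := hV
    simpa only [sub_sub_sub_cancel_right] using hB.tendsto.sub
      (tendstoZeroH1_bubbleProfile_sub hn hr hχ hχ0 hx hμ_pos hμ h h' hO hG)

/-- The criterion for two families of bubbles to be equivalent. -/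
theorem IsBubbleFamilyIn.tendstoZeroH1_sub_iff (hn : 3 ≤ n) (hr : 0 < r) (hχ : ContDiff ℝ ∞ χ)
    (hχ1 : ∀ t, |t| ≤ r / 2 → χ t = 1) (hχ0 : ∀ t, r ≤ |t| → χ t = 0)
    (hx : Tendsto x (𝓝[>] (0 : ℝ)) (𝓝 x₀)) (hμ_pos : ∀ ε, 0 < ε → 0 < μ ε)
    (hμ : Tendsto μ (𝓝[>] (0 : ℝ)) (𝓝 0)) (hB : IsBubbleFamilyIn χ r x₀ x μ φ V B)
    (hB' : IsBubbleFamilyIn χ r x₀ x μ φ' V' B')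
    (hO : fderiv ℝ (φ 0 ∘ (φ' 0).symm) (φ' 0 x₀) =
      (O.toContinuousLinearEquiv : Euc n →L[ℝ] Euc n)) :
    TendstoZeroH1 n (fun ε => B ε - B' ε) ↔ V' =ᵐ[volume] V ∘ O := by
  have hB₁ := (isBubbleFamilyIn_iff_comp_isometry hn hr.le hχ hχ0 hx hμ_pos hμ hB.charts hB'.charts
    hO).1 hB
  refine ⟨fun hz => ?_, fun hV => ?_⟩
  · obtain ⟨G, hG, -⟩ := hB'.mem_sigma
    obtain ⟨H, hH, -⟩ := hB₁.mem_sigma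
    -- Once `B` is read in the charts `φ'` with model `V ∘ O`, the two profiles differ by the
    -- profile of a single model `V' - V ∘ O`, to which the vanishing result applies.
    have h1 : TendstoZeroH1 n
        (fun ε => bubbleProfile χ (V' - V ∘ O) (φ' ε) (x ε) (μ ε)) := by
      have h2 := (hB₁.tendsto.sub hB'.tendsto).sub hz
      refine h2.congr_ae (Eventually.of_forall fun ε => EventuallyEq.of_eq ?_)
      rw [bubbleProfile_sub]
      abel
    have h3 := ae_eq_zero_of_tendstoZeroH1_bubbleProfile hn hr hχ1 hx hμ_pos hμ hB'.charts
      (hG.sub hn hH) h1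
    filter_upwards [h3] with y hy
    exact sub_eq_zero.1 hy
  · simpa only [sub_sub_sub_cancel_right] using
      (hB₁.congr_ae hχ0 hx hμ_pos hV.symm).tendsto.sub hB'.tendsto

end BubbleComparison
end BubbleFamilies
end

theorem proposition3p2 {n : ℕ} (hn : 3 ≤ n)
    {M : Type*} [MetricSpace M] [ChartedSpace (Euc n) M] [IsManifold 𝓘(ℝ, Euc n) ∞ M]
    [RiemannianBundle (fun p : M => TangentSpace 𝓘(ℝ, Euc n) p)]
    [IsContMDiffRiemannianBundle 𝓘(ℝ, Euc n) ∞ (Euc n)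
      (fun p : M => TangentSpace 𝓘(ℝ, Euc n) p)]
    [IsRiemannianManifold 𝓘(ℝ, Euc n) M]
    [CompactSpace M] [ConnectedSpace M] [MeasurableSpace M] [BorelSpace M]
    (r : ℝ) (hr : 0 < r)
    (χ : ℝ → ℝ) (hχ : ContDiff ℝ ∞ χ)
    (hχ_one : ∀ t, |t| ≤ r / 2 → χ t = 1) (hχ_zero : ∀ t, r ≤ |t| → χ t = 0)
    (x : ℝ → M) (x₀ : M) (hx : Tendsto x (𝓝[>] (0 : ℝ)) (𝓝 x₀))
    (μ : ℝ → ℝ) (hμ_pos : ∀ ε, 0 < ε → 0 < μ ε) (hμ : Tendsto μ (𝓝[>] (0 : ℝ)) (𝓝 0)) :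
    -- two families of normal charts determine a single isometry `O`, for which the criterion holds
    (∀ φ φ' : ℝ → OpenPartialHomeomorph M (Euc n),
      IsNormalChartFamily r x₀ x φ → IsNormalChartFamily r x₀ x φ' →
      ∃ O : Euc n ≃ₗᵢ[ℝ] Euc n,
        Tendsto (fun ε => fderiv ℝ (φ ε ∘ (φ' ε).symm) (φ' ε (x ε))) (𝓝[>] (0 : ℝ))
          (𝓝 (O.toContinuousLinearEquiv : Euc n →L[ℝ] Euc n)) ∧
        (∀ (V V' : Euc n → ℝ) (B B' : ℝ → M → ℝ),
          IsBubbleFamilyIn χ r x₀ x μ φ V B → IsBubbleFamilyIn χ r x₀ x μ φ' V' B' →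
          (TendstoZeroH1 n (fun ε => B ε - B' ε) ↔ V' =ᵐ[volume] V ∘ O) ∧
          (5 ≤ n → TendstoZeroH1 n (fun ε => B ε - B' ε) →
            weylTensorBubble (φ' 0) x₀ V' = weylTensorBubble (φ 0) x₀ V)) ∧
        -- changing the charts amounts to composing the model with `O`
        (∀ (V : Euc n → ℝ) (B : ℝ → M → ℝ),
          IsBubbleFamilyIn χ r x₀ x μ φ V B ↔ IsBubbleFamilyIn χ r x₀ x μ φ' (V ∘ O) B) ∧
        (5 ≤ n → ∀ V ∈ SigmaSol n,
          weylTensorBubble (φ' 0) x₀ (V ∘ O) = weylTensorBubble (φ 0) x₀ V)) ∧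
    -- equivalent families are modeled on functions that agree up to an isometry
    (∀ (V V' : Euc n → ℝ) (B B' : ℝ → M → ℝ),
      IsBubbleFamily χ r x₀ x μ V B → IsBubbleFamily χ r x₀ x μ V' B' →
      TendstoZeroH1 n (fun ε => B ε - B' ε) →
      ∃ O : Euc n ≃ₗᵢ[ℝ] Euc n, V' =ᵐ[volume] V ∘ O) ∧
    -- the functions on which a given family is modeled are exactly one orbit of `O(n)`
    (∀ (V V' : Euc n → ℝ) (B : ℝ → M → ℝ), IsBubbleFamily χ r x₀ x μ V B →
      (IsBubbleFamily χ r x₀ x μ V' B ↔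
        ∃ O : Euc n ≃ₗᵢ[ℝ] Euc n, V' =ᵐ[volume] V ∘ O)) := by
  refine ⟨fun φ φ' h h' => ?_, fun V V' B B' hB hB' hz => ?_, fun V V' B hB => ⟨fun hB' => ?_, ?_⟩⟩
  · obtain ⟨O, hO⟩ := h.exists_isometry hr.le hx h'
    have h0 := h.exists_convergingCharts.choose_spec.2.mem 0 le_rfl
    have h0' := h'.exists_convergingCharts.choose_spec.2.mem 0 le_rfl
    have hW : ∀ V, weylTensorBubble (φ' 0) x₀ (V ∘ O) = weylTensorBubble (φ 0) x₀ V :=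
      (h.isNormalAt_zero hr.le hx).weylTensorBubble_transition h0 h0'
        (h'.isNormalAt_zero hr.le hx) hO
    refine ⟨O, hO ▸ h.tendsto_fderiv_transition hr.le hx h', fun V V' B B' hB hB' => ?_,
      fun V B => isBubbleFamilyIn_iff_comp_isometry hn hr.le hχ hχ_zero hx hμ_pos hμ h h' hO,
      fun _ V _ => hW V⟩
    have hiff := hB.tendstoZeroH1_sub_iff hn hr hχ hχ_one hχ_zero hx hμ_pos hμ hB' hO
    exact ⟨hiff, fun _ hz => (weylTensorBubble_congr_ae _ _ (hiff.1 hz)).trans (hW V)⟩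
  · obtain ⟨φ, hφ⟩ := hB
    obtain ⟨φ', hφ'⟩ := hB'
    obtain ⟨O, hO⟩ := hφ.charts.exists_isometry hr.le hx hφ'.charts
    exact ⟨O, (hφ.tendstoZeroH1_sub_iff hn hr hχ hχ_one hχ_zero hx hμ_pos hμ hφ' hO).1 hz⟩
  · obtain ⟨φ, hφ⟩ := hB
    obtain ⟨φ', hφ'⟩ := hB'
    obtain ⟨O, hO⟩ := hφ.charts.exists_isometry hr.le hx hφ'.charts
    refine ⟨O, (hφ.tendstoZeroH1_sub_iff hn hr hχ hχ_one hχ_zero hx hμ_pos hμ hφ' hO).1 ?_⟩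
    -- The criterion is applied to the family `B` and itself.
    simpa only [sub_self] using tendstoZeroH1_zero
  · rintro ⟨O, hO⟩
    obtain ⟨φ, hφ⟩ := hB
    -- The charts witnessing the model `V ∘ O` are the charts of `V` composed with `O.symm`.
    exact ⟨_, (hφ.rotatedChart O).congr_ae hχ_zero hx hμ_pos hO.symm⟩
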